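/- Let $m\ge 0$ be an integer (for $m=0$ everything is trivial), $\hbar>0$, let $J=\begin{pmatrix}0&-I\\ I&0\end{pmatrix}$ and let $K$ be a complex symmetric $2m\times 2m$ matrix. Write the coordinates of $\mathbb C^{2m}$ as $(\tilde u_1,\dots,\tilde u_m,\tilde v_1,\dots,\tilde v_m)$, put $\Lambda=K+J$, and for functions $f,g$, one a polynomial and the other entire, let $$f*_K g=\sum_{k\ge0}\frac{(i\hbar)^k}{k!\,2^k}\sum\Lambda_{i_1j_1}\cdots\Lambda_{i_kj_k}\,\partial_{i_1}\cdots\partial_{i_k}f\;\partial_{j_1}\cdots\partial_{j_k}g .$$ Put $H_k=\frac1{i\hbar}\tilde u_k\circ\tilde v_k$ with $a\circ b=\frac12(a*_Kb+b*_Ka)$. For entire $F$, $e_*^{i\langle t,H\rangle}*F$ $(t\in\mathbb R^m)$ denotes the (jointly real analytic in $t$ and the coordinates, and entire in the coordinates) solution $f_t$ on all of $\mathbb R^m$ of $\partial_{t_k}f_t=iH_k*_Kf_t$ $(1\le k\le m)$, $f_0=F$; the star-exponential $e_*^{i\langle t,H\rangle}=e_*^{it_1H_1}*\cdots*e_*^{it_mH_m}$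 is the case $F=1$. The product of the pseudo-vacuum $\tilde\varpi_*(0)=(2\pi)^{-m}\int_{[0,2\pi]^m}e_*^{i\langle t,H\rangle}dt$ with $F$ is $\tilde\varpi_*(0)*F=(2\pi)^{-m}\int_{[0,2\pi]^m}e_*^{i\langle t,H\rangle}*F\,dt$; it is called defined if the solution exists and is unique. For each $k$ let $\lambda_k^\pm=K_{\tilde u_k\tilde v_k}\pm\sqrt{K_{\tilde u_k\tilde u_k}K_{\tilde v_k\tilde v_k}}$. The singular points of the $K$-ordered expression of $e_*^{zH_k}$ are the solutions of $(1-\lambda)e^z+(1+\lambda)=0$, $\lambda=\lambda_k^\pm$; they lie on the vertical lines with real parts $\log\left|\frac{1+\lambda_k^\pm}{1-\lambda_k^\pm}\right|\in[-\infty,\infty]$. Let $a_k\le b_k$ be these two real parts; $[a_k,b_k]$ is the exchanging interval. Let $\mathfrak K_0$ be the set of complex symmetric $K$ such that $a_k<0<b_k$ for every $k$ and such that the $m$-parameter star-exponential has no singular point for imaginary parameters, i.e. $\det\bigl(I-JK+\mathrm{diag}(e^{it_1},\dots,e^{it_m},e^{-it_1},\dots,e^{-it_m})(I+JK)\bigr)\neq0$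 for all $t\in\mathbb R^m$ (for $m=1$ the last condition follows from $a_1<0<b_1$). **Proposition.** Let $K\in\mathfrak K_0$. Then the following hold. 1. The star-exponential $e_*^{i\langle t,H\rangle}$ exists for all $t\in\mathbb R^m$, is unique, and is $2\pi$-periodic in each $t_k$. 2. Its period mean $\varpi=\tilde\varpi_*(0)$ is not zero, and $\varpi*\varpi=\varpi$. 3. For every polynomial $p$ in $(\tilde u,\tilde v)$ the product $\varpi*(p*_K\varpi)$ is defined, and the set of these products is $\mathbb C\varpi$, i.e. $\varpi*\mathbb C[\tilde u,\tilde v]*\varpi=\mathbb C\varpi$. 4. For $n\in\mathbb Z^m$ let $w_n$ be the $*_K$-product over $k$ of the star powers $\tilde u_k^{n_k}$ (if $n_k\ge0$) or $\tilde v_k^{-n_k}$ (if $n_k\le0$), and let $N$ be the space of formal finite linear combinations of the $w_n$ (for $m=1$ this is $\mathbb C[\tilde u]+\mathbb C[\tilde v]$). Then $f\mapsto f*_K\varpi$ is a bijection from $N$ onto the regular representation space $\mathbb C[\tilde u,\tilde v]*_K\varpi$. Let $\iota:N\to N$ be the linear map with $\iota(\tilde u_k^p)=\tilde v_k^p$,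 $\iota(\tilde v_k^p)=-\tilde u_k^p$ $(p\ge1)$, $\iota(1)=1$, extended multiplicatively over different $k$. Then $$\langle f*_K\varpi,\;g*_K\varpi\rangle\,\varpi=\varpi*\bigl(f*_K(\iota(g)*_K\varpi)\bigr)$$ defines a nondegenerate bilinear form on the regular representation space, and its restriction to the subspace $(\mathbb C[\tilde u]+\mathbb C[\tilde v])*_K\varpi$, spanned by the $w_n*_K\varpi$ with all $n_k\ge0$ or all $n_k\le0$, is nondegenerate as well. -/

import Mathlib

open Complex MeasureTheory

namespace PseudoVacuum

noncomputable section

/-- Index set of the generators: `Sum.inl k` stands for `ũ_k`, `Sum.inr k` for `ṽ_k`. -/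
abbrev Idx (m : ℕ) : Type := Fin m ⊕ Fin m

/-- Complex valued functions of the `2m` complex variables `(ũ, ṽ)`. -/
abbrev Fn (m : ℕ) : Type := (Idx m → ℂ) → ℂ

/-- The coordinate function of a generator. -/
def gen {m : ℕ} (i : Idx m) : Fn m := fun x => x i

/-- A polynomial in `(ũ, ṽ)`, viewed as a function. -/
def polyFn {m : ℕ} (p : MvPolynomial (Idx m) ℂ) : Fn m := fun x => MvPolynomial.eval x p

/-- The complex partial derivative in the `i`-th variable. -/
def pd {m : ℕ} (i : Idx m) (f : Fn m) : Fn m := fun x => fderiv ℂ f x (Pi.single i 1)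

/-- `biDiff Λ k f g = ∑ Λ_{i₁j₁} ⋯ Λ_{i_k j_k} (∂_{i₁} ⋯ ∂_{i_k} f) (∂_{j₁} ⋯ ∂_{j_k} g)`,
the sum being over all indices `i₁, …, i_k, j₁, …, j_k`. -/
def biDiff {m : ℕ} (Λ : Matrix (Idx m) (Idx m) ℂ) : ℕ → Fn m → Fn m → Fn m
  | 0, f, g => f * g
  | k + 1, f, g => ∑ i, ∑ j, Λ i j • biDiff Λ k (pd i f) (pd j g)

/-- The product `f *_K g = ∑_k (iħ)^k / (k! 2^k) ∑ Λ ⋯ Λ (∂ ⋯ ∂ f) (∂ ⋯ ∂ g)` with `Λ = K + J`,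
`J = [[0, -I], [I, 0]]`. Below, one of the two factors is always a polynomial, so that the sum over
`k` is finite. -/
def starMul {m : ℕ} (ħ : ℝ) (K : Matrix (Idx m) (Idx m) ℂ) (f g : Fn m) : Fn m := fun x =>
  ∑' k : ℕ, (I * (ħ : ℂ)) ^ k / ((k.factorial : ℂ) * 2 ^ k) *
    biDiff (K + Matrix.J (Fin m) ℂ) k f g x

/-- The `K`-ordered expression of `(1/iħ) ũ_k ∘ ṽ_k`, where `a ∘ b = (a * b + b * a) / 2`. -/
def ham {m : ℕ} (ħ : ℝ) (K : Matrix (Idx m) (Idx m) ℂ) (k : Fin m) : Fn m :=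
  (1 / (I * (ħ : ℂ))) • ((1 / 2 : ℂ) •
    (starMul ħ K (gen (Sum.inl k)) (gen (Sum.inr k)) +
      starMul ħ K (gen (Sum.inr k)) (gen (Sum.inl k))))

/-- `f` is the `K`-ordered expression of
`t ↦ e_*^{i t₁ (1/iħ) ũ₁∘ṽ₁} * ⋯ * e_*^{i t_m (1/iħ) ũ_m∘ṽ_m} * F`, i.e. the real analytic solution,
defined for all real `t₁, …, t_m` and entire in `(ũ, ṽ)`, of the evolution equations
`∂f/∂t_k = i ((1/iħ) ũ_k∘ṽ_k) *_K f` with initial value `F`. For `F = 1` this is the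
star-exponential function itself. -/
structure IsStarFlow {m : ℕ} (ħ : ℝ) (K : Matrix (Idx m) (Idx m) ℂ) (F : Fn m)
    (f : (Fin m → ℝ) → Fn m) : Prop where
  init : f 0 = F
  entire : ∀ t, Differentiable ℂ (f t)
  analytic : AnalyticOnNhd ℝ (fun p : (Fin m → ℝ) × (Idx m → ℂ) => f p.1 p.2) Set.univ
  evolution : ∀ (k : Fin m) (t : Fin m → ℝ) (x : Idx m → ℂ),
    HasDerivAt (fun s : ℝ => f (Function.update t k s) x)
      (I * starMul ħ K (ham ħ K k) (f t) x) (t k)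

/-- The mean value `(2π)^{-m} ∫_0^{2π} ⋯ ∫_0^{2π} f(t) dt₁ ⋯ dt_m`. -/
def periodMean {m : ℕ} (f : (Fin m → ℝ) → Fn m) : Fn m := fun x =>
  (((2 * Real.pi : ℝ) : ℂ) ^ m)⁻¹ *
    ∫ t in Set.univ.pi (fun _ : Fin m => Set.Icc (0 : ℝ) (2 * Real.pi)), f t x

/-- `IsPseudoVacMul ħ K F G` says that the product `ϖ̃_*(0) * F` of the pseudo-vacuum with `F` is
defined and equal to `G`: the flow `e_*^{i t₁ H₁} * ⋯ * e_*^{i t_m H_m} * F` exists and is unique,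
and its mean value is `G`. -/
def IsPseudoVacMul {m : ℕ} (ħ : ℝ) (K : Matrix (Idx m) (Idx m) ℂ) (F G : Fn m) : Prop :=
  ∃ f : (Fin m → ℝ) → Fn m, (∀ g, IsStarFlow ħ K F g ↔ g = f) ∧ periodMean f = G

/-- The determinant under the square root in the closed formula for the `K`-ordered expression of
`e_*^{z₁ (1/iħ) ũ₁∘ṽ₁} * ⋯ * e_*^{z_m (1/iħ) ũ_m∘ṽ_m}`, which is
`2^m / √(det (I - κ + e^{-2α} (I + κ)))` times the exponential of a quadratic form, where `κ = J K`
and `e^{-2α} = diag (e^{z₁}, …, e^{z_m}, e^{-z₁}, …, e^{-z_m})`. Its zeros `z` are the singular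
points of that expression. -/
def ampDet {m : ℕ} (K : Matrix (Idx m) (Idx m) ℂ) (z : Fin m → ℂ) : ℂ :=
  (1 - Matrix.J (Fin m) ℂ * K +
    Matrix.diagonal (Sum.elim (fun k => Complex.exp (z k)) (fun k => Complex.exp (-z k))) *
      (1 + Matrix.J (Fin m) ℂ * K)).det

/-- With `c = K_{ũ_k ṽ_k}`, `δ = K_{ũ_k ũ_k}`, `δ' = K_{ṽ_k ṽ_k}`: the number `c + √(δδ')`.
The determinant under the square root for `e_*^{z (1/iħ) ũ_k∘ṽ_k}` is, up to a nonzero constant,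
`e^{-z} ((1 - λ) e^z + (1 + λ)) ((1 - λ') e^z + (1 + λ'))` where `λ, λ'` are `c ± √(δδ')`. -/
def rootPlus {m : ℕ} (K : Matrix (Idx m) (Idx m) ℂ) (k : Fin m) : ℂ :=
  K (Sum.inl k) (Sum.inr k) + (K (Sum.inl k) (Sum.inl k) * K (Sum.inr k) (Sum.inr k)) ^ (1 / 2 : ℂ)

/-- The number `c - √(δδ')`, see `rootPlus`. -/
def rootMinus {m : ℕ} (K : Matrix (Idx m) (Idx m) ℂ) (k : Fin m) : ℂ :=
  K (Sum.inl k) (Sum.inr k) - (K (Sum.inl k) (Sum.inl k) * K (Sum.inr k) (Sum.inr k)) ^ (1 / 2 : ℂ)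

/-- The real part `log |(1 + λ) / (1 - λ)|` of the vertical line of singular points
`(1 - λ) e^z + (1 + λ) = 0`. It is `+∞` for `λ = 1` and `-∞` for `λ = -1`, where there are no such
points. -/
def abscissa (lam : ℂ) : EReal := ENNReal.log (‖1 + lam‖ₑ / ‖1 - lam‖ₑ)

/-- Left end point `a` of the exchanging interval of `e_*^{z (1/iħ) ũ_k∘ṽ_k}`: the smaller of the
real parts of the two lines of singular points. -/
def exchangeLeft {m : ℕ} (K : Matrix (Idx m) (Idx m) ℂ) (k : Fin m) : EReal :=
  min (abscissa (rootPlus K k)) (abscissa (rootMinus K k))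

/-- Right end point `b` of the exchanging interval: the larger of these real parts. -/
def exchangeRight {m : ℕ} (K : Matrix (Idx m) (Idx m) ℂ) (k : Fin m) : EReal :=
  max (abscissa (rootPlus K k)) (abscissa (rootMinus K k))

/-- The class `𝔎₀`: complex symmetric `K` such that `0` lies strictly inside the exchanging interval
of each `e_*^{z (1/iħ) ũ_k∘ṽ_k}`, and the `m`-parameter star-exponential has no singular point for
purely imaginary parameters. For `m = 1` the last condition is automatic, see `mem_frakK0_one`. -/
def frakK0 (m : ℕ) : Set (Matrix (Idx m) (Idx m) ℂ) :=
  {K | K.IsSymm ∧ (∀ k, exchangeLeft K k < 0 ∧ 0 < exchangeRight K k) ∧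
    ∀ t : Fin m → ℝ, ampDet K (fun k => I * (t k : ℂ)) ≠ 0}

/-- The star monomial of `n ∈ ℤ^m`: the `*_K`-product over `k` of `ũ_k^{n_k}` if `n_k ≥ 0` and of
`ṽ_k^{-n_k}` if `n_k ≤ 0`, all powers being star powers. -/
def starMonomial {m : ℕ} (ħ : ℝ) (K : Matrix (Idx m) (Idx m) ℂ) (n : Fin m → ℤ) : Fn m :=
  ((List.finRange m).flatMap fun k =>
      List.replicate (n k).toNat (Sum.inl k : Idx m) ++
        List.replicate (-n k).toNat (Sum.inr k : Idx m)).foldr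
    (fun i F => starMul ħ K (gen i) F) 1

/-- Formal linear combinations of star monomials. For `m = 1` this is `ℂ[ũ] + ℂ[ṽ]`; in general it
is the tensor product over `k` of the spaces `ℂ[ũ_k] + ℂ[ṽ_k]`. -/
abbrev StarPoly (m : ℕ) : Type := (Fin m → ℤ) →₀ ℂ

/-- The `K`-ordered expression of a linear combination of star monomials. -/
def expr {m : ℕ} (ħ : ℝ) (K : Matrix (Idx m) (Idx m) ℂ) (f : StarPoly m) : Fn m :=
  f.sum fun n c => c • starMonomial ħ K n

/-- The linear map `ι` with `ι(ũ_k^p) = ṽ_k^p`, `ι(ṽ_k^p) = -ũ_k^p` for `p ≥ 1` and `ι(1) = 1`,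
extended multiplicatively over different `k`. -/
def iotaMap (m : ℕ) : StarPoly m →ₗ[ℂ] StarPoly m :=
  Finsupp.linearCombination ℂ fun n : Fin m → ℤ =>
    Finsupp.single (-n) (∏ k, if n k < 0 then (-1 : ℂ) else 1)

/-- The regular representation space `ℂ[ũ, ṽ] *_K ϖ` with respect to `ϖ`. -/
def regRep {m : ℕ} (ħ : ℝ) (K : Matrix (Idx m) (Idx m) ℂ) (ϖ : Fn m) : Submodule ℂ (Fn m) :=
  Submodule.span ℂ (Set.range fun p : MvPolynomial (Idx m) ℂ => starMul ħ K (polyFn p) ϖ)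

/-- The subspace `(ℂ[ũ] + ℂ[ṽ]) *_K ϖ` of the regular representation space, spanned by the star
monomials in the `ũ_k` only and those in the `ṽ_k` only. -/
def halfRep {m : ℕ} (ħ : ℝ) (K : Matrix (Idx m) (Idx m) ℂ) (ϖ : Fn m) :
    Submodule ℂ (regRep ħ K ϖ) :=
  Submodule.span ℂ {x | ∃ n : Fin m → ℤ, (0 ≤ n ∨ n ≤ 0) ∧
    (x : Fn m) = starMul ħ K (starMonomial ħ K n) ϖ}

theorem ampDet_one (K : Matrix (Idx 1) (Idx 1) ℂ) (hK : K.IsSymm) (z : Fin 1 → ℂ) :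
    ampDet K z = Complex.exp (-z 0) *
      (((1 - rootPlus K 0) * Complex.exp (z 0) + (1 + rootPlus K 0)) *
        ((1 - rootMinus K 0) * Complex.exp (z 0) + (1 + rootMinus K 0))) := by
  have hs : K (Sum.inr 0) (Sum.inl 0) = K (Sum.inl 0) (Sum.inr 0) := hK.apply _ _
  have hr : ((K (Sum.inl 0) (Sum.inl 0) * K (Sum.inr 0) (Sum.inr 0)) ^ (1 / 2 : ℂ)) ^ 2 =
      K (Sum.inl 0) (Sum.inl 0) * K (Sum.inr 0) (Sum.inr 0) := by
    rw [← Complex.cpow_nat_mul]; simp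
  have he : Complex.exp (z 0) * Complex.exp (-z 0) = 1 := by
    rw [← Complex.exp_add]; simp
  unfold ampDet rootPlus rootMinus
  generalize (K (Sum.inl 0) (Sum.inl 0) * K (Sum.inr 0) (Sum.inr 0)) ^ (1 / 2 : ℂ) = r at *
  rw [← Matrix.det_reindex_self (finSumFinEquiv (m := 1) (n := 1)), Matrix.det_fin_two]
  have e0 : (finSumFinEquiv (m := 1) (n := 1)).symm (0 : Fin 2) = Sum.inl 0 := rfl
  have e1 : (finSumFinEquiv (m := 1) (n := 1)).symm (1 : Fin 2) = Sum.inr 0 := rfl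
  simp only [Matrix.reindex_apply, Matrix.submatrix_apply, e0, e1]
  simp [Matrix.mul_apply, Matrix.J, Matrix.one_apply]
  rw [hs]
  generalize K (Sum.inl 0) (Sum.inl 0) = a at *
  generalize K (Sum.inr 0) (Sum.inr 0) = b at *
  generalize K (Sum.inl 0) (Sum.inr 0) = c at *
  generalize Complex.exp (z 0) = p at *
  generalize Complex.exp (-z 0) = q at *
  linear_combination (2 * c * p + c ^ 2 - c ^ 2 * p - 1 - p + (p - 1) * (a * b)) * he +
    (q - 2 * p * q + p ^ 2 * q) * hr

theorem mem_frakK0_one (K : Matrix (Idx 1) (Idx 1) ℂ) :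
    K ∈ frakK0 1 ↔ K.IsSymm ∧ exchangeLeft K 0 < 0 ∧ 0 < exchangeRight K 0 := by
  have key : ∀ (lam : ℂ) (t : ℝ), abscissa lam ≠ 0 →
      (1 - lam) * Complex.exp (I * (t : ℂ)) + (1 + lam) ≠ 0 := by
    intro lam t hl h
    apply hl
    have hn : ‖1 + lam‖ = ‖1 - lam‖ := by
      have h1 : 1 + lam = -((1 - lam) * Complex.exp (I * (t : ℂ))) := by linear_combination h
      rw [h1, norm_neg, norm_mul, mul_comm I, Complex.norm_exp_ofReal_mul_I, mul_one]
    have he : ‖1 + lam‖ₑ = ‖1 - lam‖ₑ := by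
      rw [← ofReal_norm, hn, ofReal_norm]
    have h0 : ‖1 - lam‖ₑ ≠ 0 := by
      intro h0
      have h2 : 1 - lam = 0 := by simpa using h0
      have h3 : 1 + lam = 0 := by simpa [h2] using he
      have h4 : (2 : ℂ) = 0 := by linear_combination h2 + h3
      norm_num at h4
    rw [abscissa, he, ENNReal.div_self h0 enorm_ne_top, ENNReal.log_one]
  constructor
  · rintro ⟨h1, h2, -⟩
    exact ⟨h1, h2 0⟩
  · rintro ⟨h1, h2, h3⟩
    refine ⟨h1, fun k => ?_, fun t => ?_⟩
    · rw [Subsingleton.elim k 0]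
      exact ⟨h2, h3⟩
    · have hp : abscissa (rootPlus K 0) ≠ 0 ∧ abscissa (rootMinus K 0) ≠ 0 := by
        unfold exchangeLeft at h2
        unfold exchangeRight at h3
        rcases min_lt_iff.1 h2 with a | a <;> rcases lt_max_iff.1 h3 with b | b
        · exact absurd (a.trans b) (lt_irrefl _)
        · exact ⟨a.ne, b.ne'⟩
        · exact ⟨b.ne', a.ne⟩
        · exact absurd (a.trans b) (lt_irrefl _)
      rw [ampDet_one K h1]
      exact mul_ne_zero (Complex.exp_ne_zero _)
        (mul_ne_zero (key _ (t 0) hp.1) (key _ (t 0) hp.2))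

end

end PseudoVacuum

open PseudoVacuum

/-! ### Entire functions, their derivations, and the bidifferential operators -/

namespace PseudoVacuum
noncomputable section

/-! Left star multiplication by a generator is the first order operator `x_i + (iħ/2) ∑_j Λ_ij ∂_j`
on entire functions (`genOp`), and these operators satisfy the canonical commutation relations
(`lOp_comm`). Hence the generators are ladder operators for the Hamiltonians `H_k` (`hamOp_lOp`),
and on a joint eigenfunction of integral weight `n` the products `ũ_k * ṽ_k` and `ṽ_k * ũ_k` act by
`iħ (n_k - 1/2)` and `iħ (n_k + 1/2)`. These scalars never vanish, so no ladder breaks off: a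
nonzero vector of integral weight generates one nonzero vector, up to scalars, in every weight of
the lattice `ℤ^m`.

The star-exponential is a Gaussian with amplitude `exp (-φ/2)`, where `φ` is a logarithm of the
amplitude determinant normalized at `t = 0`, and with an exponent given by the matrix `qMat`. Matrix
identities show that it solves the evolution equations (`starExp_evolution`). Solutions are unique
because all their derivatives at the origin of the parameters are prescribed and they are analytic
(`IsStarFlow.unique`). Periodicity is a question about the square root of the determinant. The
parameter space is simply connected, so `φ` exists. Along the `k`-th axis the determinant is `C (1 +
p e^{-is}) (1 + q e^{is})`, and `a_k < 0 < b_k` gives `|p|, |q| < 1`. The winding number is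
therefore zero and `φ` itself is periodic (`exists_log_det`).

Let `f_n` be the Fourier coefficients of the star-exponential. Integration by parts gives `H_k * f_n
= n_k f_n` (`isWeight_starCoef`). The star-exponential intertwines left and right multiplication by
a generator up to a phase, so `f_n * x_i = x_i * f_{n - wt i}` (`rOp_starCoef`). If the
pseudo-vacuum `f_0` were zero, the ladders would force every `f_n` to vanish, although the
star-exponential equals 1 at `t = 0` (`starCoef_zero_ne_zero`).

Once `ϖ = f_0` is a nonzero vector of weight 0, the rest is linear algebra. The flow through a
finite sum of weight vectors multiplies each by its character, so the product with `ϖ` is the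
projection to weight 0 (`isPseudoVacMul_sum`). The vectors `w_n * ϖ` form a basis of the regular
representation space. As `ι` sends `w_n` to `± w_{-n}` and `w_n * w_{-n} * ϖ` is a nonzero multiple
of `ϖ`, the form is diagonal with nonzero entries in this basis. It remains nondegenerate on the
span of any set of basis vectors. -/

theorem differentiable_pd {m : ℕ} {f : Fn m} (hf : Differentiable ℂ f)
    (hA : AnalyticOnNhd ℝ f Set.univ) (i : Idx m) :
    Differentiable ℂ (pd i f) ∧ AnalyticOnNhd ℝ (pd i f) Set.univ := by
  have hre : ∀ x, fderiv ℝ f x = (fderiv ℂ f x).restrictScalars ℝ := fun x =>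
    ((hf x).hasFDerivAt.restrictScalars ℝ).fderiv
  have hF : AnalyticOnNhd ℝ (fderiv ℝ f) Set.univ := hA.fderiv
  have hpd : pd i f = fun x => fderiv ℝ f x (Pi.single i 1) := by
    funext x
    simp [pd, hre]
  have happ : ∀ v x, HasFDerivAt (fun y => fderiv ℝ f y v)
      ((ContinuousLinearMap.apply ℝ ℂ v).comp (fderiv ℝ (fderiv ℝ f) x)) x := fun v x =>
    (ContinuousLinearMap.apply ℝ ℂ v).hasFDerivAt.comp x (hF x trivial).differentiableAt.hasFDerivAt
  refine ⟨fun x => ?_, ?_⟩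
  -- The second real derivative is complex linear in its second argument because each first
  -- derivative is. By symmetry it is complex linear in the first argument as well, and this is
  -- complex differentiability of `pd i f`.
  · have hsymm : IsSymmSndFDerivAt ℝ f x :=
      (hA x trivial).contDiffAt.isSymmSndFDerivAt (n := ⊤) (by simp)
    have hlin : ∀ (c : ℂ) v, fderiv ℝ (fderiv ℝ f) x (c • v) (Pi.single i 1) =
        c * fderiv ℝ (fderiv ℝ f) x v (Pi.single i 1) := by
      intro c v
      rw [hsymm, hsymm v]
      have h1 := happ (c • v) x
      have h2 := (happ v x).const_mul c
      have h3 : (fun y => fderiv ℝ f y (c • v)) = fun y => c * fderiv ℝ f y v := by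
        funext y
        simp [hre]
      rw [h3] at h1
      have h4 := congrArg (fun g => g (Pi.single i 1)) (h1.unique h2)
      simpa using h4
    rw [hpd]
    refine (differentiableAt_iff_restrictScalars ℝ (happ _ x).differentiableAt).2
      ⟨⟨⟨⟨fun v => fderiv ℝ (fderiv ℝ f) x v (Pi.single i 1), by simp⟩, hlin⟩, ?_⟩, ?_⟩
    · exact (((ContinuousLinearMap.apply ℝ ℂ (Pi.single i (1 : ℂ) : Idx m → ℂ)).comp
        (fderiv ℝ (fderiv ℝ f) x))).continuous
    · rw [(happ _ x).fderiv]
      rfl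
  · rw [hpd]
    exact fun x hx => ((ContinuousLinearMap.apply ℝ ℂ (Pi.single i (1 : ℂ) : Idx m → ℂ)).analyticAt
      _).comp (hF x hx)

/-- The algebra of entire functions. -/
def Entire (m : ℕ) : Subalgebra ℂ (Fn m) where
  carrier := {f | Differentiable ℂ f ∧ AnalyticOnNhd ℝ f Set.univ}
  mul_mem' hf hg := ⟨hf.1.mul hg.1, hf.2.mul hg.2⟩
  add_mem' hf hg := ⟨hf.1.add hg.1, hf.2.add hg.2⟩
  algebraMap_mem' c := ⟨differentiable_const c, analyticOnNhd_const⟩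

variable {m : ℕ}

theorem pd_add {f g : Fn m} (hf : Differentiable ℂ f) (hg : Differentiable ℂ g) (i : Idx m) :
    pd i (f + g) = pd i f + pd i g := by
  funext x
  simp [pd, fderiv_add (hf x) (hg x)]

theorem pd_smul {f : Fn m} (hf : Differentiable ℂ f) (c : ℂ) (i : Idx m) :
    pd i (c • f) = c • pd i f := by
  funext x
  simp [pd, fderiv_const_smul (hf x)]

theorem pd_mul {f g : Fn m} (hf : Differentiable ℂ f) (hg : Differentiable ℂ g) (i : Idx m) :
    pd i (f * g) = f * pd i g + g * pd i f := by
  funext x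
  simp [pd, fderiv_mul (hf x) (hg x)]

/-- The partial derivative as a derivation of the algebra of entire functions. -/
def D (i : Idx m) : Derivation ℂ (Entire m) (Entire m) :=
  Derivation.mk'
    { toFun := fun f => ⟨pd i f, differentiable_pd f.2.1 f.2.2 i⟩
      map_add' := fun f g => Subtype.ext (pd_add f.2.1 g.2.1 i)
      map_smul' := fun c f => Subtype.ext (pd_smul f.2.1 c i) }
    fun f g => Subtype.ext (pd_mul f.2.1 g.2.1 i)

@[simp] theorem coe_D (i : Idx m) (f : Entire m) : (D i f : Fn m) = pd i f := rfl

theorem D_comm (i j : Idx m) (f : Entire m) : D i (D j f) = D j (D i f) := by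
  apply Subtype.ext
  funext x
  have hre : ∀ {g : Fn m}, Differentiable ℂ g → ∀ x,
      fderiv ℝ g x = (fderiv ℂ g x).restrictScalars ℝ := fun hg x =>
    ((hg x).hasFDerivAt.restrictScalars ℝ).fderiv
  have hF : AnalyticOnNhd ℝ (fderiv ℝ (f : Fn m)) Set.univ := f.2.2.fderiv
  have key : ∀ i j : Idx m, (D i (D j f) : Fn m) x =
      fderiv ℝ (fderiv ℝ (f : Fn m)) x (Pi.single i 1) (Pi.single j 1) := by
    intro i j
    have h1 : (D j f : Fn m) = fun x => fderiv ℝ (f : Fn m) x (Pi.single j 1) := by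
      funext x
      simp [pd, hre f.2.1]
    have h2 : (D i (D j f) : Fn m) x = fderiv ℝ (D j f : Fn m) x (Pi.single i 1) := by
      rw [hre (D j f).2.1]
      rfl
    have h3 : HasFDerivAt (fun x => fderiv ℝ (f : Fn m) x (Pi.single j 1)) _ x :=
      (ContinuousLinearMap.apply ℝ ℂ (Pi.single j (1 : ℂ) : Idx m → ℂ)).hasFDerivAt.comp x
        (hF x trivial).differentiableAt.hasFDerivAt
    rw [h2, h1, h3.fderiv]
    rfl
  rw [key, key, (f.2.2 x trivial).contDiffAt.isSymmSndFDerivAt (n := ⊤) (by simp)]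

/-- The coordinate functions. -/
def coord (i : Idx m) : Entire m :=
  ⟨gen i, (ContinuousLinearMap.proj (R := ℂ) (φ := fun _ : Idx m => ℂ) i).differentiable,
    fun x _ => (ContinuousLinearMap.proj (R := ℝ) (φ := fun _ : Idx m => ℂ) i).analyticAt x⟩

@[simp] theorem coe_coord (i : Idx m) : (coord i : Fn m) = gen i := rfl

@[simp] theorem D_coord (i j : Idx m) : D i (coord j) = if i = j then 1 else 0 := by
  apply Subtype.ext
  funext x
  have h : fderiv ℂ (gen j : Fn m) x = ContinuousLinearMap.proj j :=
    (ContinuousLinearMap.proj (R := ℂ) (φ := fun _ : Idx m => ℂ) j).fderiv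
  simp only [coe_D, coe_coord, pd, h]
  by_cases hij : i = j
  · subst hij
    simp
  · simp [hij, Ne.symm hij]

/-- Bidifferential operators on entire functions. -/
def biDiffE (Λ : Matrix (Idx m) (Idx m) ℂ) : ℕ → Entire m → Entire m → Entire m
  | 0, f, g => f * g
  | k + 1, f, g => ∑ i, ∑ j, Λ i j • biDiffE Λ k (D i f) (D j g)

variable (Λ : Matrix (Idx m) (Idx m) ℂ)

theorem coe_biDiffE (k : ℕ) (f g : Entire m) : (biDiffE Λ k f g : Fn m) = biDiff Λ k f g := by
  induction k generalizing f g with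
  | zero => rfl
  | succ k ih => simp [biDiffE, biDiff, ih]

theorem biDiffE_add_left (k : ℕ) (f f' g : Entire m) :
    biDiffE Λ k (f + f') g = biDiffE Λ k f g + biDiffE Λ k f' g := by
  induction k generalizing f f' g with
  | zero => exact add_mul _ _ _
  | succ k ih => simp [biDiffE, ih, Finset.sum_add_distrib, -Fintype.sum_sum_type]

theorem biDiffE_add_right (k : ℕ) (f g g' : Entire m) :
    biDiffE Λ k f (g + g') = biDiffE Λ k f g + biDiffE Λ k f g' := by
  induction k generalizing f g g' with
  | zero => exact mul_add _ _ _
  | succ k ih => simp [biDiffE, ih, Finset.sum_add_distrib, -Fintype.sum_sum_type]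

theorem biDiffE_smul_left (k : ℕ) (c : ℂ) (f g : Entire m) :
    biDiffE Λ k (c • f) g = c • biDiffE Λ k f g := by
  induction k generalizing f g with
  | zero => exact smul_mul_assoc _ _ _
  | succ k ih => simp [biDiffE, ih, Finset.smul_sum, smul_comm c]

theorem biDiffE_smul_right (k : ℕ) (c : ℂ) (f g : Entire m) :
    biDiffE Λ k f (c • g) = c • biDiffE Λ k f g := by
  induction k generalizing f g with
  | zero => exact mul_smul_comm _ _ _
  | succ k ih => simp [biDiffE, ih, Finset.smul_sum, smul_comm c]

theorem D_biDiffE (k : ℕ) (j : Idx m) (f g : Entire m) :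
    D j (biDiffE Λ k f g) = biDiffE Λ k (D j f) g + biDiffE Λ k f (D j g) := by
  induction k generalizing f g with
  | zero =>
    simp only [biDiffE, Derivation.leibniz, smul_eq_mul]
    ring
  | succ k ih => simp [biDiffE, ih, Finset.sum_add_distrib, -Fintype.sum_sum_type, D_comm j]

theorem biDiffE_zero_left (k : ℕ) (g : Entire m) : biDiffE Λ k 0 g = 0 := by
  simpa using biDiffE_smul_left Λ k 0 0 g

/-- A coordinate survives at most one differentiation, and any one of the `k + 1` derivatives may be
the one that hits it. This accounts for the factor `k + 1`. -/
theorem biDiffE_coord_mul (k : ℕ) (i : Idx m) (f g : Entire m) :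
    biDiffE Λ (k + 1) (coord i * f) g = coord i * biDiffE Λ (k + 1) f g +
      ((k : ℂ) + 1) • ∑ j, Λ i j • biDiffE Λ k f (D j g) := by
  have step : ∀ (k : ℕ) (f g : Entire m), biDiffE Λ (k + 1) (coord i * f) g =
      ∑ a, ∑ b, Λ a b • biDiffE Λ k (coord i * D a f) (D b g) +
        ∑ j, Λ i j • biDiffE Λ k f (D j g) := by
    intro k f g
    have h : ∀ a : Idx m, f * (if a = i then 1 else 0 : Entire m) = (if a = i then (1 : ℂ) else 0) • f := by
      intro a
      split_ifs <;> simp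
    simp only [biDiffE, Derivation.leibniz, D_coord, smul_eq_mul, h, biDiffE_add_left,
      biDiffE_smul_left, smul_add, Finset.sum_add_distrib]
    congr 1
    rw [Finset.sum_eq_single i]
    · simp
    · intro a _ ha
      simp [ha]
    · simp
  induction k generalizing f g with
  | zero =>
    rw [step]
    simp [biDiffE, Finset.mul_sum, mul_assoc, -Fintype.sum_sum_type]
  | succ k ih =>
    rw [step]
    simp only [ih]
    have h1 : coord i * biDiffE Λ (k + 1 + 1) f g =
        ∑ a, ∑ b, Λ a b • (coord i * biDiffE Λ (k + 1) (D a f) (D b g)) := by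
      rw [biDiffE]
      simp only [Finset.mul_sum, mul_smul_comm]
    have h2 : ∑ j, Λ i j • biDiffE Λ (k + 1) f (D j g) = ∑ a, ∑ b, Λ a b •
        ∑ j, Λ i j • biDiffE Λ k (D a f) (D j (D b g)) := by
      simp only [biDiffE, Finset.smul_sum]
      rw [Finset.sum_comm]
      refine Finset.sum_congr rfl fun a _ => ?_
      rw [Finset.sum_comm]
      refine Finset.sum_congr rfl fun b _ => Finset.sum_congr rfl fun j _ => ?_
      rw [smul_comm, D_comm]
    rw [h1]
    simp only [smul_add, Finset.sum_add_distrib]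
    push_cast
    -- The coefficient `(k + 1) + 1` splits into `k + 1` from the induction hypothesis and 1 from
    -- the outermost derivative hitting the coordinate.
    rw [add_smul _ (1 : ℂ), one_smul, h2, add_assoc, Finset.smul_sum]
    simp only [Finset.smul_sum, smul_comm ((k : ℂ) + 1)]

end
end PseudoVacuum

/-! ### Star products with polynomials as operators on entire functions -/

namespace PseudoVacuum
noncomputable section
variable {m : ℕ} (Λ : Matrix (Idx m) (Idx m) ℂ)

/-- Polynomials as entire functions. -/
def polyE (m : ℕ) : MvPolynomial (Idx m) ℂ →ₐ[ℂ] Entire m := MvPolynomial.aeval coord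

theorem coe_polyE (p : MvPolynomial (Idx m) ℂ) : (polyE m p : Fn m) = polyFn p := by
  funext x
  let ev : Entire m →ₐ[ℂ] ℂ := (Pi.evalAlgHom ℂ (fun _ : Idx m → ℂ => ℂ) x).comp (Entire m).val
  have h : ev.comp (polyE m) = MvPolynomial.aeval x := by
    ext i
    simp [polyE, ev, gen]
  have := congrArg (fun g => g p) h
  simpa [ev, polyFn] using this

@[simp] theorem polyE_X (i : Idx m) : polyE m (MvPolynomial.X i) = coord i := by simp [polyE]

theorem D_polyE (i : Idx m) (p : MvPolynomial (Idx m) ℂ) :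
    D i (polyE m p) = polyE m (MvPolynomial.pderiv i p) := by
  classical
  induction p using MvPolynomial.induction_on with
  | C a =>
    rw [MvPolynomial.pderiv_C, map_zero, ← MvPolynomial.algebraMap_eq, AlgHom.commutes]
    exact (D i).map_algebraMap a
  | add p q hp hq => simp [hp, hq]
  | mul_X p j hp =>
    rw [map_mul, Derivation.leibniz, Derivation.leibniz, hp, map_add, polyE_X, D_coord,
      MvPolynomial.pderiv_X, smul_eq_mul, smul_eq_mul, smul_eq_mul, smul_eq_mul, map_mul, map_mul,
      polyE_X]
    congr 2
    by_cases h : i = j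
    · subst h; simp
    · rw [if_neg h, Pi.single_eq_of_ne (Ne.symm h), map_zero]

theorem biDiffE_C (k : ℕ) (a : ℂ) (f : Entire m) :
    biDiffE Λ (k + 1) (polyE m (MvPolynomial.C a)) f = 0 := by
  simp [biDiffE, biDiffE_zero_left, -Fintype.sum_sum_type]

theorem exists_biDiffE_eq_zero (p : MvPolynomial (Idx m) ℂ) :
    ∃ N, ∀ k, N ≤ k → ∀ f, biDiffE Λ k (polyE m p) f = 0 := by
  induction p using MvPolynomial.induction_on with
  | C a =>
    refine ⟨1, fun k hk f => ?_⟩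
    obtain ⟨k, rfl⟩ := Nat.exists_eq_add_of_le' hk
    exact biDiffE_C Λ k a f
  | add p q hp hq =>
    obtain ⟨N, hN⟩ := hp
    obtain ⟨N', hN'⟩ := hq
    refine ⟨max N N', fun k hk f => ?_⟩
    rw [map_add, biDiffE_add_left, hN k (le_trans (le_max_left _ _) hk),
      hN' k (le_trans (le_max_right _ _) hk), add_zero]
  | mul_X p i hp =>
    obtain ⟨N, hN⟩ := hp
    refine ⟨N + 1, fun k hk f => ?_⟩
    obtain ⟨k, rfl⟩ : ∃ l, k = l + 1 := Nat.exists_eq_add_of_le' (le_trans (by omega) hk)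
    rw [mul_comm, map_mul, polyE_X, biDiffE_coord_mul, hN _ (by omega)]
    simp [hN k (by omega)]

variable (ħ : ℝ)

/-- The coefficients of the star product. -/
def coef (k : ℕ) : ℂ := (I * (ħ : ℂ)) ^ k / ((k.factorial : ℂ) * 2 ^ k)

/-- The factor `k + 1` produced by `biDiffE_coord_mul` is absorbed by the factorial, so that each
contraction with a coordinate costs exactly `iħ/2`. -/
theorem coef_succ (k : ℕ) : coef ħ (k + 1) * ((k : ℂ) + 1) = I * ħ / 2 * coef ħ k := by
  have h1 : ((k : ℂ) + 1) ≠ 0 := by exact_mod_cast k.succ_ne_zero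
  have h2 : (k.factorial : ℂ) ≠ 0 := by exact_mod_cast k.factorial_ne_zero
  rw [coef, coef, Nat.factorial_succ]
  push_cast
  field_simp
  ring

/-- Left multiplication by a polynomial, as an operation on entire functions. -/
def polyStar (p : MvPolynomial (Idx m) ℂ) (f : Entire m) : Entire m :=
  ∑ᶠ k, coef ħ k • biDiffE Λ k (polyE m p) f

/-- The cutoff depends only on the polynomial and may be raised at will. Several star products can
thus be compared as finite sums over one common range. -/
theorem exists_polyStar_eq (p : MvPolynomial (Idx m) ℂ) : ∃ N, ∀ n, N ≤ n → ∀ f,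
    polyStar Λ ħ p f = ∑ k ∈ Finset.range n, coef ħ k • biDiffE Λ k (polyE m p) f := by
  obtain ⟨N, hN⟩ := exists_biDiffE_eq_zero Λ p
  refine ⟨N, fun n hn f => finsum_eq_sum_of_support_subset _ fun k hk => ?_⟩
  simp only [Finset.coe_range, Set.mem_Iio]
  by_contra h
  exact hk (by simp [hN k (by omega)])

theorem starMul_polyFn (K : Matrix (Idx m) (Idx m) ℂ) (p : MvPolynomial (Idx m) ℂ) (f : Entire m) :
    starMul ħ K (polyFn p) f = polyStar (K + Matrix.J (Fin m) ℂ) ħ p f := by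
  funext x
  obtain ⟨N, hN⟩ := exists_biDiffE_eq_zero (K + Matrix.J (Fin m) ℂ) p
  obtain ⟨N', hN'⟩ := exists_polyStar_eq (K + Matrix.J (Fin m) ℂ) ħ p
  rw [hN' _ (le_max_right N N'), starMul, tsum_eq_sum (s := Finset.range (max N N'))]
  · simp [← coe_polyE, ← coe_biDiffE, coef]
  · intro k hk
    have hk' : N ≤ k := le_trans (le_max_left _ _) (by simpa using hk)
    rw [← coe_polyE, ← coe_biDiffE, hN k hk']
    simp

theorem polyStar_add_left (p q : MvPolynomial (Idx m) ℂ) (f : Entire m) :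
    polyStar Λ ħ (p + q) f = polyStar Λ ħ p f + polyStar Λ ħ q f := by
  obtain ⟨a, ha⟩ := exists_polyStar_eq Λ ħ p
  obtain ⟨b, hb⟩ := exists_polyStar_eq Λ ħ q
  obtain ⟨c, hc⟩ := exists_polyStar_eq Λ ħ (p + q)
  rw [ha (a + b + c) (by omega), hb (a + b + c) (by omega), hc (a + b + c) (by omega)]
  simp [biDiffE_add_left, Finset.sum_add_distrib]

theorem polyStar_smul_left (c : ℂ) (p : MvPolynomial (Idx m) ℂ) (f : Entire m) :
    polyStar Λ ħ (c • p) f = c • polyStar Λ ħ p f := by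
  obtain ⟨a, ha⟩ := exists_polyStar_eq Λ ħ p
  obtain ⟨b, hb⟩ := exists_polyStar_eq Λ ħ (c • p)
  rw [ha (a + b) (by omega), hb (a + b) (by omega)]
  simp [biDiffE_smul_left, Finset.smul_sum, smul_comm c]

theorem polyStar_add_right (p : MvPolynomial (Idx m) ℂ) (f g : Entire m) :
    polyStar Λ ħ p (f + g) = polyStar Λ ħ p f + polyStar Λ ħ p g := by
  obtain ⟨a, ha⟩ := exists_polyStar_eq Λ ħ p
  simp only [ha a le_rfl, biDiffE_add_right, smul_add, Finset.sum_add_distrib]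

theorem polyStar_smul_right (c : ℂ) (p : MvPolynomial (Idx m) ℂ) (f : Entire m) :
    polyStar Λ ħ p (c • f) = c • polyStar Λ ħ p f := by
  obtain ⟨a, ha⟩ := exists_polyStar_eq Λ ħ p
  simp only [ha a le_rfl, biDiffE_smul_right, Finset.smul_sum, smul_comm c]

/-- The polynomial star operation as a bilinear map. -/
def polyStarL : MvPolynomial (Idx m) ℂ →ₗ[ℂ] Entire m →ₗ[ℂ] Entire m :=
  LinearMap.mk₂ ℂ (polyStar Λ ħ) (polyStar_add_left Λ ħ) (polyStar_smul_left Λ ħ)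
    (polyStar_add_right Λ ħ) (fun c p f => polyStar_smul_right Λ ħ c p f)

@[simp] theorem polyStarL_apply (p : MvPolynomial (Idx m) ℂ) (f : Entire m) :
    polyStarL Λ ħ p f = polyStar Λ ħ p f := rfl

theorem polyStar_one (f : Entire m) : polyStar Λ ħ 1 f = f := by
  rw [polyStar, finsum_eq_single _ 0]
  · simp [coef, biDiffE]
  · intro k hk
    obtain ⟨k, rfl⟩ := Nat.exists_eq_succ_of_ne_zero hk
    rw [← MvPolynomial.C_1, Nat.succ_eq_add_one, biDiffE_C, smul_zero]

theorem polyStar_X_mul (i : Idx m) (p : MvPolynomial (Idx m) ℂ) (f : Entire m) :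
    polyStar Λ ħ (MvPolynomial.X i * p) f = coord i * polyStar Λ ħ p f +
      (I * ħ / 2) • ∑ j, Λ i j • polyStar Λ ħ p (D j f) := by
  obtain ⟨a, ha⟩ := exists_polyStar_eq Λ ħ p
  obtain ⟨b, hb⟩ := exists_polyStar_eq Λ ħ (MvPolynomial.X i * p)
  rw [hb (a + b + 1) (by omega), ha (a + b + 1) (by omega)]
  simp only [ha (a + b) (by omega)]
  rw [Finset.sum_range_succ', Finset.sum_range_succ']
  have h1 : ∀ k, coef ħ (k + 1) • biDiffE Λ (k + 1) (polyE m (MvPolynomial.X i * p)) f =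
      coord i * coef ħ (k + 1) • biDiffE Λ (k + 1) (polyE m p) f +
        (I * ħ / 2) • ∑ j, Λ i j • coef ħ k • biDiffE Λ k (polyE m p) (D j f) := by
    intro k
    rw [map_mul, polyE_X, biDiffE_coord_mul, smul_add, smul_smul, coef_succ, mul_smul_comm, mul_smul]
    simp only [Finset.smul_sum, smul_comm (coef ħ k)]
  rw [Finset.sum_congr rfl fun k _ => h1 k, Finset.sum_add_distrib, ← Finset.mul_sum,
    ← Finset.smul_sum, Finset.sum_comm]
  simp only [← Finset.smul_sum, biDiffE, map_mul, polyE_X, mul_add, mul_assoc, mul_smul_comm]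
  abel

theorem D_polyStar (j : Idx m) (p : MvPolynomial (Idx m) ℂ) (f : Entire m) :
    D j (polyStar Λ ħ p f) =
      polyStar Λ ħ (MvPolynomial.pderiv j p) f + polyStar Λ ħ p (D j f) := by
  obtain ⟨a, ha⟩ := exists_polyStar_eq Λ ħ p
  obtain ⟨b, hb⟩ := exists_polyStar_eq Λ ħ (MvPolynomial.pderiv j p)
  rw [hb (a + b) (by omega), ha (a + b) (by omega), ha (a + b) (by omega)]
  simp [D_biDiffE, D_polyE, Finset.sum_add_distrib, -Fintype.sum_sum_type]

/-- Left star multiplication by a generator. -/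
def genOp (i : Idx m) : Entire m →ₗ[ℂ] Entire m :=
  LinearMap.mulLeft ℂ (coord i) + (I * ħ / 2) • ∑ j, Λ i j • (D j : Entire m →ₗ[ℂ] Entire m)

theorem genOp_apply (i : Idx m) (f : Entire m) :
    genOp Λ ħ i f = coord i * f + (I * ħ / 2) • ∑ j, Λ i j • D j f := by
  simp [genOp, LinearMap.sum_apply, -Fintype.sum_sum_type]

theorem polyStar_X (i : Idx m) (f : Entire m) :
    polyStar Λ ħ (MvPolynomial.X i) f = genOp Λ ħ i f := by
  rw [← mul_one (MvPolynomial.X i), polyStar_X_mul, genOp_apply]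
  simp only [polyStar_one]

/-- The star product of a generator and a polynomial. -/
def genMul (i : Idx m) (p : MvPolynomial (Idx m) ℂ) : MvPolynomial (Idx m) ℂ :=
  MvPolynomial.X i * p + (I * ħ / 2) • ∑ j, Λ i j • MvPolynomial.pderiv j p

theorem polyE_genMul (i : Idx m) (p : MvPolynomial (Idx m) ℂ) :
    polyE m (genMul Λ ħ i p) = genOp Λ ħ i (polyE m p) := by
  simp [genMul, genOp_apply, D_polyE, -Fintype.sum_sum_type]

/-- The only case of associativity that is needed: `(x_i * p) * f = x_i * (p * f)`. The derivatives
`∂_j p` in `genMul` supply the half of the Leibniz rule `D_polyStar` that is missing from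
`polyStar_X_mul`. -/
theorem polyStar_genMul (i : Idx m) (p : MvPolynomial (Idx m) ℂ) (f : Entire m) :
    polyStar Λ ħ (genMul Λ ħ i p) f = genOp Λ ħ i (polyStar Λ ħ p f) := by
  rw [genMul, polyStar_add_left, polyStar_smul_left, polyStar_X_mul, genOp_apply]
  simp only [← polyStarL_apply, map_sum, map_smul, LinearMap.sum_apply, LinearMap.smul_apply]
  simp only [polyStarL_apply, D_polyStar, smul_add, Finset.sum_add_distrib]
  abel

theorem genOp_coord_mul (i j : Idx m) (f : Entire m) :
    genOp Λ ħ i (coord j * f) = coord j * genOp Λ ħ i f + (I * ħ / 2 * Λ i j) • f := by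
  have h : ∀ a : Idx m, f * (if a = j then 1 else 0 : Entire m) = (if a = j then (1 : ℂ) else 0) • f := by
    intro a
    split_ifs <;> simp
  simp only [genOp_apply, Derivation.leibniz, D_coord, smul_eq_mul, h, smul_add,
    Finset.sum_add_distrib, mul_add, mul_smul_comm, Finset.mul_sum]
  have h2 : ∑ x, Λ i x • (if x = j then (1 : ℂ) else 0) • f = Λ i j • f := by
    rw [Finset.sum_eq_single j] <;> simp +contextual
  rw [h2, smul_smul, mul_left_comm]
  abel

theorem genOp_D (i j : Idx m) (f : Entire m) :
    D j (genOp Λ ħ i f) = genOp Λ ħ i (D j f) + (if j = i then (1 : ℂ) else 0) • f := by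
  have h : D j (∑ l, Λ i l • D l f) = ∑ l, Λ i l • D l (D j f) := by
    rw [map_sum]
    exact Finset.sum_congr rfl fun l _ => by rw [Derivation.map_smul, D_comm]
  rw [genOp_apply, genOp_apply, map_add, Derivation.map_smul, h, Derivation.leibniz, D_coord, smul_eq_mul,
    smul_eq_mul]
  split_ifs <;> simp [-Fintype.sum_sum_type]
  abel

/-- Commutation relation of two first order operators of the type of `genOp`. -/
theorem genOp_comm (Λ' : Matrix (Idx m) (Idx m) ℂ) (i j : Idx m) (f : Entire m) :
    genOp Λ ħ i (genOp Λ' ħ j f) =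
      genOp Λ' ħ j (genOp Λ ħ i f) + (I * ħ / 2 * (Λ i j - Λ' j i)) • f := by
  rw [genOp_apply Λ' ħ j f, map_add, genOp_coord_mul, map_smul, map_sum, genOp_apply Λ' ħ j]
  simp only [map_smul, genOp_D, smul_add, Finset.sum_add_distrib]
  have h2 : ∑ x, Λ' j x • (if x = i then (1 : ℂ) else 0) • f = Λ' j i • f := by
    rw [Finset.sum_eq_single i] <;> simp +contextual
  rw [h2, smul_smul, mul_sub, sub_smul]
  abel

end
end PseudoVacuum

/-! ### Commutation relations, weights, and words in the generators -/

namespace PseudoVacuum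
noncomputable section
variable {m : ℕ} (ħ : ℝ) (K : Matrix (Idx m) (Idx m) ℂ)

/-- Left multiplication by a generator for the product `*_K`. -/
abbrev lOp (i : Idx m) : Entire m →ₗ[ℂ] Entire m := genOp (K + Matrix.J (Fin m) ℂ) ħ i

/-- Left multiplication by the Hamiltonian `(1/iħ) ũ_k ∘ ṽ_k`. -/
def hamOp (k : Fin m) : Entire m →ₗ[ℂ] Entire m :=
  (1 / (I * (ħ : ℂ))) • ((1 / 2 : ℂ) •
    (lOp ħ K (Sum.inl k) ∘ₗ lOp ħ K (Sum.inr k) + lOp ħ K (Sum.inr k) ∘ₗ lOp ħ K (Sum.inl k)))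

theorem polyFn_X (i : Idx m) : polyFn (MvPolynomial.X i) = gen i := by
  funext x
  simp [polyFn, gen]

theorem starMul_gen (i : Idx m) (f : Entire m) : starMul ħ K (gen i) f = lOp ħ K i f := by
  rw [← polyFn_X, starMul_polyFn, polyStar_X]

theorem starMul_gen_polyFn (i : Idx m) (p : MvPolynomial (Idx m) ℂ) :
    starMul ħ K (gen i) (polyFn p) = polyFn (genMul (K + Matrix.J (Fin m) ℂ) ħ i p) := by
  rw [← coe_polyE, starMul_gen, ← polyE_genMul, coe_polyE]

theorem starMul_ham (k : Fin m) (f : Entire m) : starMul ħ K (ham ħ K k) f = hamOp ħ K k f := by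
  have h : ham ħ K k = polyFn ((1 / (I * (ħ : ℂ))) • ((1 / 2 : ℂ) •
      (genMul (K + Matrix.J (Fin m) ℂ) ħ (Sum.inl k) (MvPolynomial.X (Sum.inr k)) +
        genMul (K + Matrix.J (Fin m) ℂ) ħ (Sum.inr k) (MvPolynomial.X (Sum.inl k))))) := by
    rw [ham, ← polyFn_X, ← polyFn_X, polyFn_X (Sum.inl k), starMul_gen_polyFn, polyFn_X (Sum.inr k),
      ← polyFn_X (Sum.inl k), starMul_gen_polyFn]
    funext x
    simp only [polyFn, Pi.smul_apply, Pi.add_apply, map_add, MvPolynomial.smul_eval,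
      smul_eq_mul]
  rw [h, starMul_polyFn]
  simp only [← polyStarL_apply, map_smul, map_add, LinearMap.smul_apply, LinearMap.add_apply, hamOp,
    LinearMap.comp_apply]
  simp only [polyStarL_apply, polyStar_genMul, polyStar_X]

/-- The product of generators along a word, as a polynomial. -/
def wordPoly (l : List (Idx m)) : MvPolynomial (Idx m) ℂ :=
  l.foldr (genMul (K + Matrix.J (Fin m) ℂ) ħ) 1

/-- Left multiplication by the product of generators along a word. -/
def wordOp (l : List (Idx m)) (f : Entire m) : Entire m := l.foldr (fun i g => lOp ħ K i g) f

/-- The word of a star monomial. -/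
def word (n : Fin m → ℤ) : List (Idx m) :=
  (List.finRange m).flatMap fun k =>
    List.replicate (n k).toNat (Sum.inl k : Idx m) ++ List.replicate (-n k).toNat (Sum.inr k : Idx m)

theorem starMonomial_eq (n : Fin m → ℤ) : starMonomial ħ K n = polyFn (wordPoly ħ K (word n)) := by
  change (word n).foldr _ _ = _
  induction word n with
  | nil =>
    funext x
    simp [wordPoly, polyFn]
  | cons i l ih => rw [List.foldr_cons, ih, starMul_gen_polyFn]; rfl

theorem polyStar_wordPoly (l : List (Idx m)) (f : Entire m) :
    polyStar (K + Matrix.J (Fin m) ℂ) ħ (wordPoly ħ K l) f = wordOp ħ K l f := by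
  induction l with
  | nil => exact polyStar_one _ _ f
  | cons i l ih => rw [wordPoly, List.foldr_cons, polyStar_genMul]; exact congrArg _ ih

/-- The expression of a star polynomial, as a polynomial. -/
def exprPoly (f : StarPoly m) : MvPolynomial (Idx m) ℂ :=
  f.sum fun n c => c • wordPoly ħ K (word n)

theorem expr_eq (f : StarPoly m) : expr ħ K f = polyFn (exprPoly ħ K f) := by
  funext x
  simp [expr, exprPoly, polyFn, Finsupp.sum, starMonomial_eq]

theorem starMul_expr (f : StarPoly m) (g : Entire m) :
    starMul ħ K (expr ħ K f) g =
      ((f.sum fun n c => c • wordOp ħ K (word n) g : Entire m) : Fn m) := by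
  rw [expr_eq, starMul_polyFn, exprPoly]
  congr 1
  simp only [← polyStarL_apply, Finsupp.sum, map_sum, map_smul, LinearMap.sum_apply,
    LinearMap.smul_apply]
  simp only [polyStarL_apply, polyStar_wordPoly]

theorem wordOp_append (l l' : List (Idx m)) (f : Entire m) :
    wordOp ħ K (l ++ l') f = wordOp ħ K l (wordOp ħ K l' f) := List.foldr_append

theorem wordOp_smul (l : List (Idx m)) (c : ℂ) (f : Entire m) :
    wordOp ħ K l (c • f) = c • wordOp ħ K l f := by
  induction l with
  | nil => rfl
  | cons i l ih =>
    change lOp ħ K i (wordOp ħ K l _) = c • lOp ħ K i (wordOp ħ K l _)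
    rw [ih, map_smul]

theorem wordOp_sum {α : Type*} (l : List (Idx m)) (s : Finset α) (f : α → Entire m) :
    wordOp ħ K l (∑ a ∈ s, f a) = ∑ a ∈ s, wordOp ħ K l (f a) := by
  induction l with
  | nil => rfl
  | cons i l ih =>
    change lOp ħ K i (wordOp ħ K l _) = ∑ a ∈ s, lOp ħ K i (wordOp ħ K l _)
    rw [ih, map_sum]

/-- The weight of a generator. -/
def wt : Idx m → Fin m → ℤ := Sum.elim (fun k => Pi.single k 1) (fun k => -Pi.single k 1)

variable {K} (hK : K.IsSymm) {ħ} (hħ : ħ ≠ 0)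

include hK in
-- The symmetric part `K` of `Λ` cancels in the commutator; only the antisymmetric part `J` remains,
-- twice.
theorem lOp_comm (i j : Idx m) (f : Entire m) :
    lOp ħ K i (lOp ħ K j f) = lOp ħ K j (lOp ħ K i f) +
      (I * ħ * Matrix.J (Fin m) ℂ i j) • f := by
  have h1 : K j i = K i j := hK.apply i j
  have h2 : Matrix.J (Fin m) ℂ j i = - Matrix.J (Fin m) ℂ i j := by
    simpa using congrFun (congrFun (Matrix.J_transpose (Fin m) ℂ) i) j
  rw [genOp_comm]
  congr 2
  rw [Matrix.add_apply, Matrix.add_apply, h1, h2]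
  ring

@[simp] theorem J_inl_inl (k l : Fin m) : Matrix.J (Fin m) ℂ (Sum.inl k) (Sum.inl l) = 0 := rfl
@[simp] theorem J_inr_inr (k l : Fin m) : Matrix.J (Fin m) ℂ (Sum.inr k) (Sum.inr l) = 0 := rfl
@[simp] theorem J_inl_inr (k l : Fin m) :
    Matrix.J (Fin m) ℂ (Sum.inl k) (Sum.inr l) = if k = l then -1 else 0 := by
  simp only [Matrix.J, Matrix.fromBlocks_apply₁₂, Matrix.neg_apply, Matrix.one_apply]
  split_ifs <;> simp
@[simp] theorem J_inr_inl (k l : Fin m) :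
    Matrix.J (Fin m) ℂ (Sum.inr k) (Sum.inl l) = if k = l then 1 else 0 := by
  simp [Matrix.J, Matrix.one_apply]

include hK hħ in
-- The commutator of a quadratic expression with a generator is linear in the generators. The
-- scalars here are integers, which makes the generators ladder operators on joint eigenfunctions.
theorem hamOp_lOp (k : Fin m) (i : Idx m) (f : Entire m) :
    hamOp ħ K k (lOp ħ K i f) = lOp ħ K i (hamOp ħ K k f) + (wt i k : ℂ) • lOp ħ K i f := by
  have h0 : (I * (ħ : ℂ)) ≠ 0 := mul_ne_zero I_ne_zero (by exact_mod_cast hħ)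
  have hħ' : (ħ : ℂ) ≠ 0 := by exact_mod_cast hħ
  have key : ∀ a b : Idx m, lOp ħ K a (lOp ħ K b (lOp ħ K i f)) =
      lOp ħ K i (lOp ħ K a (lOp ħ K b f)) + (I * ħ * Matrix.J (Fin m) ℂ a i) • lOp ħ K b f +
        (I * ħ * Matrix.J (Fin m) ℂ b i) • lOp ħ K a f := by
    intro a b
    rw [lOp_comm hK b i, map_add, map_smul, lOp_comm hK a i]
  simp only [hamOp, LinearMap.smul_apply, LinearMap.add_apply, LinearMap.comp_apply, map_smul,
    map_add, key]
  rcases i with l | l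
  · by_cases h : k = l
    · subst h
      simp only [wt, J_inl_inl, J_inr_inl, Sum.elim_inl, Pi.single_eq_same]
      match_scalars <;> field_simp <;> norm_num [hħ']
    · simp [wt, h]
  · by_cases h : k = l
    · subst h
      simp only [wt, J_inr_inr, J_inl_inr, Sum.elim_inr, Pi.single_eq_same, Pi.neg_apply]
      match_scalars <;> field_simp <;> norm_num [hħ']
    · simp [wt, h]

/-- Simultaneous eigenfunctions of the Hamiltonians. -/
def IsWeight (ħ : ℝ) (K : Matrix (Idx m) (Idx m) ℂ) (n : Fin m → ℤ) (f : Entire m) : Prop :=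
  ∀ k, hamOp ħ K k f = (n k : ℂ) • f

include hK hħ in
theorem IsWeight.lOp {n : Fin m → ℤ} {f : Entire m} (h : IsWeight ħ K n f) (i : Idx m) :
    IsWeight ħ K (n + wt i) (lOp ħ K i f) := fun k => by
  rw [hamOp_lOp hK hħ, h k, map_smul, ← add_smul]
  simp

theorem IsWeight.smul {n : Fin m → ℤ} {f : Entire m} (h : IsWeight ħ K n f) (c : ℂ) :
    IsWeight ħ K n (c • f) := fun k => by
  rw [map_smul, h k, smul_comm]

/-- The sum of the weights of the letters of a word. -/
def wordWt (l : List (Idx m)) : Fin m → ℤ := (l.map wt).sum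

include hK hħ in
theorem IsWeight.wordOp {n : Fin m → ℤ} {f : Entire m} (h : IsWeight ħ K n f) (l : List (Idx m)) :
    IsWeight ħ K (n + wordWt l) (wordOp ħ K l f) := by
  induction l with
  | nil => simpa [wordWt, PseudoVacuum.wordOp] using h
  | cons i l ih =>
    have : n + wordWt (i :: l) = n + wordWt l + wt i := by simp [wordWt, add_comm, add_left_comm]
    rw [this]
    exact ih.lOp hK hħ i

include hK hħ in
-- Since `ṽ_k * ũ_k = ũ_k * ṽ_k + iħ`, the Hamiltonian is `(1/iħ) (ũ_k * ṽ_k + iħ/2)`. Its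
-- eigenvalue therefore determines the action of `ũ_k * ṽ_k`.
theorem lOp_inl_inr {n : Fin m → ℤ} {f : Entire m} (h : IsWeight ħ K n f) (k : Fin m) :
    lOp ħ K (Sum.inl k) (lOp ħ K (Sum.inr k) f) = (I * ħ * (n k - 1 / 2)) • f := by
  have h0 : (I * (ħ : ℂ)) ≠ 0 := mul_ne_zero I_ne_zero (by exact_mod_cast hħ)
  have h1 := h k
  have h2 := lOp_comm (ħ := ħ) hK (Sum.inr k) (Sum.inl k) f
  simp only [hamOp, LinearMap.smul_apply, LinearMap.add_apply, LinearMap.comp_apply, h2,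
    J_inr_inl, if_true] at h1
  have h3 : (1 / (I * (ħ : ℂ))) • (1 / 2 : ℂ) • (lOp ħ K (Sum.inl k) (lOp ħ K (Sum.inr k) f) +
      (lOp ħ K (Sum.inl k) (lOp ħ K (Sum.inr k) f) + (I * ħ * 1) • f)) =
      (1 / (I * (ħ : ℂ))) • (lOp ħ K (Sum.inl k) (lOp ħ K (Sum.inr k) f) + (I * ħ / 2) • f) := by
    module
  rw [h3] at h1
  have h4 := congrArg (fun g => (I * (ħ : ℂ)) • g) h1
  simp only [smul_smul] at h4
  rw [mul_one_div_cancel h0, one_smul] at h4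
  rw [eq_sub_of_add_eq h4]
  module

theorem J_apply_partner (k : Fin m) : Matrix.J (Fin m) ℂ (Sum.inr k) (Sum.inl k) = 1 := by simp

include hK hħ in
theorem lOp_inr_inl {n : Fin m → ℤ} {f : Entire m} (h : IsWeight ħ K n f) (k : Fin m) :
    lOp ħ K (Sum.inr k) (lOp ħ K (Sum.inl k) f) = (I * ħ * (n k + 1 / 2)) • f := by
  rw [lOp_comm hK, lOp_inl_inr hK hħ h, J_apply_partner]
  module

/-- The half-integral shift is what excludes highest and lowest weight vectors: a generator followed
by its partner never annihilates a nonzero vector of integral weight. -/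
theorem int_add_half_ne_zero (n : ℤ) : (n : ℂ) + 1 / 2 ≠ 0 := by
  intro h
  have h1 : ((2 * n + 1 : ℤ) : ℂ) = 0 := by
    push_cast
    linear_combination 2 * h
  have h2 : 2 * n + 1 = 0 := by exact_mod_cast h1
  omega

theorem int_sub_half_ne_zero (n : ℤ) : (n : ℂ) - 1 / 2 ≠ 0 := by
  have h := int_add_half_ne_zero (n - 1)
  push_cast at h
  intro h1
  exact h (by linear_combination h1)

include hK hħ in
theorem exists_lOp_swap {n : Fin m → ℤ} {f : Entire m} (h : IsWeight ħ K n f) (i : Idx m) :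
    ∃ c : ℂ, c ≠ 0 ∧ lOp ħ K i (lOp ħ K i.swap f) = c • f := by
  have h0 : (I * (ħ : ℂ)) ≠ 0 := mul_ne_zero I_ne_zero (by exact_mod_cast hħ)
  rcases i with k | k
  · exact ⟨_, mul_ne_zero h0 (int_sub_half_ne_zero (n k)), lOp_inl_inr hK hħ h k⟩
  · exact ⟨_, mul_ne_zero h0 (int_add_half_ne_zero (n k)), lOp_inr_inl hK hħ h k⟩

/-- Equality up to a nonzero scalar. -/
def Proportional (f g : Entire m) : Prop := ∃ c : ℂ, c ≠ 0 ∧ f = c • g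

theorem Proportional.refl (f : Entire m) : Proportional f f := ⟨1, one_ne_zero, (one_smul _ _).symm⟩

theorem Proportional.symm {f g : Entire m} (h : Proportional f g) : Proportional g f := by
  obtain ⟨c, hc, rfl⟩ := h
  exact ⟨c⁻¹, inv_ne_zero hc, by rw [smul_smul, inv_mul_cancel₀ hc, one_smul]⟩

theorem Proportional.trans {f g h : Entire m} (h₁ : Proportional f g) (h₂ : Proportional g h) :
    Proportional f h := by
  obtain ⟨c, hc, rfl⟩ := h₁
  obtain ⟨d, hd, rfl⟩ := h₂
  exact ⟨c * d, mul_ne_zero hc hd, by rw [smul_smul]⟩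

theorem Proportional.map {f g : Entire m} (h : Proportional f g) (T : Entire m →ₗ[ℂ] Entire m) :
    Proportional (T f) (T g) := by
  obtain ⟨c, hc, rfl⟩ := h
  exact ⟨c, hc, map_smul _ _ _⟩

theorem Proportional.ne_zero {f g : Entire m} (h : Proportional f g) (hf : f ≠ 0) : g ≠ 0 := by
  obtain ⟨c, hc, rfl⟩ := h
  rintro rfl
  exact hf (smul_zero c)

include hK hħ in
-- Generators that are not partners commute. For partners both orders act on a weight vector by
-- nonzero scalars, so the order of letters matters only up to a nonzero factor.
theorem proportional_lOp_comm {n : Fin m → ℤ} {f : Entire m} (h : IsWeight ħ K n f) (i j : Idx m) :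
    Proportional (lOp ħ K i (lOp ħ K j f)) (lOp ħ K j (lOp ħ K i f)) := by
  by_cases hij : j = i.swap
  · subst hij
    obtain ⟨c, hc, h1⟩ := exists_lOp_swap hK hħ h i
    obtain ⟨d, hd, h2⟩ := exists_lOp_swap hK hħ h i.swap
    rw [Sum.swap_swap] at h2
    exact Proportional.trans ⟨c, hc, h1⟩ (Proportional.symm ⟨d, hd, h2⟩)
  · have hJ : Matrix.J (Fin m) ℂ i j = 0 := by
      rcases i with k | k <;> rcases j with l | l <;> simp at hij ⊢ <;> exact fun h => hij h.symm
    rw [lOp_comm hK, hJ]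
    simpa using Proportional.refl _

include hK hħ in
theorem wordOp_perm {n : Fin m → ℤ} {f : Entire m} (h : IsWeight ħ K n f) {l l' : List (Idx m)}
    (hl : l.Perm l') : Proportional (wordOp ħ K l f) (wordOp ħ K l' f) := by
  induction hl with
  | nil => exact Proportional.refl _
  | cons i _ ih => exact ih.map (lOp ħ K i)
  | swap i j l => exact proportional_lOp_comm hK hħ (h.wordOp hK hħ l) j i
  | trans _ _ ih ih' => exact ih.trans ih'

/-- The signed multiplicity of a generator in the star monomial with exponent `n`. -/
def charge (n : Fin m → ℤ) : Idx m → ℤ := Sum.elim n (-n)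

theorem charge_swap (n : Fin m → ℤ) (i : Idx m) : charge n i.swap = -charge n i := by
  rcases i with k | k <;> simp [charge]

theorem charge_add_wt (n : Fin m → ℤ) (i a : Idx m) : charge (n + wt i) a =
    charge n a + (if i = a then 1 else 0) - (if i.swap = a then 1 else 0) := by
  rcases i with k | k <;> rcases a with l | l <;> by_cases h : k = l <;>
    simp [charge, wt, h, Ne.symm, eq_comm] <;> ring

/-- Words are compared by counting letters, and `List.count` uses the boolean equality of the sum
type. -/
instance : LawfulBEq (Idx m) where
  eq_of_beq {a b} h := by
    rcases a with a | a <;> rcases b with b | b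
    · exact congrArg _ (eq_of_beq (α := Fin m) h)
    · exact absurd h Bool.false_ne_true
    · exact absurd h Bool.false_ne_true
    · exact congrArg _ (eq_of_beq (α := Fin m) h)
  rfl {a} := by
    rcases a with a | a
    · exact beq_self_eq_true (α := Fin m) a
    · exact beq_self_eq_true (α := Fin m) a

theorem count_word (n : Fin m → ℤ) (a : Idx m) : (word n).count a = (charge n a).toNat := by
  have h1 : ∀ k : Fin m, (List.finRange m).count k = 1 := fun k =>
    List.count_eq_one_of_mem (List.nodup_finRange m) (List.mem_finRange k)
  rcases a with k | k
  · rw [word, List.count_flatMap, List.sum_map_eq_nsmul_single k]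
    · simp [List.count_replicate, h1, charge]
    · intro l hl _
      simp [List.count_replicate, hl]
  · rw [word, List.count_flatMap, List.sum_map_eq_nsmul_single k]
    · simp [List.count_replicate, h1, charge]
    · intro l hl _
      simp [List.count_replicate, hl]

include hK hħ in
-- If the exponent of the letter `i` is nonnegative, adding `i` gives a rearrangement of the next
-- standard word. Otherwise the word contains the partner of `i`, which `i` cancels up to a nonzero
-- scalar.
theorem lOp_wordOp_word {n₀ : Fin m → ℤ} {f : Entire m} (h : IsWeight ħ K n₀ f) (i : Idx m)
    (n : Fin m → ℤ) :
    Proportional (lOp ħ K i (wordOp ħ K (word n) f)) (wordOp ħ K (word (n + wt i)) f) := by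
  have hne : i ≠ i.swap := by rcases i with k | k <;> simp
  have hsw := charge_swap n i
  by_cases hs : 0 ≤ charge n i
  · refine wordOp_perm (l := i :: word n) hK hħ h (List.perm_iff_count.2 fun a => ?_)
    rw [List.count_cons, count_word, count_word, charge_add_wt]
    simp only [beq_iff_eq]
    by_cases h1 : i = a
    · subst h1
      rw [if_pos rfl, if_pos rfl, if_neg hne.symm]
      omega
    · rw [if_neg h1, if_neg h1]
      by_cases h2 : i.swap = a
      · subst h2
        rw [if_pos rfl]
        omega
      · rw [if_neg h2]
        omega
  · have hp : (word n).Perm (i.swap :: word (n + wt i)) := by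
      refine List.perm_iff_count.2 fun a => ?_
      rw [List.count_cons, count_word, count_word, charge_add_wt]
      simp only [beq_iff_eq]
      by_cases h1 : i = a
      · subst h1
        rw [if_pos rfl, if_neg hne.symm, if_neg hne.symm]
        omega
      · rw [if_neg h1]
        by_cases h2 : i.swap = a
        · subst h2
          rw [if_pos rfl, if_pos rfl]
          omega
        · rw [if_neg h2, if_neg h2]
          omega
    exact ((wordOp_perm hK hħ h hp).map (lOp ħ K i)).trans
      (exists_lOp_swap hK hħ (h.wordOp hK hħ _) i)

theorem word_zero : word (0 : Fin m → ℤ) = [] := by simp [word]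

include hK hħ in
theorem wordOp_proportional {n₀ : Fin m → ℤ} {f : Entire m} (h : IsWeight ħ K n₀ f)
    (l : List (Idx m)) : Proportional (wordOp ħ K l f) (wordOp ħ K (word (wordWt l)) f) := by
  induction l with
  | nil => rw [show wordWt ([] : List (Idx m)) = 0 from rfl, word_zero]; exact Proportional.refl _
  | cons i l ih =>
    have : wordWt (i :: l) = wordWt l + wt i := by simp [wordWt, add_comm]
    rw [this]
    exact (ih.map (lOp ħ K i)).trans (lOp_wordOp_word hK hħ h i _)

theorem wordWt_word (n : Fin m → ℤ) : wordWt (word n) = n := by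
  have h : ∀ k : Fin m, ((List.replicate (n k).toNat (Sum.inl k : Idx m) ++
      List.replicate (-n k).toNat (Sum.inr k : Idx m)).map wt).sum = Pi.single k (n k) := by
    intro k
    funext l
    by_cases hl : l = k
    · subst hl; simp [wt]; omega
    · simp [wt, hl]
  rw [wordWt, word, List.map_flatMap, List.flatMap, List.sum_flatten, List.map_map]
  simp only [Function.comp_def, h]
  rw [← List.ofFn_eq_map, List.sum_ofFn, Finset.univ_sum_single]

include hK hħ in
theorem wordOp_word_word {n₀ : Fin m → ℤ} {f : Entire m} (h : IsWeight ħ K n₀ f)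
    (a b : Fin m → ℤ) : Proportional (wordOp ħ K (word a) (wordOp ħ K (word b) f))
      (wordOp ħ K (word (a + b)) f) := by
  rw [← wordOp_append]
  have := wordOp_proportional hK hħ h (word a ++ word b)
  rwa [show wordWt (word a ++ word b) = a + b by
    rw [wordWt, List.map_append, List.sum_append]; exact congrArg₂ _ (wordWt_word a) (wordWt_word b)] at this

include hK hħ in
-- The word with opposite exponents leads back to a nonzero multiple of `f`.
theorem wordOp_word_ne_zero {n₀ : Fin m → ℤ} {f : Entire m} (h : IsWeight ħ K n₀ f) (hf : f ≠ 0)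
    (n : Fin m → ℤ) : wordOp ħ K (word n) f ≠ 0 := by
  intro h0
  have h1 := (wordOp_word_word hK hħ h (-n) n).symm
  rw [neg_add_cancel, word_zero, h0] at h1
  exact h1.ne_zero hf (by simpa using wordOp_smul ħ K (word (-n)) 0 0)

include hK hħ in
-- The span is stable under the generators. An ordinary monomial `x_i s` differs from the star
-- product `x_i * s` only by terms of smaller degree, so induction on the degree reaches all
-- polynomials.
theorem polyStar_mem_span {n₀ : Fin m → ℤ} {f : Entire m} (h : IsWeight ħ K n₀ f)
    (p : MvPolynomial (Idx m) ℂ) : polyStar (K + Matrix.J (Fin m) ℂ) ħ p f ∈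
      Submodule.span ℂ (Set.range fun n => wordOp ħ K (word n) f) := by
  set W := Submodule.span ℂ (Set.range fun n => wordOp ħ K (word n) f) with hW
  have hstab : ∀ i, ∀ g ∈ W, lOp ħ K i g ∈ W := by
    intro i g hg
    induction hg using Submodule.span_induction with
    | mem g hg =>
      obtain ⟨n, rfl⟩ := hg
      obtain ⟨c, -, hc⟩ := lOp_wordOp_word hK hħ h i n
      simp only [hc]
      exact W.smul_mem _ (Submodule.subset_span ⟨_, rfl⟩)
    | zero => simp
    | add a b _ _ ha hb => rw [map_add]; exact W.add_mem ha hb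
    | smul c a _ ha => rw [map_smul]; exact W.smul_mem _ ha
  have hmon : ∀ d : ℕ, ∀ s : Idx m →₀ ℕ, s.degree = d → ∀ c : ℂ,
      polyStar (K + Matrix.J (Fin m) ℂ) ħ (MvPolynomial.monomial s c) f ∈ W := by
    intro d
    induction d using Nat.strong_induction_on with
    | _ d ih =>
    intro s hs c
    by_cases h0 : s = 0
    · subst h0
      have : MvPolynomial.monomial (0 : Idx m →₀ ℕ) c = c • 1 := by
        rw [MvPolynomial.smul_eq_C_mul, mul_one]; rfl
      rw [this, polyStar_smul_left, polyStar_one]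
      refine W.smul_mem _ (Submodule.subset_span ⟨0, ?_⟩)
      simp only [word_zero]
      rfl
    · obtain ⟨i, hi⟩ := Finsupp.ne_iff.1 h0
      obtain ⟨s', rfl⟩ : ∃ s', s = Finsupp.single i 1 + s' :=
        exists_add_of_le (Finsupp.single_le_iff.2 (Nat.one_le_iff_ne_zero.2 hi))
      have hdeg : s'.degree < d := by
        rw [← hs, map_add, Finsupp.degree_single]; omega
      have hX : MvPolynomial.monomial (Finsupp.single i 1 + s') c =
          genMul (K + Matrix.J (Fin m) ℂ) ħ i (MvPolynomial.monomial s' c) -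
            (I * ħ / 2) • ∑ j, (K + Matrix.J (Fin m) ℂ) i j •
              MvPolynomial.pderiv j (MvPolynomial.monomial s' c) := by
        rw [genMul, add_sub_cancel_right, MvPolynomial.X, MvPolynomial.monomial_mul, one_mul]
      rw [hX, ← polyStarL_apply, map_sub]
      simp only [map_sum, map_smul, LinearMap.sub_apply, LinearMap.smul_apply, LinearMap.sum_apply]
      -- Both remaining kinds of monomial, `s'` and its derivatives, have degree at most that of
      -- `s'`, hence below `d`.
      simp only [polyStarL_apply, polyStar_genMul, MvPolynomial.pderiv_monomial]
      refine W.sub_mem (hstab i _ (ih _ hdeg _ rfl c)) (W.smul_mem _ (W.sum_mem fun j _ =>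
        W.smul_mem _ (ih _ (lt_of_le_of_lt ?_ hdeg) _ rfl _)))
      exact Finsupp.degree_mono tsub_le_self
  induction p using MvPolynomial.induction_on' with
  | monomial s c => exact hmon _ s rfl c
  | add p q hp hq => rw [polyStar_add_left]; exact W.add_mem hp hq

end
end PseudoVacuum

/-! ### Analytic curves of entire functions and uniqueness of the flow -/

namespace PseudoVacuum
noncomputable section
variable {m : ℕ}

/-- Curves of entire functions which are analytic jointly in the parameter and the variables. -/
def IsAnalyticCurve (γ : ℝ → Entire m) : Prop :=
  AnalyticOnNhd ℝ (fun p : ℝ × (Idx m → ℂ) => (γ p.1 : Fn m) p.2) Set.univ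

/-- `γ'` is the derivative of the curve `γ` of entire functions. -/
def HasCurveDeriv (γ γ' : ℝ → Entire m) : Prop :=
  ∀ s x, HasDerivAt (fun s => (γ s : Fn m) x) ((γ' s : Fn m) x) s

theorem pd_eq_fderiv_real (f : Entire m) (i : Idx m) (x : Idx m → ℂ) :
    pd i f x = fderiv ℝ (f : Fn m) x (Pi.single i 1) := by
  rw [pd, ((f.2.1 x).hasFDerivAt.restrictScalars ℝ).fderiv]
  rfl

theorem IsAnalyticCurve.D_apply {γ : ℝ → Entire m} (h : IsAnalyticCurve γ) (i : Idx m) (s : ℝ)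
    (x : Idx m → ℂ) : (D i (γ s) : Fn m) x =
      fderiv ℝ (fun p : ℝ × (Idx m → ℂ) => (γ p.1 : Fn m) p.2) (s, x) (0, Pi.single i 1) := by
  rw [coe_D, pd_eq_fderiv_real]
  have h1 : HasFDerivAt (γ s : Fn m) ((fderiv ℝ (fun p : ℝ × (Idx m → ℂ) => (γ p.1 : Fn m) p.2)
      (s, x)).comp (ContinuousLinearMap.inr ℝ ℝ (Idx m → ℂ))) x :=
    HasFDerivAt.comp (f := fun y => (s, y)) x (h (s, x) trivial).differentiableAt.hasFDerivAt
      (hasFDerivAt_prodMk_right s x)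
  rw [h1.fderiv]
  rfl

theorem analyticOnNhd_fderiv_apply {E : Type*} [NormedAddCommGroup E] [NormedSpace ℝ E] {G : E → ℂ}
    (h : AnalyticOnNhd ℝ G Set.univ) (v : E) :
    AnalyticOnNhd ℝ (fun p => fderiv ℝ G p v) Set.univ := fun p hp =>
  ((ContinuousLinearMap.apply ℝ ℂ v).analyticAt _).comp (h.fderiv p hp)

theorem hasFDerivAt_fderiv_apply {E : Type*} [NormedAddCommGroup E] [NormedSpace ℝ E] {G : E → ℂ}
    (h : AnalyticOnNhd ℝ G Set.univ) (v p : E) :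
    HasFDerivAt (fun p => fderiv ℝ G p v)
      ((ContinuousLinearMap.apply ℝ ℂ v).comp (fderiv ℝ (fderiv ℝ G) p)) p :=
  (ContinuousLinearMap.apply ℝ ℂ v).hasFDerivAt.comp p
    (h.fderiv p trivial).differentiableAt.hasFDerivAt

theorem IsAnalyticCurve.D {γ : ℝ → Entire m} (h : IsAnalyticCurve γ) (i : Idx m) :
    IsAnalyticCurve fun s => D i (γ s) := by
  unfold IsAnalyticCurve
  simp only [h.D_apply]
  exact analyticOnNhd_fderiv_apply h _

/-- Symmetry of the second derivative of the jointly analytic function exchanges the derivative in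
the parameter with the one in the variables. -/
theorem HasCurveDeriv.D {γ γ' : ℝ → Entire m} (h : HasCurveDeriv γ γ') (hγ : IsAnalyticCurve γ)
    (hγ' : IsAnalyticCurve γ') (i : Idx m) :
    HasCurveDeriv (fun s => PseudoVacuum.D i (γ s)) fun s => PseudoVacuum.D i (γ' s) := by
  intro s x
  simp only [hγ.D_apply, hγ'.D_apply]
  set G := fun p : ℝ × (Idx m → ℂ) => (γ p.1 : Fn m) p.2 with hG
  have h1 : (fun p : ℝ × (Idx m → ℂ) => (γ' p.1 : Fn m) p.2) = fun p => fderiv ℝ G p (1, 0) := by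
    funext ⟨s, x⟩
    have h2 : HasFDerivAt (fun s => (γ s : Fn m) x) ((fderiv ℝ G (s, x)).comp
        (ContinuousLinearMap.inl ℝ ℝ (Idx m → ℂ))) s :=
      HasFDerivAt.comp (g := G) (f := fun s => (s, x)) s
        (hγ (s, x) trivial).differentiableAt.hasFDerivAt (hasFDerivAt_prodMk_left s x)
    simpa using (h s x).unique h2.hasDerivAt
  rw [h1, (hasFDerivAt_fderiv_apply hγ (1, 0) (s, x)).fderiv]
  have h3 : HasFDerivAt (fun s => fderiv ℝ G (s, x) (0, Pi.single i 1)) _ s :=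
    HasFDerivAt.comp (f := fun s => (s, x)) s
      (hasFDerivAt_fderiv_apply hγ (0, Pi.single i 1) (s, x)) (hasFDerivAt_prodMk_left s x)
  have h4 := h3.hasDerivAt
  convert! h4 using 1
  exact (hγ (s, x) trivial).contDiffAt.isSymmSndFDerivAt (n := ⊤) (by simp) _ _

/-- Linear maps compatible with the differentiation of analytic curves. -/
structure IsCurveMap (T : Entire m →ₗ[ℂ] Entire m) : Prop where
  analytic : ∀ γ, IsAnalyticCurve γ → IsAnalyticCurve fun s => T (γ s)
  deriv : ∀ γ γ', HasCurveDeriv γ γ' → IsAnalyticCurve γ → IsAnalyticCurve γ' →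
    HasCurveDeriv (fun s => T (γ s)) fun s => T (γ' s)

theorem IsCurveMap.add {S T : Entire m →ₗ[ℂ] Entire m} (hS : IsCurveMap S) (hT : IsCurveMap T) :
    IsCurveMap (S + T) where
  analytic γ h := (hS.1 γ h).add (hT.1 γ h)
  deriv γ γ' h h1 h2 s x := (hS.2 γ γ' h h1 h2 s x).add (hT.2 γ γ' h h1 h2 s x)

theorem IsCurveMap.smul {T : Entire m →ₗ[ℂ] Entire m} (hT : IsCurveMap T) (c : ℂ) :
    IsCurveMap (c • T) where
  analytic γ h := analyticOnNhd_const.mul (hT.1 γ h)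
  deriv γ γ' h h1 h2 s x := (hT.2 γ γ' h h1 h2 s x).const_mul c

theorem IsCurveMap.zero : IsCurveMap (0 : Entire m →ₗ[ℂ] Entire m) where
  analytic _ _ := analyticOnNhd_const
  deriv _ _ _ _ _ s _ := hasDerivAt_const s 0

theorem IsCurveMap.sum {α : Type*} (s : Finset α) {T : α → Entire m →ₗ[ℂ] Entire m}
    (hT : ∀ a, IsCurveMap (T a)) : IsCurveMap (∑ a ∈ s, T a) := by
  classical
  induction s using Finset.induction_on with
  | empty => exact IsCurveMap.zero
  | insert a s ha ih => rw [Finset.sum_insert ha]; exact (hT a).add ih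

theorem IsCurveMap.comp {S T : Entire m →ₗ[ℂ] Entire m} (hS : IsCurveMap S) (hT : IsCurveMap T) :
    IsCurveMap (S ∘ₗ T) where
  analytic γ h := hS.1 _ (hT.1 γ h)
  deriv γ γ' h h1 h2 := hS.2 _ _ (hT.2 γ γ' h h1 h2) (hT.1 γ h1) (hT.1 γ' h2)

theorem isCurveMap_D (i : Idx m) : IsCurveMap (D i : Entire m →ₗ[ℂ] Entire m) where
  analytic _ h := h.D i
  deriv _ _ h h1 h2 := h.D h1 h2 i

theorem isCurveMap_mulLeft (f : Entire m) : IsCurveMap (LinearMap.mulLeft ℂ f) where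
  analytic _ h := AnalyticOnNhd.mul (fun p _ => (f.2.2 p.2 trivial).comp analyticAt_snd) h
  deriv _ _ h _ _ s x := (h s x).const_mul _

theorem isCurveMap_genOp (Λ : Matrix (Idx m) (Idx m) ℂ) (ħ : ℝ) (i : Idx m) :
    IsCurveMap (genOp Λ ħ i) :=
  (isCurveMap_mulLeft _).add ((IsCurveMap.sum _ fun j => (isCurveMap_D j).smul _).smul _)

theorem isCurveMap_hamOp (ħ : ℝ) (K : Matrix (Idx m) (Idx m) ℂ) (k : Fin m) :
    IsCurveMap (hamOp ħ K k) :=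
  ((((isCurveMap_genOp _ _ _).comp (isCurveMap_genOp _ _ _)).add
    ((isCurveMap_genOp _ _ _).comp (isCurveMap_genOp _ _ _))).smul _).smul _

theorem eventually_eq_zero_of_iteratedDeriv {h : ℝ → ℂ} (hh : AnalyticAt ℝ h 0)
    (h0 : ∀ n, iteratedDeriv n h 0 = 0) : ∀ᶠ s in nhds 0, h s = 0 := by
  rw [← analyticOrderAt_eq_top, ENat.eq_top_iff_forall_ge]
  exact fun n => (natCast_le_analyticOrderAt_iff_iteratedDeriv_eq_zero hh).2 fun i _ => h0 i

/-- Uniqueness for linear evolution equations with analytic coefficients. -/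
theorem IsCurveMap.eq_zero {T : Entire m →ₗ[ℂ] Entire m} (hT : IsCurveMap T) {γ : ℝ → Entire m}
    (hγ : IsAnalyticCurve γ) (h : HasCurveDeriv γ fun s => T (γ s)) (h0 : γ 0 = 0) (s : ℝ) :
    γ s = 0 := by
  have han : ∀ n : ℕ, IsAnalyticCurve fun s => (T ^ n) (γ s) := by
    intro n
    induction n with
    | zero => exact hγ
    | succ n ih =>
      simp only [pow_succ', Module.End.mul_apply]
      exact hT.1 _ ih
  have hd : ∀ n : ℕ, HasCurveDeriv (fun s => (T ^ n) (γ s)) fun s => (T ^ (n + 1)) (γ s) := by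
    intro n
    induction n with
    | zero => simpa using h
    | succ n ih =>
      have := hT.2 _ _ ih (han n) (han (n + 1))
      simpa only [← Module.End.mul_apply, ← pow_succ'] using this
  apply Subtype.ext
  funext x
  -- By the equation the `n`-th derivative at parameter 0 is `T ^ n` applied to the initial value 0.
  -- The curve thus vanishes near 0, and everywhere by the identity theorem.
  have hit : ∀ n : ℕ, iteratedDeriv n (fun s => (γ s : Fn m) x) =
      fun s => ((T ^ n) (γ s) : Fn m) x := by
    intro n
    induction n with
    | zero => simp
    | succ n ih =>
      rw [iteratedDeriv_succ, ih]
      funext s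
      exact (hd n s x).deriv
  have hax : AnalyticOnNhd ℝ (fun s => (γ s : Fn m) x) Set.univ := fun s _ =>
    AnalyticAt.comp (g := fun p : ℝ × (Idx m → ℂ) => (γ p.1 : Fn m) p.2) (f := fun s => (s, x))
      (hγ (s, x) trivial) (analyticAt_id.prod analyticAt_const)
  have hev := eventually_eq_zero_of_iteratedDeriv (hax 0 trivial) fun n => by
    simp [hit, h0]
  exact hax.eqOn_zero_of_preconnected_of_eventuallyEq_zero isPreconnected_univ trivial hev trivial

variable {ħ : ℝ} {K : Matrix (Idx m) (Idx m) ℂ} {F : Fn m} {f g : (Fin m → ℝ) → Fn m}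

theorem IsStarFlow.mem_entire (h : IsStarFlow ħ K F f) (t : Fin m → ℝ) : f t ∈ Entire m :=
  ⟨h.entire t, fun x _ => AnalyticAt.comp (g := fun p : (Fin m → ℝ) × (Idx m → ℂ) => f p.1 p.2)
    (f := fun x => (t, x)) (h.analytic (t, x) trivial) (analyticAt_const.prod analyticAt_id)⟩

/-- Along the ray through `t` the `m` evolution equations combine, by the chain rule, into a single
linear equation with a constant operator. -/
theorem IsStarFlow.hasDerivAt_smul (h : IsStarFlow ħ K F f) (t : Fin m → ℝ) (s : ℝ)
    (x : Idx m → ℂ) : HasDerivAt (fun s : ℝ => f (s • t) x)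
      ((((∑ k, (I * t k) • hamOp ħ K k) ⟨f (s • t), h.mem_entire _⟩ : Entire m) : Fn m) x) s := by
  have h1 : DifferentiableAt ℝ (fun τ => f τ x) (s • t) :=
    (AnalyticAt.comp (g := fun p : (Fin m → ℝ) × (Idx m → ℂ) => f p.1 p.2)
      (f := fun τ => (τ, x)) (h.analytic (s • t, x) trivial)
      (analyticAt_id.prod analyticAt_const)).differentiableAt
  have h2 : ∀ k, fderiv ℝ (fun τ => f τ x) (s • t) (Pi.single k 1) =
      I * (hamOp ħ K k ⟨f (s • t), h.mem_entire _⟩ : Fn m) x := by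
    intro k
    rw [← starMul_ham]
    refine HasDerivAt.unique ?_ (h.evolution k (s • t) x)
    refine HasFDerivAt.comp_hasDerivAt (l := fun τ => f τ x)
      (f := fun r => Function.update (s • t) k r) _ ?_ (hasDerivAt_update _ _ _)
    rw [Function.update_eq_self]
    exact h1.hasFDerivAt
  have h3 : HasDerivAt (fun s : ℝ => s • t) t s := by
    simpa using (hasDerivAt_id s).smul_const t
  have h4 := HasFDerivAt.comp_hasDerivAt s h1.hasFDerivAt h3
  convert! h4 using 1
  have h5 : t = ∑ k, t k • Pi.single k (1 : ℝ) := by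
    funext l
    simp [Finset.sum_apply, Pi.single_apply]
  have h6 : fderiv ℝ (fun τ => f τ x) (s • t) t =
      ∑ k, t k • fderiv ℝ (fun τ => f τ x) (s • t) (Pi.single k 1) := by
    conv_lhs => enter [2]; rw [h5]
    simp
  rw [h6]
  simp [LinearMap.sum_apply, h2, mul_left_comm, mul_assoc]

/-- The difference of two flows along the ray `s ↦ s • t` solves a linear equation with zero initial
value. Its value at `s = 1` is the assertion at `t`. -/
theorem IsStarFlow.unique (hf : IsStarFlow ħ K F f) (hg : IsStarFlow ħ K F g) : f = g := by
  funext t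
  have key := IsCurveMap.eq_zero
    (T := ∑ k, (I * t k) • hamOp ħ K k) (γ := fun s =>
      ⟨f (s • t), hf.mem_entire _⟩ - ⟨g (s • t), hg.mem_entire _⟩)
    (IsCurveMap.sum _ fun k => (isCurveMap_hamOp ħ K k).smul _) ?_ ?_ ?_ 1
  · have := congrArg Subtype.val key
    simpa [sub_eq_zero] using this
  · have h1 : ∀ {f}, IsStarFlow ħ K F f → AnalyticOnNhd ℝ
        (fun p : ℝ × (Idx m → ℂ) => f (p.1 • t) p.2) Set.univ := fun {f} hf p _ =>
      AnalyticAt.comp (g := fun p : (Fin m → ℝ) × (Idx m → ℂ) => f p.1 p.2)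
        (f := fun p : ℝ × (Idx m → ℂ) => (p.1 • t, p.2)) (hf.analytic _ trivial)
        ((analyticAt_fst.smul analyticAt_const).prod analyticAt_snd)
    exact (h1 hf).sub (h1 hg)
  · intro s x
    simp only [map_sub]
    exact (hf.hasDerivAt_smul t s x).sub (hg.hasDerivAt_smul t s x)
  · apply Subtype.ext
    simp [hf.init, hg.init]

theorem isPseudoVacMul_of_isStarFlow {G : Fn m} (hf : IsStarFlow ħ K F f) (hG : periodMean f = G) :
    IsPseudoVacMul ħ K F G :=
  ⟨f, fun _ => ⟨fun hg => hg.unique hf, fun hg => hg ▸ hf⟩, hG⟩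

theorem IsPseudoVacMul.unique {G G' : Fn m} (h : IsPseudoVacMul ħ K F G)
    (h' : IsPseudoVacMul ħ K F G') : G = G' := by
  obtain ⟨f, hf, rfl⟩ := h
  obtain ⟨g, hg, rfl⟩ := h'
  rw [(hg f).1 ((hf f).2 rfl)]

end
end PseudoVacuum

/-! ### Matrix identities behind the closed formula -/

namespace PseudoVacuum
noncomputable section
open scoped Matrix
variable {m : ℕ}

/-- The phases `e^{i t_k}` (for `ũ_k`) and `e^{-i t_k}` (for `ṽ_k`). -/
def phase (t : Fin m → ℝ) : Idx m → ℂ :=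
  Sum.elim (fun k => Complex.exp (I * t k)) (fun k => Complex.exp (-(I * t k)))

theorem phase_eq (t : Fin m → ℝ) (i : Idx m) :
    phase t i = Complex.exp (I * ∑ k, (wt i k : ℂ) * t k) := by
  rcases i with l | l
  · simp [phase, wt, Pi.single_apply]
  · simp [phase, wt, Pi.single_apply]

theorem phase_swap_mul (t : Fin m → ℝ) (i : Idx m) : phase t i.swap * phase t i = 1 := by
  rcases i with k | k <;> simp [phase, ← Complex.exp_add]

/-- The diagonal matrix of the phases. -/
abbrev phaseMat (t : Fin m → ℝ) : Matrix (Idx m) (Idx m) ℂ := Matrix.diagonal (phase t)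

/-- The diagonal matrix of the inverse phases. -/
abbrev phaseInv (t : Fin m → ℝ) : Matrix (Idx m) (Idx m) ℂ :=
  Matrix.diagonal fun i => phase t i.swap

/-- The diagonal matrix of the `k`-th components of the weights. -/
abbrev wtMat (k : Fin m) : Matrix (Idx m) (Idx m) ℂ := Matrix.diagonal fun i => (wt i k : ℂ)

theorem J_mul_J : Matrix.J (Fin m) ℂ * Matrix.J (Fin m) ℂ = -1 := Matrix.J_squared _ _

theorem J_eq_zero {i j : Idx m} (h : j ≠ i.swap) : Matrix.J (Fin m) ℂ i j = 0 := by
  rcases i with k | k <;> rcases j with l | l <;> simp at h ⊢ <;> exact fun h' => h h'.symm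

theorem J_mul_diagonal (d : Idx m → ℂ) : Matrix.J (Fin m) ℂ * Matrix.diagonal d =
    Matrix.diagonal (fun i => d i.swap) * Matrix.J (Fin m) ℂ := by
  ext i j
  rw [Matrix.mul_diagonal, Matrix.diagonal_mul]
  by_cases h : j = i.swap
  · subst h; rw [mul_comm]
  · simp [J_eq_zero h]

theorem phaseMat_mul_phaseInv (t : Fin m → ℝ) : phaseMat t * phaseInv t = 1 := by
  rw [Matrix.diagonal_mul_diagonal, ← Matrix.diagonal_one]
  congr 1
  funext i
  rw [mul_comm, phase_swap_mul]

theorem J_mul_phaseMat (t : Fin m → ℝ) :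
    Matrix.J (Fin m) ℂ * phaseMat t = phaseInv t * Matrix.J (Fin m) ℂ := J_mul_diagonal _

variable (K : Matrix (Idx m) (Idx m) ℂ) (t : Fin m → ℝ)

/-- The matrix in the closed formula for the star-exponential, at imaginary parameters. -/
def ampMat : Matrix (Idx m) (Idx m) ℂ :=
  1 - Matrix.J (Fin m) ℂ * K + phaseMat t * (1 + Matrix.J (Fin m) ℂ * K)

/-- `iħ` times the matrix of the quadratic form in the exponent of the star-exponential. -/
def qMat : Matrix (Idx m) (Idx m) ℂ :=
  (ampMat K t)⁻¹ * ((1 - phaseMat t) * Matrix.J (Fin m) ℂ)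

/-- The matrix describing the left star multiplication of the star-exponential by generators. -/
def mMat : Matrix (Idx m) (Idx m) ℂ := 1 + (K + Matrix.J (Fin m) ℂ) * qMat K t

variable {K} {t} (hK : K.IsSymm) (hN : IsUnit (ampMat K t).det)

include hN in
theorem ampMat_mul_qMat : ampMat K t * qMat K t = (1 - phaseMat t) * Matrix.J (Fin m) ℂ := by
  rw [qMat, Matrix.mul_nonsing_inv_cancel_left _ _ hN]

include hK hN in
-- Write `N` for `ampMat K t`, `D` for `phaseMat t` and `A = (1 - D) J`. Symmetry of `N⁻¹ A` amounts
-- to `A Nᵀ = N Aᵀ`. The two sides differ by `2 (J - D J D)`, which is zero because `D` is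
-- symplectic.
theorem qMat_transpose : (qMat K t)ᵀ = qMat K t := by
  set J := Matrix.J (Fin m) ℂ with hJ
  have hJT : Jᵀ = -J := Matrix.J_transpose _ _
  have hDT : (phaseMat t)ᵀ = phaseMat t := Matrix.diagonal_transpose _
  have hNT : (ampMat K t)ᵀ = 1 + K * J + (1 - K * J) * phaseMat t := by
    simp only [ampMat, Matrix.transpose_add, Matrix.transpose_sub, Matrix.transpose_mul,
      Matrix.transpose_one, ← hJ, hJT, hK.eq, hDT]
    noncomm_ring
  have hAT : ((1 - phaseMat t) * J)ᵀ = -(J * (1 - phaseMat t)) := by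
    rw [Matrix.transpose_mul, Matrix.transpose_sub, Matrix.transpose_one, hDT, hJT, neg_mul]
  have h1 : ((1 - phaseMat t) * J) * (ampMat K t)ᵀ =
      ampMat K t * ((1 - phaseMat t) * J)ᵀ := by
    have hDD := phaseMat_mul_phaseInv t
    have hJD := J_mul_phaseMat t
    rw [hNT, hAT, ampMat, ← hJ]
    have e1 : phaseMat t * J * phaseMat t = J := by
      rw [mul_assoc, ← hJ] at *
      rw [hJD, ← mul_assoc, hDD, one_mul]
    have e2 : (1 - phaseMat t) * J * (1 + K * J + (1 - K * J) * phaseMat t) -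
        (1 - J * K + phaseMat t * (1 + J * K)) * -(J * (1 - phaseMat t)) =
        2 • (J - phaseMat t * J * phaseMat t) := by
      noncomm_ring
    rw [← sub_eq_zero, e2, e1, sub_self, smul_zero]
  have hN' : IsUnit (ampMat K t)ᵀ.det := by rwa [Matrix.det_transpose]
  rw [qMat, Matrix.transpose_mul, Matrix.transpose_nonsing_inv]
  rw [← hJ]
  calc _ = (ampMat K t)⁻¹ * (ampMat K t * ((1 - phaseMat t) * J)ᵀ) * ((ampMat K t)ᵀ)⁻¹ := by
        rw [Matrix.nonsing_inv_mul_cancel_left _ _ hN]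
    _ = _ := by
        rw [← h1, mul_assoc, Matrix.mul_nonsing_inv_cancel_right _ _ hN']

include hK hN in
-- With `N` for `ampMat K t` and `Q` for `qMat K t`, symmetry of `Q` gives `N Mᵀ = N + N Q (K - J)`.
-- By `ampMat_mul_qMat` all terms cancel except the constant 2.
theorem mMat_transpose : (mMat K t)ᵀ = (2 : ℂ) • (ampMat K t)⁻¹ := by
  set J := Matrix.J (Fin m) ℂ with hJ
  have hJT : Jᵀ = -J := Matrix.J_transpose _ _
  have hJJ : J * J = -1 := J_mul_J
  have h1 : (mMat K t)ᵀ = 1 + qMat K t * (K - J) := by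
    rw [mMat, Matrix.transpose_add, Matrix.transpose_mul, qMat_transpose hK hN,
      Matrix.transpose_add, hK.eq, ← hJ, hJT, Matrix.transpose_one, sub_eq_add_neg]
  have h2 : ampMat K t * (mMat K t)ᵀ = 2 := by
    rw [h1, mul_add, ← mul_assoc, ampMat_mul_qMat hN, ← hJ, ampMat, ← hJ]
    have : (1 - phaseMat t) * J * (K - J) = (1 - phaseMat t) * (J * K - J * J) := by noncomm_ring
    rw [this, hJJ]
    noncomm_ring
    exact (two_nsmul _).trans one_add_one_eq_two
  have h3 := congrArg (fun X => (ampMat K t)⁻¹ * X) h2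
  simp only [Matrix.nonsing_inv_mul_cancel_left _ _ hN] at h3
  rw [h3, mul_two, two_smul]

include hN in
-- Replacing `K + J` by `K - J` turns left into right star multiplication. The identity says that on
-- the star-exponential the two differ only by the phases, and it comes from `D J N = D (K + J) - (K
-- - J)`, where `D` and `N` stand for `phaseMat t` and `ampMat K t`.
theorem phaseMat_mul_mMat : phaseMat t * mMat K t =
    1 + (K - Matrix.J (Fin m) ℂ) * qMat K t := by
  set J := Matrix.J (Fin m) ℂ with hJ
  have hJJ : J * J = -1 := J_mul_J
  have hDD := phaseMat_mul_phaseInv t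
  have hJD : J * phaseMat t = phaseInv t * J := J_mul_phaseMat t
  have h1 : phaseMat t * J * ampMat K t = phaseMat t * (K + J) - (K - J) := by
    have : phaseMat t * J * ampMat K t = phaseMat t * (J - J * J * K) +
        phaseMat t * (J * phaseMat t) * (1 + J * K) := by
      rw [ampMat, ← hJ]; noncomm_ring
    rw [this, hJD, ← mul_assoc (phaseMat t) (phaseInv t), hDD, hJJ]
    have : (1 : Matrix (Idx m) (Idx m) ℂ) * J * (1 + J * K) = J + J * J * K := by noncomm_ring
    rw [this, hJJ]
    noncomm_ring
  have h2 : (phaseMat t * (K + J) - (K - J)) * qMat K t = 1 - phaseMat t := by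
    rw [← h1, mul_assoc, ampMat_mul_qMat hN, ← hJ]
    have : phaseMat t * J * ((1 - phaseMat t) * J) = phaseMat t * (J * J) -
        phaseMat t * (J * phaseMat t) * J := by noncomm_ring
    rw [this, hJD, ← mul_assoc (phaseMat t) (phaseInv t), hDD, one_mul, hJJ]
    noncomm_ring
  rw [mMat, ← hJ]
  have h3 : phaseMat t * (1 + (K + J) * qMat K t) = phaseMat t +
      ((phaseMat t * (K + J) - (K - J)) * qMat K t) + (K - J) * qMat K t := by noncomm_ring
  rw [h3, h2]
  noncomm_ring

include hN in
/-- Algebraic form of the derivative of `qMat`. -/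
theorem wtMat_mul_eq (k : Fin m) : -(wtMat k * phaseMat t * Matrix.J (Fin m) ℂ) -
    (wtMat k * phaseMat t * (1 + Matrix.J (Fin m) ℂ * K)) * qMat K t =
    -(wtMat k * Matrix.J (Fin m) ℂ * mMat K t) := by
  set J := Matrix.J (Fin m) ℂ with hJ
  have hJJ : J * J = -1 := J_mul_J
  -- This is `J` times the identity `phaseMat_mul_mMat`.
  have h1 : J + (1 + J * K) * qMat K t = J * phaseMat t * mMat K t := by
    rw [mul_assoc, phaseMat_mul_mMat hN, ← hJ]
    have : J * (1 + (K - J) * qMat K t) = J + (J * K - J * J) * qMat K t := by noncomm_ring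
    rw [this, hJJ]
    noncomm_ring
  have h2 : -(wtMat k * phaseMat t * J) - (wtMat k * phaseMat t * (1 + J * K)) * qMat K t =
      -(wtMat k * phaseMat t * (J + (1 + J * K) * qMat K t)) := by noncomm_ring
  have h3 : phaseMat t * J * phaseMat t = J := by
    rw [mul_assoc, J_mul_phaseMat t, ← mul_assoc, phaseMat_mul_phaseInv, one_mul]
  rw [h2, h1]
  have h4 : wtMat k * phaseMat t * (J * phaseMat t * mMat K t) =
      wtMat k * (phaseMat t * J * phaseMat t) * mMat K t := by noncomm_ring
  rw [h4, h3]

include hN in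
-- After cyclic rotation the two matrices differ by `wtMat k` alone, whose trace is zero because
-- `ũ_k` and `ṽ_k` have opposite weights.
theorem trace_eq (k : Fin m) : Matrix.trace ((ampMat K t)⁻¹ *
    (wtMat k * phaseMat t * (1 + Matrix.J (Fin m) ℂ * K))) =
    Matrix.trace (wtMat k * Matrix.J (Fin m) ℂ * (K + Matrix.J (Fin m) ℂ) * (ampMat K t)⁻¹) := by
  set J := Matrix.J (Fin m) ℂ with hJ
  have hJJ : J * J = -1 := J_mul_J
  rw [Matrix.trace_mul_comm, ← sub_eq_zero, ← Matrix.trace_sub, ← sub_mul]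
  have h1 : wtMat k * phaseMat t * (1 + J * K) - wtMat k * J * (K + J) = wtMat k * ampMat K t := by
    have : wtMat k * phaseMat t * (1 + J * K) - wtMat k * J * (K + J) =
        wtMat k * (phaseMat t * (1 + J * K) - J * K - J * J) := by noncomm_ring
    rw [this, hJJ, ampMat, ← hJ]
    congr 1
    noncomm_ring
  rw [h1, mul_assoc, Matrix.mul_nonsing_inv _ hN, mul_one, Matrix.trace_diagonal]
  simp [wt]

end
end PseudoVacuum

/-! ### Gaussians, determinants, and analyticity -/

namespace PseudoVacuum
noncomputable section
open scoped Matrix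
variable {m : ℕ}

/-- Linear forms as entire functions. -/
def linE (v : Idx m → ℂ) : Entire m := ∑ l, v l • coord l

theorem linE_apply (v x : Idx m → ℂ) : (linE v : Fn m) x = v ⬝ᵥ x := by
  simp [linE, gen, dotProduct, -Fintype.sum_sum_type]

theorem genOp_linE_mul (Λ : Matrix (Idx m) (Idx m) ℂ) (ħ : ℝ) (i : Idx m) (v : Idx m → ℂ)
    (f : Entire m) : genOp Λ ħ i (linE v * f) =
      linE v * genOp Λ ħ i f + (I * ħ / 2 * (Λ i ⬝ᵥ v)) • f := by
  simp only [linE, Finset.sum_mul, smul_mul_assoc, map_sum, map_smul, genOp_coord_mul, smul_add,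
    Finset.sum_add_distrib, dotProduct, Finset.mul_sum, Finset.sum_smul, smul_smul]
  congr 1
  exact Finset.sum_congr rfl fun l _ => by congr 1; ring

/-- The exponential of a polynomial of degree two without linear part. -/
def gaussian (a : ℂ) (Q : Matrix (Idx m) (Idx m) ℂ) : Entire m :=
  ⟨fun x => Complex.exp (a + ∑ i, ∑ j, Q i j * (x i * x j)), by
    constructor
    · fun_prop
    · intro x _
      have h : ∀ i, AnalyticAt ℝ (fun x : Idx m → ℂ => x i) x := fun i =>
        (ContinuousLinearMap.proj (R := ℝ) (φ := fun _ : Idx m => ℂ) i).analyticAt x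
      refine AnalyticAt.comp (g := Complex.exp) (analyticAt_cexp.restrictScalars (𝕜 := ℝ)) (analyticAt_const.add ?_)
      exact Finset.analyticAt_fun_sum _ fun i _ => Finset.analyticAt_fun_sum _ fun j _ =>
        analyticAt_const.mul ((h i).mul (h j))⟩

theorem gaussian_apply (a : ℂ) (Q : Matrix (Idx m) (Idx m) ℂ) (x : Idx m → ℂ) :
    (gaussian a Q : Fn m) x = Complex.exp (a + ∑ i, ∑ j, Q i j * (x i * x j)) := rfl

theorem D_gaussian (a : ℂ) {Q : Matrix (Idx m) (Idx m) ℂ} (hQ : Qᵀ = Q) (l : Idx m) :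
    D l (gaussian a Q) = linE ((2 : ℂ) • Q l) * gaussian a Q := by
  apply Subtype.ext
  funext x
  have hp : ∀ i, HasFDerivAt (fun x : Idx m → ℂ => x i)
      (ContinuousLinearMap.proj (R := ℂ) (φ := fun _ : Idx m => ℂ) i) x := fun i =>
    (ContinuousLinearMap.proj (R := ℂ) (φ := fun _ : Idx m => ℂ) i).hasFDerivAt
  have h1 : HasFDerivAt (gaussian a Q : Fn m) _ x :=
    ((HasFDerivAt.fun_sum fun i _ => HasFDerivAt.fun_sum fun j _ =>
      ((hp i).mul (hp j)).const_mul (Q i j)).const_add a).cexp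
  rw [coe_D, pd, h1.fderiv]
  have hs : ∀ i, Q i l = Q l i := fun i => congrFun (congrFun hQ l) i
  change _ = ((linE _ : Entire m) : Fn m) x * (gaussian a Q : Fn m) x
  rw [linE_apply, gaussian_apply, mul_comm]
  simp only [smul_apply, sum_apply, smul_eq_mul,
    add_apply, ContinuousLinearMap.proj_apply, dotProduct, Pi.smul_apply]
  congr 1
  have h2 : ∀ i j, Q i j * (x i * (Pi.single l 1 : Idx m → ℂ) j + x j * (Pi.single l 1 : Idx m → ℂ) i)
      = (if j = l then Q i l * x i else 0) + (if i = l then Q l j * x j else 0) := by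
    intro i j
    by_cases hj : j = l <;> by_cases hi : i = l <;> (simp [hi, hj]; try ring)
  simp only [h2, Finset.sum_add_distrib, Finset.sum_ite_eq', Finset.mem_univ, if_true, hs]
  rw [Finset.sum_comm]
  simp only [Finset.sum_ite_eq', Finset.mem_univ, if_true, mul_assoc, ← Finset.mul_sum]
  ring

/-- Differentiating a Gaussian multiplies it by a linear form, so each generator acts on it through
one row of a matrix. With `Q = (1/iħ) qMat` and `Λ = K + J` this matrix is `mMat`. -/
theorem genOp_gaussian (Λ : Matrix (Idx m) (Idx m) ℂ) (ħ : ℝ) (a : ℂ)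
    {Q : Matrix (Idx m) (Idx m) ℂ} (hQ : Qᵀ = Q) (i : Idx m) :
    genOp Λ ħ i (gaussian a Q) = linE ((1 + (I * ħ) • (Λ * Q)) i) * gaussian a Q := by
  rw [genOp_apply]
  simp only [D_gaussian a hQ]
  apply Subtype.ext
  funext x
  change gen i x * (gaussian a Q : Fn m) x + (I * ħ / 2) * ((∑ j, Λ i j • (linE _ * gaussian a Q) :
    Entire m) : Fn m) x = ((linE _ : Entire m) : Fn m) x * (gaussian a Q : Fn m) x
  have h1 : ((∑ j, Λ i j • (linE ((2 : ℂ) • Q j) * gaussian a Q) : Entire m) : Fn m) x =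
      ∑ j, Λ i j * (2 * (Q j ⬝ᵥ x) * (gaussian a Q : Fn m) x) := by
    simp [linE_apply, -Fintype.sum_sum_type]
  have h2 : (1 + (I * ħ) • (Λ * Q)) i = Pi.single i 1 + (I * ħ : ℂ) • (Λ * Q) i := by
    funext j
    simp [Matrix.one_apply, Pi.single_apply, eq_comm]
  have h3 : (Λ * Q) i ⬝ᵥ x = ∑ j, Λ i j * (Q j ⬝ᵥ x) := by
    simp only [dotProduct, Matrix.mul_apply, Finset.sum_mul, Finset.mul_sum]
    rw [Finset.sum_comm]
    simp only [mul_assoc]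
  rw [h1, linE_apply, h2, add_dotProduct, smul_dotProduct, h3, single_dotProduct]
  have h4 : ∑ j, Λ i j * (2 * (Q j ⬝ᵥ x) * (gaussian a Q : Fn m) x) =
      2 * (∑ j, Λ i j * (Q j ⬝ᵥ x)) * (gaussian a Q : Fn m) x := by
    simp only [Finset.mul_sum, Finset.sum_mul]
    exact Finset.sum_congr rfl fun j _ => by ring
  rw [h4, gen, smul_eq_mul]
  ring

/-- Jacobi's formula for the derivative of a determinant. -/
theorem hasDerivAt_det {n : Type*} [Fintype n] [DecidableEq n] {X : ℝ → Matrix n n ℂ}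
    {X' : Matrix n n ℂ} {s : ℝ} (h : ∀ i j, HasDerivAt (fun s => X s i j) (X' i j) s) :
    HasDerivAt (fun s => (X s).det) (Matrix.trace ((X s).adjugate * X')) s := by
  have h1 : HasDerivAt (fun s => ∑ σ : Equiv.Perm n, ((Equiv.Perm.sign σ : ℤ) : ℂ) *
      ∏ i, X s (σ i) i) (∑ σ : Equiv.Perm n, ((Equiv.Perm.sign σ : ℤ) : ℂ) *
        ∑ i, (∏ j ∈ Finset.univ.erase i, X s (σ j) j) • X' (σ i) i) s :=
    HasDerivAt.fun_sum fun σ _ => (HasDerivAt.fun_finsetProd fun i _ => h (σ i) i).const_mul _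
  simp only [Matrix.det_apply']
  convert! h1 using 1
  have h2 : Matrix.trace ((X s).adjugate * X') =
      ∑ i, ((X s).updateCol i fun j => X' j i).det := by
    rw [Matrix.trace]
    refine Finset.sum_congr rfl fun i _ => ?_
    rw [← Matrix.cramer_apply, Matrix.cramer_eq_adjugate_mulVec, Matrix.diag_apply,
      Matrix.mul_apply]
    rfl
  rw [h2]
  simp only [Matrix.det_apply', Finset.mul_sum]
  rw [Finset.sum_comm]
  refine Finset.sum_congr rfl fun σ _ => Finset.sum_congr rfl fun i _ => ?_
  rw [← Finset.mul_prod_erase _ _ (Finset.mem_univ i), Matrix.updateCol_self, smul_eq_mul,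
    mul_comm (X' _ _)]
  congr 2
  refine Finset.prod_congr rfl fun j hj => ?_
  rw [Matrix.updateCol_ne (Finset.ne_of_mem_erase hj)]

theorem analyticAt_det {E n : Type*} [NormedAddCommGroup E] [NormedSpace ℝ E] [Fintype n]
    [DecidableEq n] {X : E → Matrix n n ℂ} {p : E} (h : ∀ i j, AnalyticAt ℝ (fun q => X q i j) p) :
    AnalyticAt ℝ (fun q => (X q).det) p := by
  simp only [Matrix.det_apply']
  exact Finset.analyticAt_fun_sum _ fun σ _ => analyticAt_const.mul
    (Finset.analyticAt_fun_prod _ fun i _ => h _ _)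

theorem analyticAt_matrix_inv {E n : Type*} [NormedAddCommGroup E] [NormedSpace ℝ E] [Fintype n]
    [DecidableEq n] {X : E → Matrix n n ℂ} {p : E} (h : ∀ i j, AnalyticAt ℝ (fun q => X q i j) p)
    (hp : (X p).det ≠ 0) (i j : n) : AnalyticAt ℝ (fun q => (X q)⁻¹ i j) p := by
  simp only [Matrix.inv_def, Matrix.smul_apply, smul_eq_mul, Ring.inverse_eq_inv',
    Matrix.adjugate_apply]
  refine ((analyticAt_det h).inv hp).mul (analyticAt_det fun a b => ?_)
  simp only [Matrix.updateRow_apply]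
  split_ifs
  · exact analyticAt_const
  · exact h a b

theorem analyticAt_matrix_mul {E n : Type*} [NormedAddCommGroup E] [NormedSpace ℝ E] [Fintype n]
    {X Y : E → Matrix n n ℂ} {p : E} (hX : ∀ i j, AnalyticAt ℝ (fun q => X q i j) p)
    (hY : ∀ i j, AnalyticAt ℝ (fun q => Y q i j) p) (i j : n) :
    AnalyticAt ℝ (fun q => (X q * Y q) i j) p := by
  simp only [Matrix.mul_apply]
  exact Finset.analyticAt_fun_sum _ fun l _ => (hX i l).mul (hY l j)

theorem hasDerivAt_matrix_mul {n : Type*} [Fintype n] {X Y : ℝ → Matrix n n ℂ}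
    {X' Y' : Matrix n n ℂ} {s : ℝ} (hX : ∀ i j, HasDerivAt (fun s => X s i j) (X' i j) s)
    (hY : ∀ i j, HasDerivAt (fun s => Y s i j) (Y' i j) s) (i j : n) :
    HasDerivAt (fun s => (X s * Y s) i j) ((X' * Y s + X s * Y') i j) s := by
  simp only [Matrix.mul_apply, Matrix.add_apply, ← Finset.sum_add_distrib]
  exact HasDerivAt.fun_sum fun l _ => (hX i l).mul (hY l j)

/-- A continuous logarithm of an analytic function is analytic. -/
theorem analyticAt_of_exp {E : Type*} [NormedAddCommGroup E] [NormedSpace ℝ E] {φ : E → ℂ} {p : E}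
    (hφ : Continuous φ) (h : AnalyticAt ℝ (fun q => Complex.exp (φ q)) p) : AnalyticAt ℝ φ p := by
  -- Near `p` the difference `φ q - φ p` is smaller than `π` in norm, so the principal logarithm
  -- recovers it from its exponential.
  have h1 : AnalyticAt ℝ (fun q => φ p + Complex.log (Complex.exp (φ q) * Complex.exp (-φ p))) p := by
    refine analyticAt_const.add ?_
    refine AnalyticAt.fun_comp (g := Complex.log) ?_ (h.mul analyticAt_const)
    refine (analyticAt_clog ?_).restrictScalars
    rw [← Complex.exp_add]
    simp
  refine h1.congr ?_
  have h2 : ∀ᶠ q in nhds p, ‖φ q - φ p‖ < Real.pi := by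
    have : Continuous fun q => ‖φ q - φ p‖ := by fun_prop
    exact this.continuousAt.eventually_lt continuousAt_const (by simp [Real.pi_pos])
  filter_upwards [h2] with q hq
  have h3 := abs_lt.1 (lt_of_le_of_lt (Complex.abs_im_le_norm _) hq)
  rw [← Complex.exp_add, ← sub_eq_add_neg, Complex.log_exp h3.1 h3.2.le]
  ring

end
end PseudoVacuum

/-! ### The amplitude determinant and its periodic logarithm -/

namespace PseudoVacuum
noncomputable section
open scoped Matrix
variable {m : ℕ}

/-- Such a function is analytic by `analyticAt_of_exp`. Differentiating its constant exponential
shows that its derivative is zero, since the exponential has no zeros. -/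
theorem eq_of_exp_const {E : Type*} [NormedAddCommGroup E] [NormedSpace ℝ E] {φ : E → ℂ} {c : ℂ}
    (hφ : Continuous φ) (h : ∀ q, Complex.exp (φ q) = c) (p q : E) : φ p = φ q := by
  have han : ∀ p, AnalyticAt ℝ φ p := fun p =>
    analyticAt_of_exp hφ (by simp only [h]; exact analyticAt_const)
  refine is_const_of_fderiv_eq_zero (𝕜 := ℝ) (fun p => (han p).differentiableAt) (fun p => ?_) p q
  have h1 := (han p).differentiableAt.hasFDerivAt.cexp
  simp only [h] at h1
  have h2 := h1.unique (hasFDerivAt_const c p)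
  refine (smul_eq_zero.1 h2).resolve_left ?_
  rw [← h p]
  exact Complex.exp_ne_zero _

theorem norm_lt_of_abscissa_neg {lam : ℂ} (h : abscissa lam < 0) : ‖1 + lam‖ < ‖1 - lam‖ := by
  rw [abscissa, ENNReal.log_lt_zero_iff] at h
  by_contra hle
  have h1 : ‖1 - lam‖ₑ ≤ ‖1 + lam‖ₑ := by
    rw [← ofReal_norm, ← ofReal_norm]
    exact ENNReal.ofReal_le_ofReal (not_lt.1 hle)
  -- For `lam = 1` the quotient is infinite rather than given by the norms, and the abscissa is
  -- `+∞`, which contradicts the hypothesis.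
  by_cases h0 : ‖1 - lam‖ₑ = 0
  · have h2 : 1 - lam = 0 := by simpa using h0
    have h3 : ‖1 + lam‖ₑ ≠ 0 := by
      intro h3
      have h4 : 1 + lam = 0 := by simpa using h3
      have h5 : (2 : ℂ) = 0 := by linear_combination h2 + h4
      norm_num at h5
    rw [h0, ENNReal.div_zero h3] at h
    exact absurd h (by simp)
  · refine absurd h (not_lt.2 ?_)
    rw [← ENNReal.div_self h0 enorm_ne_top]
    exact ENNReal.div_le_div_right h1 _

theorem norm_lt_of_abscissa_pos {lam : ℂ} (h : 0 < abscissa lam) : ‖1 - lam‖ < ‖1 + lam‖ := by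
  rw [abscissa, ENNReal.zero_lt_log_iff] at h
  by_contra hle
  have h1 : ‖1 + lam‖ₑ ≤ ‖1 - lam‖ₑ := by
    rw [← ofReal_norm, ← ofReal_norm]
    exact ENNReal.ofReal_le_ofReal (not_lt.1 hle)
  exact absurd h (not_lt.2 (ENNReal.div_le_of_le_mul (by rwa [one_mul])))

/-- Zero lies strictly between the two abscissae, so one root is of each type. Which of `rootPlus`
and `rootMinus` it is does not matter: the determinant depends only on their sum and product. -/
theorem exists_roots {K : Matrix (Idx m) (Idx m) ℂ} {k : Fin m} (h1 : exchangeLeft K k < 0)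
    (h2 : 0 < exchangeRight K k) : ∃ α β : ℂ, ‖1 + α‖ < ‖1 - α‖ ∧ ‖1 - β‖ < ‖1 + β‖ ∧
      α + β = 2 * K (Sum.inl k) (Sum.inr k) ∧ α * β = K (Sum.inl k) (Sum.inr k) ^ 2 -
        K (Sum.inl k) (Sum.inl k) * K (Sum.inr k) (Sum.inr k) := by
  have hr : ((K (Sum.inl k) (Sum.inl k) * K (Sum.inr k) (Sum.inr k)) ^ (1 / 2 : ℂ)) ^ 2 =
      K (Sum.inl k) (Sum.inl k) * K (Sum.inr k) (Sum.inr k) := by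
    rw [← Complex.cpow_nat_mul]; simp
  have hs : rootPlus K k + rootMinus K k = 2 * K (Sum.inl k) (Sum.inr k) := by
    rw [rootPlus, rootMinus]; ring
  have hp : rootPlus K k * rootMinus K k = K (Sum.inl k) (Sum.inr k) ^ 2 -
      K (Sum.inl k) (Sum.inl k) * K (Sum.inr k) (Sum.inr k) := by
    rw [rootPlus, rootMinus]; linear_combination -hr
  rcases min_lt_iff.1 h1 with a | a <;> rcases lt_max_iff.1 h2 with b | b
  · exact absurd (a.trans b) (lt_irrefl _)
  · exact ⟨_, _, norm_lt_of_abscissa_neg a, norm_lt_of_abscissa_pos b, hs, hp⟩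
  · exact ⟨_, _, norm_lt_of_abscissa_neg a, norm_lt_of_abscissa_pos b, by rw [add_comm, hs],
      by rw [mul_comm, hp]⟩
  · exact absurd (a.trans b) (lt_irrefl _)

/-- The determinant along the `k`-th coordinate axis. -/
theorem det_ampMat_single {K : Matrix (Idx m) (Idx m) ℂ} (hK : K.IsSymm) (k : Fin m) (s : ℝ) :
    (ampMat K (Pi.single k s)).det = 2 ^ Fintype.card (Idx m) *
      ((1 + 1 / 2 * (Complex.exp (I * s) - 1) * (1 - K (Sum.inl k) (Sum.inr k))) *
        (1 + 1 / 2 * (Complex.exp (-(I * s)) - 1) * (1 + K (Sum.inl k) (Sum.inr k))) +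
        1 / 4 * (Complex.exp (I * s) - 1) * (Complex.exp (-(I * s)) - 1) *
          (K (Sum.inl k) (Sum.inl k) * K (Sum.inr k) (Sum.inr k))) := by
  set κ : Matrix (Idx m) (Idx m) ℂ := Matrix.J (Fin m) ℂ * K with hκ
  -- Only the entries of `ũ_k` and `ṽ_k` contribute to `D - 1`, where `D` is the phase matrix. It
  -- factors through a two-dimensional space, and `det (1 + U V) = det (1 + V U)` reduces the
  -- determinant to size two.
  let idx : Fin 2 → Idx m := ![Sum.inl k, Sum.inr k]
  let d : Fin 2 → ℂ := ![Complex.exp (I * s) - 1, Complex.exp (-(I * s)) - 1]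
  let U : Matrix (Idx m) (Fin 2) ℂ := Matrix.of fun i a => if i = idx a then 1 else 0
  have hU : ∀ i a, U i a = if i = idx a then 1 else 0 := fun _ _ => rfl
  have hD : phaseMat (Pi.single k s) - 1 = U * (Matrix.diagonal d * Uᵀ) := by
    ext i j
    rw [Matrix.sub_apply, Matrix.mul_apply, Fin.sum_univ_two]
    simp only [Matrix.diagonal_mul, Matrix.transpose_apply, hU, idx, d, Matrix.cons_val_zero,
      Matrix.cons_val_one, Matrix.diagonal_apply, Matrix.one_apply]
    rcases i with i | i <;> rcases j with j | j <;> by_cases hi : i = k <;> by_cases hj : j = k <;>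
      by_cases hij : i = j <;> simp_all [phase]
  have h1 : ampMat K (Pi.single k s) =
      (2 : ℂ) • (1 + U * ((1 / 2 : ℂ) • (Matrix.diagonal d * Uᵀ * (1 + κ)))) := by
    have : ampMat K (Pi.single k s) = (2 : ℂ) • 1 + (phaseMat (Pi.single k s) - 1) * (1 + κ) := by
      rw [ampMat, ← hκ, two_smul]
      noncomm_ring
    rw [this, hD, smul_add, Matrix.mul_smul, smul_smul]
    norm_num [Matrix.mul_assoc]
  have huu : κ (Sum.inl k) (Sum.inl k) = -K (Sum.inl k) (Sum.inr k) := by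
    rw [hκ, Matrix.mul_apply, ← hK.apply]
    simp
  have huv : κ (Sum.inl k) (Sum.inr k) = -K (Sum.inr k) (Sum.inr k) := by
    rw [hκ, Matrix.mul_apply]
    simp
  have hvu : κ (Sum.inr k) (Sum.inl k) = K (Sum.inl k) (Sum.inl k) := by
    rw [hκ, Matrix.mul_apply]
    simp
  have hvv : κ (Sum.inr k) (Sum.inr k) = K (Sum.inl k) (Sum.inr k) := by
    rw [hκ, Matrix.mul_apply]
    simp
  have h2 : ∀ a b : Fin 2, ((1 / 2 : ℂ) • (Matrix.diagonal d * Uᵀ * (1 + κ)) * U :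
      Matrix (Fin 2) (Fin 2) ℂ) a b =
      1 / 2 * d a * ((1 : Matrix (Idx m) (Idx m) ℂ) (idx a) (idx b) + κ (idx a) (idx b)) := by
    intro a b
    simp only [Matrix.smul_mul, Matrix.smul_apply, Matrix.mul_assoc, Matrix.diagonal_mul, smul_eq_mul]
    have : (Uᵀ * ((1 + κ) * U) : Matrix (Fin 2) (Fin 2) ℂ) a b = (1 + κ) (idx a) (idx b) := by
      simp [Matrix.mul_apply, hU, -Fintype.sum_sum_type]
    rw [this, Matrix.add_apply, mul_assoc]
  have h01 : (1 : Matrix (Idx m) (Idx m) ℂ) (idx 0) (idx 1) = 0 :=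
    Matrix.one_apply_ne (by simp [idx])
  have h10 : (1 : Matrix (Idx m) (Idx m) ℂ) (idx 1) (idx 0) = 0 :=
    Matrix.one_apply_ne (by simp [idx])
  rw [h1, Matrix.det_smul, Matrix.det_one_add_mul_comm, Matrix.det_fin_two]
  simp only [Matrix.add_apply, h2, h01, h10, idx, d, Matrix.cons_val_zero, Matrix.cons_val_one, huu, huv, hvu,
    hvv]
  simp
  ring


/-- The condition `a_k < 0 < b_k` enters here. Both nonconstant factors stay in the disc of radius
less than 1 about 1, so the determinant does not wind around zero along the `k`-th axis. -/
theorem exists_det_ampMat_single_eq {K : Matrix (Idx m) (Idx m) ℂ} (hK : K ∈ frakK0 m)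
    (k : Fin m) : ∃ C p q : ℂ, C ≠ 0 ∧ ‖p‖ < 1 ∧ ‖q‖ < 1 ∧ ∀ s : ℝ,
      (ampMat K (Pi.single k s)).det =
        C * (1 + p * Complex.exp (-(I * s))) * (1 + q * Complex.exp (I * s)) := by
  obtain ⟨α, β, hα, hβ, hs, hp⟩ := exists_roots (hK.2.1 k).1 (hK.2.1 k).2
  have hα0 : 1 - α ≠ 0 := norm_pos_iff.1 ((norm_nonneg _).trans_lt hα)
  have hβ0 : 1 + β ≠ 0 := norm_pos_iff.1 ((norm_nonneg _).trans_lt hβ)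
  -- The determinant has one factor `e^{-is}` to spare. Giving it to the root `α`, for which `1 - α`
  -- is the larger coefficient, makes both quotients `p` and `q` less than 1 in norm.
  refine ⟨2 ^ Fintype.card (Idx m) * (1 / 4 * (1 - α) * (1 + β)), (1 + α) / (1 - α),
    (1 - β) / (1 + β), ?_, ?_, ?_, fun s => ?_⟩
  · exact mul_ne_zero (pow_ne_zero _ two_ne_zero) (mul_ne_zero (mul_ne_zero (by norm_num) hα0) hβ0)
  · rwa [norm_div, div_lt_one (norm_pos_iff.2 hα0)]
  · rwa [norm_div, div_lt_one (norm_pos_iff.2 hβ0)]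
  · rw [det_ampMat_single hK.1]
    have he : Complex.exp (I * s) * Complex.exp (-(I * s)) = 1 := by
      rw [← Complex.exp_add]; simp
    generalize Complex.exp (I * s) = w at *
    generalize Complex.exp (-(I * s)) = w' at *
    have h1 : 2 ^ Fintype.card (Idx m) * (1 / 4 * (1 - α) * (1 + β)) * (1 + (1 + α) / (1 - α) * w') *
        (1 + (1 - β) / (1 + β) * w) = 2 ^ Fintype.card (Idx m) * (1 / 4 *
          ((1 - α) + (1 + α) * w') * ((1 + β) + (1 - β) * w)) := by
      field_simp
    rw [h1]
    congr 1
    generalize K (Sum.inl k) (Sum.inr k) = c at *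
    have h2 : K (Sum.inl k) (Sum.inl k) * K (Sum.inr k) (Sum.inr k) = c ^ 2 - α * β := by
      rw [hp]; ring
    rw [h2]
    have h3 : β = 2 * c - α := by rw [← hs]; ring
    subst h3
    linear_combination (1 / 2 * (c - α)) * he

theorem phase_zero : phase (0 : Fin m → ℝ) = 1 := by
  funext i
  rcases i with k | k <;> simp [phase]

theorem phase_periodic (k : Fin m) (t : Fin m → ℝ) :
    phase (t + Pi.single k (2 * Real.pi)) = phase t := by
  have h : ∀ l, Complex.exp (I * ((t + Pi.single k (2 * Real.pi) : Fin m → ℝ) l)) =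
       Complex.exp (I * t l) := by
    intro l
    by_cases hl : l = k
    · subst hl
      rw [Pi.add_apply, Pi.single_eq_same]
      push_cast
      rw [mul_add, Complex.exp_add, mul_comm I (2 * (Real.pi : ℂ)), Complex.exp_two_pi_mul_I, mul_one]
    · simp [hl]
  funext i
  rcases i with l | l
  · exact h l
  · simp only [phase, Sum.elim_inr, Complex.exp_neg, h]

theorem analyticAt_phase (i : Idx m) (t : Fin m → ℝ) :
    AnalyticAt ℝ (fun t : Fin m → ℝ => phase t i) t := by
  have h : ∀ l, AnalyticAt ℝ (fun t : Fin m → ℝ => I * (t l : ℂ)) t := fun l =>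
    analyticAt_const.mul ((Complex.ofRealCLM.comp
      (ContinuousLinearMap.proj (R := ℝ) (φ := fun _ : Fin m => ℝ) l)).analyticAt t)
  have he : ∀ z, AnalyticAt ℝ Complex.exp z := fun z => analyticAt_cexp.restrictScalars
  rcases i with l | l
  · exact (he _).comp (h l)
  · exact (he _).comp (h l).neg

theorem ampMat_apply (K : Matrix (Idx m) (Idx m) ℂ) (t : Fin m → ℝ) (i j : Idx m) :
    ampMat K t i j = (1 - Matrix.J (Fin m) ℂ * K) i j +
      phase t i * (1 + Matrix.J (Fin m) ℂ * K) i j := by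
  rw [ampMat, Matrix.add_apply, Matrix.diagonal_mul]

theorem analyticAt_ampMat (K : Matrix (Idx m) (Idx m) ℂ) (t : Fin m → ℝ) (i j : Idx m) :
    AnalyticAt ℝ (fun t => ampMat K t i j) t := by
  simp only [ampMat_apply]
  exact analyticAt_const.add ((analyticAt_phase i t).mul analyticAt_const)

theorem ampMat_periodic (K : Matrix (Idx m) (Idx m) ℂ) (k : Fin m) (t : Fin m → ℝ) :
    ampMat K (t + Pi.single k (2 * Real.pi)) = ampMat K t := by
  rw [ampMat, phaseMat, phase_periodic]
  rfl

variable {K : Matrix (Idx m) (Idx m) ℂ} (hK : K ∈ frakK0 m)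

include hK in
theorem det_ampMat_ne_zero (t : Fin m → ℝ) : (ampMat K t).det ≠ 0 := hK.2.2 t

include hK in
/-- The determinant has a periodic logarithm. -/
theorem exists_log_det : ∃ φ : (Fin m → ℝ) → ℂ, Continuous φ ∧ φ 0 = 0 ∧
    (∀ t, Complex.exp (φ t) * (ampMat K 0).det = (ampMat K t).det) ∧
    ∀ k t, φ (t + Pi.single k (2 * Real.pi)) = φ t := by
  have hcont : Continuous fun t => (ampMat K t).det := continuous_iff_continuousAt.2 fun t =>
    (analyticAt_det fun i j => analyticAt_ampMat K t i j).continuousAt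
  -- The determinant has no zeros on the simply connected parameter space, so it has a continuous
  -- logarithm there.
  have hsc : IsSimplyConnected (Set.univ : Set (Fin m → ℝ)) := by
    have := (convex_univ (𝕜 := ℝ) (E := Fin m → ℝ)).contractibleSpace Set.univ_nonempty
    exact SimplyConnectedSpace.ofContractible _
  obtain ⟨ψ, hψ, hexp⟩ := Complex.exists_continuousOn_eqOn_exp_comp (X := Fin m → ℝ)
    (U := Set.univ) hsc isOpen_univ hcont.continuousOn
    (by rintro ⟨t, -, ht⟩; exact det_ampMat_ne_zero hK t ht)
  rw [continuousOn_univ] at hψ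
  have hexp' : ∀ t, Complex.exp (ψ t) = (ampMat K t).det := fun t => hexp (Set.mem_univ t)
  set φ : (Fin m → ℝ) → ℂ := fun t => ψ t - ψ 0 with hφ
  have hφc : Continuous φ := hψ.sub continuous_const
  have hφe : ∀ t, Complex.exp (φ t) * (ampMat K 0).det = (ampMat K t).det := by
    intro t
    rw [← hexp', ← hexp', ← Complex.exp_add]
    simp [hφ]
  refine ⟨φ, hφc, by simp [hφ], hφe, fun k t => ?_⟩
  have hd0 := det_ampMat_ne_zero hK 0
  -- The increment of `φ` over one period has exponential 1 and is therefore constant in `t`. It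
  -- suffices to compute it on the `k`-th axis.
  have h1 : φ (t + Pi.single k (2 * Real.pi)) - φ t = φ (0 + Pi.single k (2 * Real.pi)) - φ 0 := by
    refine eq_of_exp_const (φ := fun t => φ (t + Pi.single k (2 * Real.pi)) - φ t) (c := 1)
      (by fun_prop) (fun q => ?_) t 0
    rw [Complex.exp_sub, div_eq_one_iff_eq (Complex.exp_ne_zero _)]
    apply mul_right_cancel₀ hd0
    rw [hφe, hφe, ampMat_periodic]
  obtain ⟨C, p, q, hC, hp, hq, hdet⟩ := exists_det_ampMat_single_eq hK k
  have hre : ∀ {p w : ℂ}, ‖p‖ < 1 → ‖w‖ = 1 → 1 + p * w ∈ Complex.slitPlane := by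
    intro p w hp hw
    left
    have h2 : ‖p * w‖ < 1 := by rwa [norm_mul, hw, mul_one]
    have h3 := (abs_lt.1 (lt_of_le_of_lt (Complex.abs_re_le_norm _) h2)).1
    rw [Complex.add_re, Complex.one_re]
    linarith
  have hn1 : ∀ s : ℝ, ‖Complex.exp (I * s)‖ = 1 := fun s => by
    rw [mul_comm, Complex.norm_exp_ofReal_mul_I]
  have hn2 : ∀ s : ℝ, ‖Complex.exp (-(I * s))‖ = 1 := fun s => by
    rw [Complex.exp_neg, norm_inv, hn1, inv_one]
  have hperp : Complex.exp (I * (2 * Real.pi : ℝ)) = 1 := by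
    push_cast
    rw [mul_comm I, Complex.exp_two_pi_mul_I]
  have h4 : φ (Pi.single k (2 * Real.pi)) = φ 0 := by
    -- On the axis `φ` differs by a constant from the sum of the principal logarithms of the two
    -- factors, which are periodic because both factors stay in the right half plane.
    have h5 := eq_of_exp_const (E := ℝ) (φ := fun s : ℝ => φ (Pi.single k s) -
        Complex.log (1 + p * Complex.exp (-(I * s))) - Complex.log (1 + q * Complex.exp (I * s)))
      (c := C / (ampMat K 0).det) ?_ (fun s => ?_) (2 * Real.pi) 0
    · simp only [Complex.exp_neg, hperp] at h5
      simpa using h5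
    · refine ((hφc.comp (continuous_single k)).sub ?_).sub ?_
      · exact Continuous.clog (by fun_prop) fun s => hre hp (hn2 s)
      · exact Continuous.clog (by fun_prop) fun s => hre hq (hn1 s)
    · have h6 := Complex.slitPlane_ne_zero (hre hp (hn2 s))
      have h7 := Complex.slitPlane_ne_zero (hre hq (hn1 s))
      rw [Complex.exp_sub, Complex.exp_sub, Complex.exp_log h6, Complex.exp_log h7]
      have h8 := hφe (Pi.single k s)
      rw [hdet] at h8
      rw [div_div, div_eq_div_iff (mul_ne_zero h6 h7) hd0, h8]
      ring
  rw [zero_add, h4, sub_self] at h1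
  exact sub_eq_zero.1 h1

end
end PseudoVacuum

/-! ### The closed formula solves the evolution equations -/

namespace PseudoVacuum
noncomputable section
open scoped Matrix
variable {m : ℕ}

/-- The closed formula for the star-exponential, in terms of a logarithm `φ` of the determinant. -/
def starExp (ħ : ℝ) (K : Matrix (Idx m) (Idx m) ℂ) (φ : (Fin m → ℝ) → ℂ) (t : Fin m → ℝ) :
    Entire m := gaussian (-(φ t) / 2) ((1 / (I * ħ : ℂ)) • qMat K t)

variable {ħ : ℝ} {K : Matrix (Idx m) (Idx m) ℂ}

theorem sum_wtMat_mul_J (k : Fin m) (f : Idx m → Idx m → ℂ) :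
    ∑ a, ∑ b, (wtMat k * Matrix.J (Fin m) ℂ) a b * f a b =
      -(f (Sum.inl k) (Sum.inr k) + f (Sum.inr k) (Sum.inl k)) := by
  simp only [Matrix.diagonal_mul, wt, Fintype.sum_sum_type, Sum.elim_inl, Sum.elim_inr, J_inl_inl,
    J_inr_inr, J_inl_inr, J_inr_inl]
  simp [Pi.single_apply, Finset.sum_ite_eq]
  ring

theorem qMat_smul_transpose (hK : K ∈ frakK0 m) (t : Fin m → ℝ) (c : ℂ) :
    (c • qMat K t)ᵀ = c • qMat K t := by
  rw [Matrix.transpose_smul, qMat_transpose hK.1 (isUnit_iff_ne_zero.2 (det_ampMat_ne_zero hK t))]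

theorem lOp_starExp (hK : K ∈ frakK0 m) (hħ : ħ ≠ 0) (φ : (Fin m → ℝ) → ℂ) (t : Fin m → ℝ)
    (i : Idx m) : lOp ħ K i (starExp ħ K φ t) = linE (mMat K t i) * starExp ħ K φ t := by
  have h0 : (I * (ħ : ℂ)) ≠ 0 := mul_ne_zero I_ne_zero (by exact_mod_cast hħ)
  rw [starExp, genOp_gaussian _ _ _ (qMat_smul_transpose hK t _), Matrix.mul_smul, smul_smul,
    mul_one_div_cancel h0, one_smul]
  rfl

/-- Intertwining of the left and right multiplications of the star-exponential by generators. -/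
theorem rOp_starExp (hK : K ∈ frakK0 m) (hħ : ħ ≠ 0) (φ : (Fin m → ℝ) → ℂ) (t : Fin m → ℝ)
    (i : Idx m) : genOp (K - Matrix.J (Fin m) ℂ) ħ i (starExp ħ K φ t) =
      phase t i • lOp ħ K i (starExp ħ K φ t) := by
  have h0 : (I * (ħ : ℂ)) ≠ 0 := mul_ne_zero I_ne_zero (by exact_mod_cast hħ)
  rw [lOp_starExp hK hħ, starExp, genOp_gaussian _ _ _ (qMat_smul_transpose hK t _),
    Matrix.mul_smul, smul_smul, mul_one_div_cancel h0, one_smul,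
    ← phaseMat_mul_mMat (isUnit_iff_ne_zero.2 (det_ampMat_ne_zero hK t))]
  rw [← smul_mul_assoc]
  congr 1
  simp only [linE, Matrix.diagonal_mul, Finset.smul_sum, smul_smul]

theorem lOp_lOp_starExp (hK : K ∈ frakK0 m) (hħ : ħ ≠ 0) (φ : (Fin m → ℝ) → ℂ) (t : Fin m → ℝ)
    (i j : Idx m) : lOp ħ K i (lOp ħ K j (starExp ħ K φ t)) =
      (linE (mMat K t i) * linE (mMat K t j)) * starExp ħ K φ t +
        (I * ħ / 2 * ((K + Matrix.J (Fin m) ℂ) * (mMat K t)ᵀ) i j) • starExp ħ K φ t := by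
  rw [lOp_starExp hK hħ, genOp_linE_mul, lOp_starExp hK hħ, ← mul_assoc, mul_comm (linE _) (linE _)]
  rfl

theorem hasDerivAt_phase_update (k : Fin m) (t : Fin m → ℝ) (i : Idx m) :
    HasDerivAt (fun s : ℝ => phase (Function.update t k s) i) (I * (wt i k : ℂ) * phase t i)
      (t k) := by
  have h1 : ∀ l : Fin m, HasDerivAt (fun s : ℝ => (wt i l : ℂ) * (Function.update t k s l : ℝ))
      (if l = k then (wt i k : ℂ) else 0) (t k) := by
    intro l
    by_cases hl : l = k
    · subst hl
      simpa using (Complex.ofRealCLM.hasDerivAt (x := t l)).const_mul (wt i l : ℂ)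
    · simpa [hl] using hasDerivAt_const (t k) ((wt i l : ℂ) * (t l : ℂ))
  have h2 := ((HasDerivAt.fun_sum fun l (_ : l ∈ Finset.univ) => h1 l).const_mul I).cexp
  simp only [← phase_eq, Function.update_eq_self, Finset.sum_ite_eq', Finset.mem_univ, if_true] at h2
  rwa [mul_comm] at h2

theorem hasDerivAt_ampMat_update (K : Matrix (Idx m) (Idx m) ℂ) (k : Fin m) (t : Fin m → ℝ)
    (i j : Idx m) : HasDerivAt (fun s : ℝ => ampMat K (Function.update t k s) i j)
      ((I • (wtMat k * phaseMat t * (1 + Matrix.J (Fin m) ℂ * K))) i j) (t k) := by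
  simp only [ampMat_apply]
  have h := ((hasDerivAt_phase_update k t i).mul_const
    ((1 + Matrix.J (Fin m) ℂ * K) i j)).const_add ((1 - Matrix.J (Fin m) ℂ * K) i j)
  convert! h using 1
  rw [Matrix.smul_apply, Matrix.mul_assoc, Matrix.diagonal_mul, Matrix.diagonal_mul, smul_eq_mul]
  ring

theorem analyticAt_qMat (hK : K ∈ frakK0 m) (t : Fin m → ℝ) (i j : Idx m) :
    AnalyticAt ℝ (fun t => qMat K t i j) t := by
  have h1 : ∀ i j, AnalyticAt ℝ (fun t => (ampMat K t)⁻¹ i j) t := fun i j =>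
    analyticAt_matrix_inv (analyticAt_ampMat K t) (det_ampMat_ne_zero hK t) i j
  have h2 : ∀ i j, AnalyticAt ℝ (fun t => ((1 - phaseMat t) * Matrix.J (Fin m) ℂ) i j) t := by
    intro i j
    have h3 : ∀ t, ((1 - phaseMat t) * Matrix.J (Fin m) ℂ) i j =
        (1 - phase t i) * Matrix.J (Fin m) ℂ i j := by
      intro t
      rw [sub_mul, one_mul, Matrix.sub_apply, Matrix.diagonal_mul]
      ring
    simp only [h3]
    exact (analyticAt_const.sub (analyticAt_phase i t)).mul analyticAt_const
  exact analyticAt_matrix_mul h1 h2 i j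

theorem analyticAt_update (k : Fin m) (t : Fin m → ℝ) (s : ℝ) :
    AnalyticAt ℝ (fun s : ℝ => Function.update t k s) s := by
  have : (fun s : ℝ => Function.update t k s) = fun s => Function.update t k 0 +
      (ContinuousLinearMap.single ℝ (fun _ : Fin m => ℝ) k) s := by
    funext s l
    by_cases hl : l = k
    · subst hl; simp
    · simp [hl]
  rw [this]
  exact analyticAt_const.add (ContinuousLinearMap.analyticAt _ _)

/-- The derivative exists by analyticity, so it can be found by differentiating `N Q = (1 - D) J`
implicitly, with `N`, `Q`, `D` standing for `ampMat`, `qMat`, `phaseMat`. Then `wtMat_mul_eq` and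
`N⁻¹ = Mᵀ / 2` bring it to the form of a Riccati equation. -/
theorem hasDerivAt_qMat_update (hK : K ∈ frakK0 m) (k : Fin m) (t : Fin m → ℝ) (i j : Idx m) :
    HasDerivAt (fun s : ℝ => qMat K (Function.update t k s) i j)
      (((-I / 2) • ((mMat K t)ᵀ * (wtMat k * Matrix.J (Fin m) ℂ) * mMat K t)) i j) (t k) := by
  have hN := isUnit_iff_ne_zero.2 (det_ampMat_ne_zero hK t)
  have hd : ∀ i j, HasDerivAt (fun s : ℝ => qMat K (Function.update t k s) i j)
      (Matrix.of (fun i j => deriv (fun s : ℝ => qMat K (Function.update t k s) i j) (t k)) i j)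
      (t k) := by
    intro i j
    refine DifferentiableAt.hasDerivAt (AnalyticAt.differentiableAt ?_)
    refine AnalyticAt.comp (g := fun t => qMat K t i j) ?_ (analyticAt_update k t (t k))
    exact analyticAt_qMat hK _ i j
  set Q' : Matrix (Idx m) (Idx m) ℂ :=
    Matrix.of fun i j => deriv (fun s : ℝ => qMat K (Function.update t k s) i j) (t k) with hQ'
  have h1 := hasDerivAt_matrix_mul (hasDerivAt_ampMat_update K k t) hd
  have h2 : ∀ i j, HasDerivAt (fun s : ℝ => (ampMat K (Function.update t k s) *
      qMat K (Function.update t k s)) i j)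
      ((I • -(wtMat k * phaseMat t * Matrix.J (Fin m) ℂ)) i j) (t k) := by
    intro i j
    have h3 : ∀ t, (ampMat K t * qMat K t) i j =
        (1 - phase t i) * Matrix.J (Fin m) ℂ i j := by
      intro t
      rw [ampMat_mul_qMat (isUnit_iff_ne_zero.2 (det_ampMat_ne_zero hK t)), sub_mul, one_mul,
        Matrix.sub_apply, Matrix.diagonal_mul]
      ring
    simp only [h3]
    have h4 := ((hasDerivAt_phase_update k t i).const_sub 1).mul_const (Matrix.J (Fin m) ℂ i j)
    convert! h4 using 1
    rw [Matrix.smul_apply, Matrix.neg_apply, Matrix.mul_assoc, Matrix.diagonal_mul,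
      Matrix.diagonal_mul, smul_eq_mul]
    ring
  have h5 : (I • (wtMat k * phaseMat t * (1 + Matrix.J (Fin m) ℂ * K))) * qMat K t +
      ampMat K t * Q' = I • -(wtMat k * phaseMat t * Matrix.J (Fin m) ℂ) := by
    ext i j
    have := (h1 i j).unique (h2 i j)
    simpa only [Function.update_eq_self] using this
  have h6 : ampMat K t * Q' = I • -(wtMat k * Matrix.J (Fin m) ℂ * mMat K t) := by
    rw [← wtMat_mul_eq hN, smul_sub, ← h5, Matrix.smul_mul]
    abel
  have h7 : Q' = (-I / 2) • ((mMat K t)ᵀ * (wtMat k * Matrix.J (Fin m) ℂ) * mMat K t) := by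
    have h8 := congrArg (fun X => (ampMat K t)⁻¹ * X) h6
    simp only [Matrix.nonsing_inv_mul_cancel_left _ _ hN] at h8
    rw [h8, mMat_transpose hK.1 hN]
    simp only [Matrix.smul_mul, Matrix.mul_smul, smul_smul, Matrix.mul_neg, smul_neg,
      Matrix.mul_assoc]
    rw [← neg_smul]
    congr 1
    ring
  rw [← h7]
  exact hd i j

theorem analyticAt_log (hK : K ∈ frakK0 m) {φ : (Fin m → ℝ) → ℂ} (hφ : Continuous φ)
    (hexp : ∀ t, Complex.exp (φ t) * (ampMat K 0).det = (ampMat K t).det) (t : Fin m → ℝ) :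
    AnalyticAt ℝ φ t := by
  refine analyticAt_of_exp hφ ?_
  have h : (fun t => Complex.exp (φ t)) = fun t => (ampMat K t).det * ((ampMat K 0).det)⁻¹ := by
    funext t
    rw [← hexp, mul_inv_cancel_right₀ (det_ampMat_ne_zero hK 0)]
  rw [h]
  exact (analyticAt_det fun i j => analyticAt_ampMat K t i j).mul analyticAt_const

/-- Jacobi's formula gives the trace of `N⁻¹ N'`, where `N` is `ampMat`. By `trace_eq` and
`mMat_transpose` it becomes the contraction term that arises when two generators act on the
Gaussian. -/
theorem hasDerivAt_log_update (hK : K ∈ frakK0 m) {φ : (Fin m → ℝ) → ℂ} (hφ : Continuous φ)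
    (hexp : ∀ t, Complex.exp (φ t) * (ampMat K 0).det = (ampMat K t).det) (k : Fin m)
    (t : Fin m → ℝ) : HasDerivAt (fun s : ℝ => φ (Function.update t k s))
      (-I / 2 * (((K + Matrix.J (Fin m) ℂ) * (mMat K t)ᵀ) (Sum.inl k) (Sum.inr k) +
        ((K + Matrix.J (Fin m) ℂ) * (mMat K t)ᵀ) (Sum.inr k) (Sum.inl k))) (t k) := by
  have hN := isUnit_iff_ne_zero.2 (det_ampMat_ne_zero hK t)
  have hd0 := det_ampMat_ne_zero hK 0
  have h1 : HasDerivAt (fun s : ℝ => φ (Function.update t k s))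
      (deriv (fun s : ℝ => φ (Function.update t k s)) (t k)) (t k) := by
    refine DifferentiableAt.hasDerivAt (AnalyticAt.differentiableAt ?_)
    exact AnalyticAt.comp (g := φ) (analyticAt_log hK hφ hexp _) (analyticAt_update k t (t k))
  have h2 := h1.cexp.mul_const (ampMat K 0).det
  have h3 := hasDerivAt_det (hasDerivAt_ampMat_update K k t)
  simp only [hexp, Function.update_eq_self] at h2 h3
  have h4 := h2.unique h3
  have h5 : (ampMat K t).adjugate = (ampMat K t).det • (ampMat K t)⁻¹ := by
    rw [Matrix.inv_def, smul_smul, Ring.mul_inverse_cancel _ hN, one_smul]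
  have h6 : Complex.exp (φ t) * (ampMat K 0).det *
      deriv (fun s : ℝ => φ (Function.update t k s)) (t k) =
      Complex.exp (φ t) * (ampMat K 0).det * (I * Matrix.trace ((ampMat K t)⁻¹ *
        (wtMat k * phaseMat t * (1 + Matrix.J (Fin m) ℂ * K)))) := by
    rw [mul_right_comm, h4, h5, Matrix.smul_mul, Matrix.mul_smul, Matrix.trace_smul,
      Matrix.trace_smul, hexp, smul_eq_mul, smul_eq_mul]
  have h7 := mul_left_cancel₀ (mul_ne_zero (Complex.exp_ne_zero _) hd0) h6
  have h8 : (ampMat K t)⁻¹ = (1 / 2 : ℂ) • (mMat K t)ᵀ := by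
    rw [mMat_transpose hK.1 hN, smul_smul]
    norm_num
  rw [trace_eq hN, h8, Matrix.mul_smul, Matrix.trace_smul, mul_assoc (wtMat k * _)] at h7
  rw [h7] at h1
  convert! h1 using 1
  have h9 : Matrix.trace (wtMat k * Matrix.J (Fin m) ℂ *
      ((K + Matrix.J (Fin m) ℂ) * (mMat K t)ᵀ)) = _ :=
    sum_wtMat_mul_J k fun a b => ((K + Matrix.J (Fin m) ℂ) * (mMat K t)ᵀ) b a
  rw [h9, smul_eq_mul]
  ring


theorem hamOp_starExp (hK : K ∈ frakK0 m) (hħ : ħ ≠ 0) (φ : (Fin m → ℝ) → ℂ) (t : Fin m → ℝ)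
    (k : Fin m) : I • hamOp ħ K k (starExp ħ K φ t) =
      ((1 / ħ : ℂ) • (linE (mMat K t (Sum.inl k)) * linE (mMat K t (Sum.inr k)))) *
        starExp ħ K φ t +
      (I / 4 * (((K + Matrix.J (Fin m) ℂ) * (mMat K t)ᵀ) (Sum.inl k) (Sum.inr k) +
        ((K + Matrix.J (Fin m) ℂ) * (mMat K t)ᵀ) (Sum.inr k) (Sum.inl k))) • starExp ħ K φ t := by
  have hħ' : (ħ : ℂ) ≠ 0 := by exact_mod_cast hħ
  simp only [hamOp, LinearMap.smul_apply, LinearMap.add_apply, LinearMap.comp_apply,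
    lOp_lOp_starExp hK hħ]
  rw [mul_comm (linE (mMat K t (Sum.inr k)))]
  rw [smul_mul_assoc]
  match_scalars <;> field_simp <;> norm_num [mul_comm]

theorem linE_mul_linE_apply (v w x : Idx m → ℂ) :
    ((linE v * linE w : Entire m) : Fn m) x = (v ⬝ᵥ x) * (w ⬝ᵥ x) := by
  change (linE v : Fn m) x * (linE w : Fn m) x = _
  rw [linE_apply, linE_apply]

theorem sum_conj_apply (M Z : Matrix (Idx m) (Idx m) ℂ) (x : Idx m → ℂ) :
    ∑ i, ∑ j, (Mᵀ * Z * M) i j * (x i * x j) =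
      ∑ a, ∑ b, Z a b * ((M a ⬝ᵥ x) * (M b ⬝ᵥ x)) := by
  have h1 : ∑ i, ∑ j, (Mᵀ * Z * M) i j * (x i * x j) = x ⬝ᵥ ((Mᵀ * Z * M) *ᵥ x) := by
    simp only [dotProduct, Matrix.mulVec, Finset.mul_sum]
    exact Finset.sum_congr rfl fun i _ => Finset.sum_congr rfl fun j _ => by ring
  rw [h1, ← Matrix.mulVec_mulVec, ← Matrix.mulVec_mulVec, Matrix.dotProduct_mulVec,
    Matrix.vecMul_transpose]
  simp only [dotProduct, Matrix.mulVec, Finset.mul_sum]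
  exact Finset.sum_congr rfl fun i _ => Finset.sum_congr rfl fun j _ => by
    simp only [Finset.mul_sum, Finset.sum_mul]
    exact Finset.sum_congr rfl fun l _ => Finset.sum_congr rfl fun l' _ => by ring

/-- Two coefficients have to agree: the quadratic part of the Hamiltonian's action is the derivative
of the exponent, and the scalar part is the derivative of `-φ/2`. -/
theorem starExp_evolution (hK : K ∈ frakK0 m) (hħ : ħ ≠ 0) {φ : (Fin m → ℝ) → ℂ}
    (hφ : Continuous φ) (hexp : ∀ t, Complex.exp (φ t) * (ampMat K 0).det = (ampMat K t).det)
    (k : Fin m) (t : Fin m → ℝ) (x : Idx m → ℂ) :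
    HasDerivAt (fun s : ℝ => (starExp ħ K φ (Function.update t k s) : Fn m) x)
      (I * (hamOp ħ K k (starExp ħ K φ t) : Fn m) x) (t k) := by
  have hħ' : (ħ : ℂ) ≠ 0 := by exact_mod_cast hħ
  have h1 := (((hasDerivAt_log_update hK hφ hexp k t).neg.div_const 2).add
    (HasDerivAt.fun_sum fun i (_ : i ∈ Finset.univ) => HasDerivAt.fun_sum fun j
      (_ : j ∈ Finset.univ) => ((hasDerivAt_qMat_update hK k t i j).const_mul
        (1 / (I * ħ : ℂ))).mul_const (x i * x j))).cexp
  have h2 : I * (hamOp ħ K k (starExp ħ K φ t) : Fn m) x =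
      ((I • hamOp ħ K k (starExp ħ K φ t) : Entire m) : Fn m) x := rfl
  rw [h2, hamOp_starExp hK hħ]
  refine HasDerivAt.congr_deriv h1 ?_
  simp only [Pi.add_apply, Pi.neg_apply, Function.update_eq_self]
  have h3 : ∑ i, ∑ j, 1 / (I * (ħ : ℂ)) * ((-I / 2) • ((mMat K t)ᵀ *
      (wtMat k * Matrix.J (Fin m) ℂ) * mMat K t)) i j * (x i * x j) =
      1 / ħ * ((mMat K t (Sum.inl k) ⬝ᵥ x) * (mMat K t (Sum.inr k) ⬝ᵥ x)) := by
    have h4 := sum_conj_apply (mMat K t) (wtMat k * Matrix.J (Fin m) ℂ) x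
    rw [sum_wtMat_mul_J k fun a b => (mMat K t a ⬝ᵥ x) * (mMat K t b ⬝ᵥ x)] at h4
    have h5 : 1 / (ħ : ℂ) * ((mMat K t (Sum.inl k) ⬝ᵥ x) * (mMat K t (Sum.inr k) ⬝ᵥ x)) =
        -(1 / (2 * ħ)) * ∑ i, ∑ j, ((mMat K t)ᵀ * (wtMat k * Matrix.J (Fin m) ℂ) * mMat K t) i j *
          (x i * x j) := by
      rw [h4]
      field_simp
      ring
    rw [h5]
    simp only [Finset.mul_sum]
    refine Finset.sum_congr rfl fun i _ => Finset.sum_congr rfl fun j _ => ?_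
    rw [Matrix.smul_apply, smul_eq_mul]
    field_simp
  rw [h3]
  change _ = (1 / (ħ : ℂ)) * ((linE _ * linE _ : Entire m) : Fn m) x * (starExp ħ K φ t : Fn m) x +
    _ * (starExp ħ K φ t : Fn m) x
  rw [linE_mul_linE_apply, starExp, gaussian_apply]
  simp only [Matrix.smul_apply, smul_eq_mul]
  ring

theorem qMat_zero : qMat K 0 = 0 := by
  have : phaseMat (0 : Fin m → ℝ) = 1 := by rw [phaseMat, phase_zero]; exact Matrix.diagonal_one
  rw [qMat, this, sub_self, zero_mul, mul_zero]

theorem starExp_zero {φ : (Fin m → ℝ) → ℂ} (h0 : φ 0 = 0) : starExp ħ K φ 0 = 1 := by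
  apply Subtype.ext
  funext x
  rw [starExp, gaussian_apply, qMat_zero, h0]
  simp

theorem isStarFlow_starExp (hK : K ∈ frakK0 m) (hħ : ħ ≠ 0) {φ : (Fin m → ℝ) → ℂ}
    (hφ : Continuous φ) (h0 : φ 0 = 0)
    (hexp : ∀ t, Complex.exp (φ t) * (ampMat K 0).det = (ampMat K t).det) :
    IsStarFlow ħ K 1 fun t => (starExp ħ K φ t : Fn m) where
  init := by simp only [starExp_zero h0]; rfl
  entire t := (starExp ħ K φ t).2.1
  analytic p _ := by
    have h : ∀ i, AnalyticAt ℝ (fun p : (Fin m → ℝ) × (Idx m → ℂ) => p.2 i) p := fun i =>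
      ((ContinuousLinearMap.proj (R := ℝ) (φ := fun _ : Idx m => ℂ) i).analyticAt _).comp
        analyticAt_snd
    refine AnalyticAt.comp (g := Complex.exp) analyticAt_cexp.restrictScalars (AnalyticAt.add ?_ ?_)
    · have h1 : AnalyticAt ℝ (fun p : (Fin m → ℝ) × (Idx m → ℂ) => φ p.1) p :=
        (analyticAt_log hK hφ hexp p.1).comp analyticAt_fst
      exact h1.neg.mul analyticAt_const
    · refine Finset.analyticAt_fun_sum _ fun i _ => Finset.analyticAt_fun_sum _ fun j _ => ?_
      have h2 : AnalyticAt ℝ (fun p : (Fin m → ℝ) × (Idx m → ℂ) => qMat K p.1 i j) p :=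
        AnalyticAt.comp (g := fun t => qMat K t i j) (analyticAt_qMat hK p.1 i j) analyticAt_fst
      exact (analyticAt_const.mul h2).mul ((h i).mul (h j))
  evolution k t x := by
    rw [starMul_ham]
    exact starExp_evolution hK hħ hφ hexp k t x

theorem starExp_periodic {φ : (Fin m → ℝ) → ℂ}
    (hper : ∀ k t, φ (t + Pi.single k (2 * Real.pi)) = φ t) (k : Fin m) (t : Fin m → ℝ) :
    starExp ħ K φ (t + Pi.single k (2 * Real.pi)) = starExp ħ K φ t := by
  rw [starExp, hper, qMat, ampMat_periodic, phaseMat, phase_periodic]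
  rfl

end
end PseudoVacuum

/-! ### Fourier analysis over the cube of periods -/

namespace PseudoVacuum
noncomputable section
open scoped Matrix Pointwise
variable {m : ℕ}

/-- The cube of periods. -/
abbrev box (m : ℕ) : Set (Fin m → ℝ) := Set.Icc (0 : Fin m → ℝ) fun _ => 2 * Real.pi

theorem pi_Icc_eq_box : (Set.univ.pi fun _ : Fin m => Set.Icc (0 : ℝ) (2 * Real.pi)) = box m :=
  Set.pi_univ_Icc _ _

/-- The characters of the torus. -/
def character (n : Fin m → ℤ) (t : Fin m → ℝ) : ℂ := Complex.exp (I * ∑ k, (n k : ℂ) * t k)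

theorem phase_eq_character (t : Fin m → ℝ) (i : Idx m) : phase t i = character (wt i) t :=
  phase_eq t i

theorem character_add (a b : Fin m → ℤ) (t : Fin m → ℝ) :
    character (a + b) t = character a t * character b t := by
  simp only [character, ← Complex.exp_add, Pi.add_apply, Int.cast_add, add_mul,
    Finset.sum_add_distrib, mul_add]

@[simp] theorem character_zero (t : Fin m → ℝ) : character (0 : Fin m → ℤ) t = 1 := by
  simp [character]

@[simp] theorem character_zero_right (n : Fin m → ℤ) : character n 0 = 1 := by
  simp [character]

theorem norm_character (n : Fin m → ℤ) (t : Fin m → ℝ) : ‖character n t‖ = 1 := by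
  have : character n t = Complex.exp ((∑ k, (n k : ℝ) * t k : ℝ) * I) := by
    rw [character, mul_comm]
    push_cast
    rfl
  rw [this, Complex.norm_exp_ofReal_mul_I]

theorem hasFDerivAt_character (n : Fin m → ℤ) (t : Fin m → ℝ) :
    ∃ L : (Fin m → ℝ) →L[ℝ] ℂ, HasFDerivAt (character n) L t ∧
      ∀ k, L (Pi.single k 1) = I * n k * character n t := by
  have h1 : ∀ k : Fin m, HasFDerivAt (fun t : Fin m → ℝ => (t k : ℂ))
      (Complex.ofRealCLM.comp (ContinuousLinearMap.proj k)) t := fun k =>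
    (Complex.ofRealCLM.comp (ContinuousLinearMap.proj (R := ℝ) (φ := fun _ : Fin m => ℝ)
      k)).hasFDerivAt
  refine ⟨_, ((HasFDerivAt.fun_sum fun k (_ : k ∈ Finset.univ) =>
    (h1 k).const_mul (n k : ℂ)).const_mul I).cexp, fun k => ?_⟩
  have h2 : ∀ x, ((Pi.single k 1 : Fin m → ℝ) x : ℂ) = if x = k then 1 else 0 := fun x => by
    rw [Pi.single_apply]
    split_ifs <;> simp
  simp [character, h2]
  ring

theorem analyticAt_character (n : Fin m → ℤ) (t : Fin m → ℝ) :
    AnalyticAt ℝ (character n) t := by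
  have h1 : ∀ k : Fin m, AnalyticAt ℝ (fun t : Fin m → ℝ => (t k : ℂ)) t := fun k =>
    (Complex.ofRealCLM.comp (ContinuousLinearMap.proj (R := ℝ) (φ := fun _ : Fin m => ℝ)
      k)).analyticAt t
  exact AnalyticAt.comp (g := Complex.exp) analyticAt_cexp.restrictScalars
    (analyticAt_const.mul (Finset.analyticAt_fun_sum _ fun k _ => analyticAt_const.mul (h1 k)))

theorem continuous_character (n : Fin m → ℤ) : Continuous (character n) :=
  continuous_iff_continuousAt.2 fun t => (analyticAt_character n t).continuousAt

theorem character_periodic (n : Fin m → ℤ) (k : Fin m) (t : Fin m → ℝ) :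
    character n (t + Pi.single k (2 * Real.pi)) = character n t := by
  have : ∑ l, (n l : ℂ) * ((t + Pi.single k (2 * Real.pi) : Fin m → ℝ) l : ℝ) =
      ∑ l, (n l : ℂ) * t l + n k * (2 * Real.pi) := by
    have h2 : ∀ x, ((Pi.single k (2 * Real.pi) : Fin m → ℝ) x : ℂ) =
        if x = k then 2 * (Real.pi : ℂ) else 0 := fun x => by
      rw [Pi.single_apply]
      split_ifs <;> simp
    simp [mul_add, Finset.sum_add_distrib, h2]
  rw [character, this, mul_add, Complex.exp_add]
  have h2 : Complex.exp (I * (n k * (2 * Real.pi))) = 1 := by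
    rw [Complex.exp_eq_one_iff]
    exact ⟨n k, by ring⟩
  rw [h2, mul_one]
  rfl

/-- The integral of a partial derivative of a periodic function vanishes. -/
theorem integral_box_fderiv {g : (Fin m → ℝ) → ℂ} {g' : (Fin m → ℝ) → (Fin m → ℝ) →L[ℝ] ℂ}
    (hg : ∀ t, HasFDerivAt g (g' t) t) (hg' : ContinuousOn g' (box m)) (k : Fin m)
    (hper : ∀ t, g (t + Pi.single k (2 * Real.pi)) = g t) :
    ∫ t in box m, g' t (Pi.single k 1) = 0 := by
  obtain _ | n := m
  · exact k.elim0
  have hc : Continuous g := continuous_iff_continuousAt.2 fun t => (hg t).continuousAt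
  have hi : IntegrableOn (fun t => g' t (Pi.single k 1)) (box (n + 1)) :=
    (hg'.clm_apply continuousOn_const).integrableOn_compact isCompact_Icc
  have hsum : ∀ t, ∑ i, (if i = k then g' t else 0) (Pi.single i 1) = g' t (Pi.single k 1) := by
    intro t
    rw [Finset.sum_eq_single k]
    · simp
    · intro i _ hik
      simp [hik]
    · simp
  -- The divergence theorem is applied to the vector field whose only component is `g`, in direction
  -- `k`. Periodicity cancels the two opposite faces.
  have h := integral_divergence_of_hasFDerivAt_off_countable' (0 : Fin (n + 1) → ℝ)
    (fun _ => 2 * Real.pi) (fun _ => Real.two_pi_pos.le)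
    (fun i => if i = k then g else 0) (fun i t => if i = k then g' t else 0) ∅
    Set.countable_empty ?_ ?_ ?_
  · simp only [hsum] at h
    rw [h]
    refine Finset.sum_eq_zero fun i _ => ?_
    by_cases hik : i = k
    · subst hik
      simp only [if_true]
      rw [sub_eq_zero]
      refine integral_congr_ae (Filter.Eventually.of_forall fun x => ?_)
      change g (i.insertNth (2 * Real.pi) x) = g (i.insertNth 0 x)
      rw [← hper (i.insertNth 0 x)]
      congr 1
      funext l
      rcases Fin.eq_self_or_eq_succAbove i l with rfl | ⟨j, rfl⟩ <;> simp
    · simp [hik]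
  · intro i
    by_cases hik : i = k
    · simpa [hik] using hc.continuousOn
    · simpa [hik] using (continuous_zero (X := Fin (n + 1) → ℝ) (M := ℂ)).continuousOn
  · intro t _ i
    by_cases hik : i = k
    · simpa [hik] using hg t
    · simp only [hik, if_false]
      exact hasFDerivAt_const (0 : ℂ) t
  · simpa only [hsum] using hi

theorem integral_box_character {n : Fin m → ℤ} (hn : n ≠ 0) :
    ∫ t in box m, character n t = 0 := by
  obtain ⟨k, hk⟩ := Function.ne_iff.1 hn
  have hd : ∀ t, HasFDerivAt (character n) (fderiv ℝ (character n) t) t := fun t =>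
    (analyticAt_character n t).differentiableAt.hasFDerivAt
  have h := integral_box_fderiv hd (fun t _ =>
    (analyticAt_character n t).fderiv.continuousAt.continuousWithinAt) k (character_periodic n k)
  have h2 : ∀ t, fderiv ℝ (character n) t (Pi.single k 1) = I * n k * character n t := by
    intro t
    obtain ⟨L, hL, hLk⟩ := hasFDerivAt_character n t
    rw [hL.fderiv, hLk]
  simp only [h2] at h
  rw [integral_const_mul] at h
  refine (mul_eq_zero.1 h).resolve_left (mul_ne_zero I_ne_zero ?_)
  exact_mod_cast hk

theorem volume_real_box : (volume.real (box m)) = (2 * Real.pi) ^ m := by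
  rw [Measure.real, Real.volume_Icc_pi]
  simp [Real.pi_pos.le]

theorem two_pi_pow_ne_zero (m : ℕ) : (((2 * Real.pi : ℝ) : ℂ) ^ m) ≠ 0 :=
  pow_ne_zero _ (by exact_mod_cast Real.two_pi_pos.ne')

theorem mean_box_character (n : Fin m → ℤ) :
    (((2 * Real.pi : ℝ) : ℂ) ^ m)⁻¹ * ∫ t in box m, character n t = if n = 0 then 1 else 0 := by
  split_ifs with hn
  · subst hn
    simp only [character_zero, setIntegral_const, volume_real_box]
    rw [Complex.real_smul, mul_one, Complex.ofReal_pow, inv_mul_cancel₀ (two_pi_pow_ne_zero m)]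
  · rw [integral_box_character hn, mul_zero]

theorem periodic_int {α : Type*} {g : (Fin m → ℝ) → α}
    (hper : ∀ k t, g (t + Pi.single k (2 * Real.pi)) = g t) (z : Fin m → ℤ) (t : Fin m → ℝ) :
    g (t + (2 * Real.pi) • fun k => (z k : ℝ)) = g t := by
  have h1 : ∀ k (a : ℤ) t, g (t + Pi.single k (a * (2 * Real.pi))) = g t := by
    intro k a
    induction a with
    | zero => simp
    | succ a ih =>
      intro t
      have h : ((a + 1 : ℤ) : ℝ) * (2 * Real.pi) = (a : ℤ) * (2 * Real.pi) + 2 * Real.pi := by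
        push_cast
        ring
      rw [h, Pi.single_add, ← add_assoc, hper, ih]
    | pred a ih =>
      intro t
      rw [← ih t, ← hper k (t + Pi.single k (_ * _)), add_assoc, ← Pi.single_add]
      congr 3
      push_cast
      ring
  have h2 : ∀ s : Finset (Fin m), ∀ t,
      g (t + ∑ k ∈ s, Pi.single k ((z k : ℝ) * (2 * Real.pi))) = g t := by
    intro s
    induction s using Finset.induction_on with
    | empty => simp
    | insert a s ha ih =>
      intro t
      rw [Finset.sum_insert ha, ← add_assoc, ih, h1]
  rw [← h2 Finset.univ t, Finset.univ_sum_single]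
  congr 2
  funext k
  simp [mul_comm]

/-- A continuous periodic function all of whose Fourier coefficients vanish is zero. -/
theorem eq_zero_of_integral_character {g : (Fin m → ℝ) → ℂ} (hg : Continuous g)
    (hper : ∀ k t, g (t + Pi.single k (2 * Real.pi)) = g t)
    (h0 : ∀ n : Fin m → ℤ, ∫ t in box m, character (-n) t * g t = 0) (t : Fin m → ℝ) :
    g t = 0 := by
  let q : (Fin m → ℝ) → UnitAddTorus (Fin m) := fun s k => (s k : UnitAddCircle)
  -- Representatives are taken in the half-open unit cube, and the parameter is rescaled by `2π`. By
  -- periodicity `g` does not depend on the choice, so it descends to a continuous function on the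
  -- torus.
  let r : UnitAddTorus (Fin m) → Fin m → ℝ := fun z k => (AddCircle.equivIoc 1 0 (z k) : ℝ)
  have hqr : ∀ z, q (r z) = z := fun z => by
    funext k
    exact (AddCircle.equivIoc 1 0).symm_apply_apply (z k)
  have hrq : ∀ s, g ((2 * Real.pi) • r (q s)) = g ((2 * Real.pi) • s) := by
    intro s
    have h1 : ∀ k, ∃ a : ℤ, r (q s) k = s k + a := by
      intro k
      have h2 : ((r (q s) k : ℝ) : UnitAddCircle) = (s k : UnitAddCircle) := congrFun (hqr (q s)) k
      rw [← sub_eq_zero, ← AddCircle.coe_sub, AddCircle.coe_eq_zero_iff] at h2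
      obtain ⟨a, ha⟩ := h2
      exact ⟨a, by simp at ha; linarith⟩
    choose a ha using h1
    rw [← periodic_int hper a ((2 * Real.pi) • s), ← smul_add]
    congr 2
    funext k
    exact ha k
  have hq : IsOpenQuotientMap q := IsOpenQuotientMap.piMap fun _ => QuotientAddGroup.isOpenQuotientMap_mk
  let G : C(UnitAddTorus (Fin m), ℂ) := ⟨fun z => g ((2 * Real.pi) • r z), by
    rw [hq.isQuotientMap.continuous_iff]
    change Continuous fun s => g ((2 * Real.pi) • r (q s))
    simp only [hrq]
    fun_prop⟩
  have hchar : ∀ (n : Fin m → ℤ) s, UnitAddTorus.mFourier n (q s) =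
      character n ((2 * Real.pi) • s) := by
    intro n s
    simp only [UnitAddTorus.mFourier, ContinuousMap.coe_mk, q, fourier_coe_apply, character,
      ← Complex.exp_sum, Finset.mul_sum]
    congr 1
    refine Finset.sum_congr rfl fun k _ => ?_
    simp
    ring
  have hcoef : ∀ n, UnitAddTorus.mFourierCoeff G n = 0 := by
    intro n
    rw [UnitAddTorus.mFourierCoeff_eq_integral _ _ 0]
    have h1 : ∀ s, UnitAddTorus.mFourier (-n) (q s) • G (q s) =
        (fun t => character (-n) t * g t) ((2 * Real.pi) • s) := by
      intro s
      rw [hchar, smul_eq_mul]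
      congr 1
      exact hrq s
    simp only [q] at h1
    simp only [h1]
    rw [Measure.setIntegral_comp_smul_of_pos volume (fun t => character (-n) t * g t) _
      Real.two_pi_pos]
    have h2 : ((2 * Real.pi) • {x : Fin m → ℝ | ∀ i, x i ∈ Set.Ioc ((0 : Fin m → ℝ) i) ((0 : Fin m → ℝ) i + 1)}) =
        Set.univ.pi fun _ : Fin m => Set.Ioc (0 : ℝ) (2 * Real.pi) := by
      ext x
      have hp := Real.two_pi_pos
      simp only [Set.mem_smul_set_iff_inv_smul_mem₀ hp.ne', Set.mem_ofPred_eq, Set.mem_pi,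
        Set.mem_univ, true_imp_iff, Pi.smul_apply, smul_eq_mul, Pi.zero_apply, zero_add, Set.mem_Ioc]
      refine forall_congr' fun i => ?_
      rw [inv_mul_le_iff₀ hp, mul_one, mul_pos_iff_of_pos_left (inv_pos.2 hp)]
    have h3 : (Set.univ.pi fun _ : Fin m => Set.Ioc (0 : ℝ) (2 * Real.pi)) =ᵐ[volume] box m :=
      Measure.univ_pi_Ioc_ae_eq_Icc
    rw [h2, setIntegral_congr_set h3, h0, smul_zero]
  -- Vanishing coefficients are summable, so the Fourier series converges pointwise to the function,
  -- and its sum is zero.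
  have hs : Summable (UnitAddTorus.mFourierCoeff G) := by
    rw [show UnitAddTorus.mFourierCoeff G = 0 from funext hcoef]
    exact summable_zero
  have h3 := UnitAddTorus.hasSum_mFourier_series_apply_of_summable hs (q ((2 * Real.pi)⁻¹ • t))
  simp only [hcoef, zero_smul] at h3
  have h4 := h3.unique hasSum_zero
  have h5 : G (q ((2 * Real.pi)⁻¹ • t)) = g t := by
    refine (hrq _).trans ?_
    rw [smul_inv_smul₀ Real.two_pi_pos.ne']
  rw [← h5, h4]

end
end PseudoVacuum

/-! ### Fourier coefficients of the star-exponential and the vacuum -/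

namespace PseudoVacuum
noncomputable section
open scoped Matrix Pointwise
variable {m : ℕ}

/-- Families of entire functions parametrized by the cube of periods, as holomorphic maps into the
Banach algebra of continuous functions of the parameters. -/
def Family (m : ℕ) : Submodule ℂ ((Idx m → ℂ) → C(box m, ℂ)) where
  carrier := {Φ | AnalyticOnNhd ℂ Φ Set.univ}
  add_mem' h h' := AnalyticOnNhd.add h h'
  zero_mem' := analyticOnNhd_const
  smul_mem' _ _ h := AnalyticOnNhd.const_smul h

/-- The entire function obtained by applying a functional to a family. -/
def Family.push (ℓ : C(box m, ℂ) →L[ℂ] ℂ) : Family m →ₗ[ℂ] Entire m where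
  toFun Φ := ⟨fun x => ℓ (Φ.1 x),
    fun x => (ℓ.differentiableAt.comp x (Φ.2 x trivial).differentiableAt),
    fun x _ => ((ℓ.analyticAt _).comp (Φ.2 x trivial)).restrictScalars⟩
  map_add' _ _ := Subtype.ext <| funext fun _ => map_add ℓ _ _
  map_smul' c _ := Subtype.ext <| funext fun _ => map_smul ℓ c _

/-- Partial derivatives of families. -/
def Family.deriv (j : Idx m) (Φ : Family m) : Family m :=
  ⟨fun x => fderiv ℂ Φ.1 x (Pi.single j 1), fun x hx =>
    AnalyticAt.comp (g := ContinuousLinearMap.apply ℂ C(box m, ℂ) (Pi.single j (1 : ℂ) : Idx m → ℂ))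
      (f := fderiv ℂ Φ.1) (ContinuousLinearMap.analyticAt _ _) (Φ.2.fderiv x hx)⟩

/-- Continuous linear functionals commute with derivatives. For evaluations this computes the family
at one parameter; for `boxCoef n` it is differentiation under the integral sign. -/
theorem Family.push_deriv (ℓ : C(box m, ℂ) →L[ℂ] ℂ) (j : Idx m) (Φ : Family m) :
    push ℓ (deriv j Φ) = D j (push ℓ Φ) := by
  apply Subtype.ext
  funext x
  have h : HasFDerivAt (push ℓ Φ : Fn m) (ℓ.comp (fderiv ℂ Φ.1 x)) x :=
    ℓ.hasFDerivAt.comp x (Φ.2 x trivial).differentiableAt.hasFDerivAt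
  rw [coe_D, pd, h.fderiv]
  rfl

/-- Multiplication of families by coordinates. -/
def Family.coordMul (i : Idx m) (Φ : Family m) : Family m :=
  ⟨fun x => x i • Φ.1 x, fun x hx =>
    ((ContinuousLinearMap.proj (R := ℂ) (φ := fun _ : Idx m => ℂ) i).analyticAt x).smul (Φ.2 x hx)⟩

/-- Star multiplication of families by generators. -/
def Family.gen (Λ : Matrix (Idx m) (Idx m) ℂ) (ħ : ℝ) (i : Idx m) (Φ : Family m) : Family m :=
  coordMul i Φ + (I * ħ / 2) • ∑ j, Λ i j • deriv j Φ

theorem Family.push_gen (ℓ : C(box m, ℂ) →L[ℂ] ℂ) (Λ : Matrix (Idx m) (Idx m) ℂ) (ħ : ℝ)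
    (i : Idx m) (Φ : Family m) : push ℓ (gen Λ ħ i Φ) = genOp Λ ħ i (push ℓ Φ) := by
  have h : push ℓ (coordMul i Φ) = coord i * push ℓ Φ :=
    Subtype.ext <| funext fun x => map_smul ℓ (x i) _
  simp only [gen, map_add, map_smul, map_sum, push_deriv, h, genOp_apply]

/-- Star multiplication of families by the Hamiltonian. -/
def Family.ham (ħ : ℝ) (K : Matrix (Idx m) (Idx m) ℂ) (k : Fin m) (Φ : Family m) : Family m :=
  (1 / (I * (ħ : ℂ))) • ((1 / 2 : ℂ) •
    (gen (K + Matrix.J (Fin m) ℂ) ħ (Sum.inl k) (gen (K + Matrix.J (Fin m) ℂ) ħ (Sum.inr k) Φ) +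
      gen (K + Matrix.J (Fin m) ℂ) ħ (Sum.inr k) (gen (K + Matrix.J (Fin m) ℂ) ħ (Sum.inl k) Φ)))

theorem Family.push_ham (ℓ : C(box m, ℂ) →L[ℂ] ℂ) (ħ : ℝ) (K : Matrix (Idx m) (Idx m) ℂ)
    (k : Fin m) (Φ : Family m) : push ℓ (ham ħ K k Φ) = hamOp ħ K k (push ℓ Φ) := by
  simp only [ham, map_add, map_smul, push_gen, hamOp, LinearMap.smul_apply, LinearMap.add_apply,
    LinearMap.comp_apply]

instance isFiniteMeasure_box :
    IsFiniteMeasure ((volume : Measure (Fin m → ℝ)).comap ((↑) : box m → Fin m → ℝ)) :=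
  ⟨by
    rw [comap_subtype_coe_apply measurableSet_Icc, Set.image_univ, Subtype.range_coe]
    exact isCompact_Icc.measure_lt_top⟩

/-- Fourier coefficients of functions on the cube of periods. -/
def boxCoef (n : Fin m → ℤ) : C(box m, ℂ) →L[ℂ] ℂ :=
  LinearMap.mkContinuous
    { toFun := fun g => (((2 * Real.pi : ℝ) : ℂ) ^ m)⁻¹ * ∫ t : box m, character (-n) t * g t
        ∂(volume.comap ((↑) : box m → Fin m → ℝ))
      map_add' := fun g h => by
        have hc : ∀ g : C(box m, ℂ), Integrable (fun t : box m => character (-n) t * g t)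
            (volume.comap ((↑) : box m → Fin m → ℝ)) := fun g =>
          (((continuous_character _).comp continuous_subtype_val).mul
            g.continuous).integrable_of_hasCompactSupport (HasCompactSupport.of_compactSpace _)
        rw [← mul_add, ← integral_add (hc g) (hc h)]
        simp only [ContinuousMap.add_apply, mul_add]
      map_smul' := fun c g => by
        simp only [ContinuousMap.smul_apply, smul_eq_mul, RingHom.id_apply, mul_left_comm _ c]
        rw [integral_const_mul, mul_left_comm] }
    (‖(((2 * Real.pi : ℝ) : ℂ) ^ m)⁻¹‖ *
      (volume.comap ((↑) : box m → Fin m → ℝ)).real Set.univ) fun g => by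
      rw [LinearMap.coe_mk, AddHom.coe_mk]
      rw [norm_mul, mul_assoc, mul_comm (Measure.real _ _)]
      refine mul_le_mul_of_nonneg_left ?_ (norm_nonneg _)
      refine norm_integral_le_of_norm_le_const (Filter.Eventually.of_forall fun t => ?_)
      rw [norm_mul, norm_character, one_mul]
      exact g.norm_coe_le_norm t

theorem boxCoef_apply (n : Fin m → ℤ) (g : C(box m, ℂ)) {f : (Fin m → ℝ) → ℂ}
    (h : ∀ t : box m, g t = f t) : boxCoef n g =
      (((2 * Real.pi : ℝ) : ℂ) ^ m)⁻¹ * ∫ t in box m, character (-n) t * f t := by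
  rw [← integral_subtype_comap measurableSet_Icc]
  simp only [← h]
  rfl

theorem boxCoef_character_mul (n a : Fin m → ℤ) {g h : C(box m, ℂ)}
    (hgh : ∀ t : box m, g t = character a t * h t) : boxCoef n g = boxCoef (n - a) h := by
  change (((2 * Real.pi : ℝ) : ℂ) ^ m)⁻¹ * (∫ t : box m, character (-n) t * g t
      ∂(volume.comap ((↑) : box m → Fin m → ℝ))) = (((2 * Real.pi : ℝ) : ℂ) ^ m)⁻¹ *
      ∫ t : box m, character (-(n - a)) t * h t ∂(volume.comap ((↑) : box m → Fin m → ℝ))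
  simp only [hgh, ← mul_assoc, ← character_add]
  rw [neg_sub, sub_eq_neg_add]

variable {ħ : ℝ} {K : Matrix (Idx m) (Idx m) ℂ}

theorem continuous_qMat (hK : K ∈ frakK0 m) (i j : Idx m) : Continuous fun t => qMat K t i j :=
  continuous_iff_continuousAt.2 fun t => (analyticAt_qMat hK t i j).continuousAt

/-- The star-exponential as a family over the cube of periods. -/
def starFamily (ħ : ℝ) (hK : K ∈ frakK0 m) {φ : (Fin m → ℝ) → ℂ} (hφ : Continuous φ) : Family m :=
  ⟨fun x => (⟨fun t => Complex.exp (-(φ t) / 2), by fun_prop⟩ : C(box m, ℂ)) *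
    NormedSpace.exp (∑ i, ∑ j, (x i * x j) •
      (⟨fun t => ((1 / (I * ħ : ℂ)) • qMat K t) i j,
        ((continuous_qMat hK i j).comp continuous_subtype_val).const_mul _⟩ : C(box m, ℂ))), by
    intro x _
    have h : ∀ i, AnalyticAt ℂ (fun x : Idx m → ℂ => x i) x := fun i =>
      (ContinuousLinearMap.proj (R := ℂ) (φ := fun _ : Idx m => ℂ) i).analyticAt x
    refine analyticAt_const.mul (AnalyticAt.comp (g := NormedSpace.exp) ?_ ?_)
    · exact NormedSpace.exp_analytic _
    · exact Finset.analyticAt_fun_sum _ fun i _ => Finset.analyticAt_fun_sum _ fun j _ =>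
        ((h i).mul (h j)).smul analyticAt_const⟩

/-- Evaluation at a parameter is a continuous algebra homomorphism and so commutes with the
exponential of the Banach algebra. -/
theorem push_eval_starFamily (hK : K ∈ frakK0 m) {φ : (Fin m → ℝ) → ℂ} (hφ : Continuous φ)
    (t : box m) : Family.push (ContinuousMap.evalCLM ℂ t) (starFamily ħ hK hφ) =
      starExp ħ K φ t := by
  apply Subtype.ext
  funext x
  rw [starExp, gaussian_apply, Complex.exp_add]
  change _ * (NormedSpace.exp (∑ i, ∑ j, (x i * x j) • _ : C(box m, ℂ))) t = _
  have h := NormedSpace.map_exp (ContinuousMap.evalAlgHom ℂ ℂ t) (continuous_eval_const t)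
    (∑ i, ∑ j, (x i * x j) • (⟨fun t => ((1 / (I * ħ : ℂ)) • qMat K t) i j,
        ((continuous_qMat hK i j).comp continuous_subtype_val).const_mul _⟩ : C(box m, ℂ)))
  rw [← Complex.exp_eq_exp_ℂ] at h
  congr 1
  refine h.trans ?_
  simp only [map_sum, map_smul, smul_eq_mul]
  congr 1
  exact Finset.sum_congr rfl fun i _ => Finset.sum_congr rfl fun j _ => mul_comm _ _

/-- The Fourier coefficients of the star-exponential. -/
def starCoef (ħ : ℝ) (hK : K ∈ frakK0 m) {φ : (Fin m → ℝ) → ℂ} (hφ : Continuous φ)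
    (n : Fin m → ℤ) : Entire m := Family.push (boxCoef n) (starFamily ħ hK hφ)

variable {φ : (Fin m → ℝ) → ℂ}

theorem starCoef_apply (hK : K ∈ frakK0 m) (hφ : Continuous φ) (n : Fin m → ℤ) (x : Idx m → ℂ) :
    (starCoef ħ hK hφ n : Fn m) x = (((2 * Real.pi : ℝ) : ℂ) ^ m)⁻¹ *
      ∫ t in box m, character (-n) t * (starExp ħ K φ t : Fn m) x :=
  boxCoef_apply n _ (f := fun t => (starExp ħ K φ t : Fn m) x) fun t => by
    rw [← push_eval_starFamily hK hφ t]
    rfl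

/-- The phase in `rOp_starExp` is the character of `wt i`; on Fourier coefficients it becomes a
shift of the index. -/
theorem rOp_starCoef (hK : K ∈ frakK0 m) (hħ : ħ ≠ 0) (hφ : Continuous φ) (n : Fin m → ℤ)
    (i : Idx m) : genOp (K - Matrix.J (Fin m) ℂ) ħ i (starCoef ħ hK hφ n) =
      lOp ħ K i (starCoef ħ hK hφ (n - wt i)) := by
  rw [starCoef, starCoef, ← Family.push_gen, ← Family.push_gen]
  apply Subtype.ext
  funext x
  refine boxCoef_character_mul n (wt i) fun t => ?_
  have h := rOp_starExp hK hħ φ t i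
  rw [← push_eval_starFamily hK hφ t, ← Family.push_gen, ← Family.push_gen] at h
  rw [← phase_eq_character]
  exact congrFun (congrArg Subtype.val h) x

/-- Integration by parts over the torus: the derivative of the star-exponential in `t_k` is `i H_k`
times it, while that of the conjugate character contributes `-i n_k`. -/
theorem isWeight_starCoef (hK : K ∈ frakK0 m) (hħ : ħ ≠ 0) (hφ : Continuous φ) (h0 : φ 0 = 0)
    (hexp : ∀ t, Complex.exp (φ t) * (ampMat K 0).det = (ampMat K t).det)
    (hper : ∀ k t, φ (t + Pi.single k (2 * Real.pi)) = φ t) (n : Fin m → ℤ) :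
    IsWeight ħ K n (starCoef ħ hK hφ n) := by
  intro k
  apply Subtype.ext
  funext x
  have hflow := isStarFlow_starExp hK hħ hφ h0 hexp
  have ha : ∀ t, AnalyticAt ℝ (fun t => (starExp ħ K φ t : Fn m) x) t := fun t =>
    AnalyticAt.comp (g := fun p : (Fin m → ℝ) × (Idx m → ℂ) => (starExp ħ K φ p.1 : Fn m) p.2)
      (f := fun t => (t, x)) (hflow.analytic (t, x) trivial) (analyticAt_id.prod analyticAt_const)
  have hg : ∀ t, AnalyticAt ℝ (fun t => character (-n) t * (starExp ħ K φ t : Fn m) x) t :=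
    fun t => (analyticAt_character (-n) t).mul (ha t)
  have hp := integral_box_fderiv (fun t => (hg t).differentiableAt.hasFDerivAt)
    (fun t _ => (hg t).fderiv.continuousAt.continuousWithinAt) k fun t => by
      rw [character_periodic, starExp_periodic hper]
  have hd : ∀ t, fderiv ℝ (fun t => character (-n) t * (starExp ħ K φ t : Fn m) x) t
      (Pi.single k 1) = character (-n) t * (I * (hamOp ħ K k (starExp ħ K φ t) : Fn m) x) -
        I * n k * (character (-n) t * (starExp ħ K φ t : Fn m) x) := by
    intro t
    obtain ⟨L, hL, hLk⟩ := hasFDerivAt_character (-n) t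
    have h1 : fderiv ℝ (fun t => (starExp ħ K φ t : Fn m) x) t (Pi.single k 1) =
        I * (hamOp ħ K k (starExp ħ K φ t) : Fn m) x := by
      refine HasDerivAt.unique ?_ (starExp_evolution hK hħ hφ hexp k t x)
      refine HasFDerivAt.comp_hasDerivAt (l := fun t => (starExp ħ K φ t : Fn m) x)
        (f := fun r => Function.update t k r) _ ?_ (hasDerivAt_update _ _ _)
      rw [Function.update_eq_self]
      exact (ha t).differentiableAt.hasFDerivAt
    rw [(hL.fun_mul (ha t).differentiableAt.hasFDerivAt).fderiv]
    simp only [add_apply, smul_apply, h1, hLk, smul_eq_mul, Pi.neg_apply, Int.cast_neg]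
    ring
  simp only [hd] at hp
  have hc : Continuous fun t => character (-n) t * (starExp ħ K φ t : Fn m) x :=
    continuous_iff_continuousAt.2 fun t => (hg t).continuousAt
  have hham : (hamOp ħ K k (starCoef ħ hK hφ n) : Fn m) x = (((2 * Real.pi : ℝ) : ℂ) ^ m)⁻¹ *
      ∫ t in box m, character (-n) t * (hamOp ħ K k (starExp ħ K φ t) : Fn m) x := by
    rw [starCoef, ← Family.push_ham]
    refine boxCoef_apply n _ (f := fun t => (hamOp ħ K k (starExp ħ K φ t) : Fn m) x) fun t => ?_
    rw [← push_eval_starFamily hK hφ t, ← Family.push_ham]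
    rfl
  change (hamOp ħ K k (starCoef ħ hK hφ n) : Fn m) x = n k * (starCoef ħ hK hφ n : Fn m) x
  rw [hham, starCoef_apply]
  have hh : Integrable (fun t => character (-n) t * (I * (hamOp ħ K k (starExp ħ K φ t) : Fn m) x))
      (volume.restrict (box m)) := by
    have h2 : Continuous fun t => character (-n) t * (I * (hamOp ħ K k (starExp ħ K φ t) : Fn m) x) := by
      have h3 : Continuous fun t => fderiv ℝ
          (fun t => character (-n) t * (starExp ħ K φ t : Fn m) x) t (Pi.single k 1) :=
        (continuous_iff_continuousAt.2 fun t => (hg t).fderiv.continuousAt).clm_apply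
          continuous_const
      simp only [hd] at h3
      have h4 := h3.add (hc.const_mul (I * n k))
      refine h4.congr fun t => ?_
      simp only [Pi.add_apply, sub_add_cancel]
    exact h2.continuousOn.integrableOn_compact isCompact_Icc
  rw [integral_sub hh ((hc.continuousOn.integrableOn_compact isCompact_Icc).const_mul _),
    integral_const_mul] at hp
  simp only [mul_left_comm _ I] at hp
  rw [integral_const_mul, mul_assoc, ← mul_sub] at hp
  have h5 := (mul_eq_zero.1 hp).resolve_left I_ne_zero
  rw [sub_eq_zero.1 h5, mul_left_comm]

/-- By `rOp_starCoef`, vanishing at `n + wt i` means that the generator `i` annihilates the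
coefficient at `n`. Its partner then turns this into a nonzero multiple of that coefficient. -/
theorem starCoef_eq_zero_of_add (hK : K ∈ frakK0 m) (hħ : ħ ≠ 0) (hφ : Continuous φ) (h0 : φ 0 = 0)
    (hexp : ∀ t, Complex.exp (φ t) * (ampMat K 0).det = (ampMat K t).det)
    (hper : ∀ k t, φ (t + Pi.single k (2 * Real.pi)) = φ t) (n : Fin m → ℤ) (i : Idx m)
    (h : starCoef ħ hK hφ (n + wt i) = 0) : starCoef ħ hK hφ n = 0 := by
  have h1 := rOp_starCoef hK hħ hφ (n + wt i) i
  rw [h, map_zero, add_sub_cancel_right] at h1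
  obtain ⟨c, hc, h2⟩ := exists_lOp_swap hK.1 hħ (isWeight_starCoef hK hħ hφ h0 hexp hper n) i.swap
  rw [Sum.swap_swap, ← h1, map_zero] at h2
  exact (smul_eq_zero.1 h2.symm).resolve_left hc

theorem starCoef_zero_ne_zero (hK : K ∈ frakK0 m) (hħ : ħ ≠ 0) (hφ : Continuous φ) (h0 : φ 0 = 0)
    (hexp : ∀ t, Complex.exp (φ t) * (ampMat K 0).det = (ampMat K t).det)
    (hper : ∀ k t, φ (t + Pi.single k (2 * Real.pi)) = φ t) : starCoef ħ hK hφ 0 ≠ 0 := by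
  intro hz
  have step := starCoef_eq_zero_of_add hK hħ hφ h0 hexp hper
  have h1 : ∀ (k : Fin m) (a : ℤ) n, starCoef ħ hK hφ n = 0 →
      starCoef ħ hK hφ (n + Pi.single k a) = 0 := by
    intro k a n hn
    induction a with
    | zero => simpa using hn
    | succ a ih =>
      -- The step lemma descends from `n + wt i` to `n`, so raising the index requires the generator
      -- of weight `-1`, and lowering it the one of weight `+1`.
      refine step _ (Sum.inr k) ?_
      convert! ih using 2
      simp [wt, Pi.single_add, ← add_assoc]
    | pred a ih =>
      refine step _ (Sum.inl k) ?_
      convert! ih using 2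
      simp [wt, Pi.single_sub, ← add_sub_assoc]
  have h2 : ∀ (n : Fin m → ℤ) (s : Finset (Fin m)),
      starCoef ħ hK hφ (∑ k ∈ s, Pi.single k (n k)) = 0 := by
    intro n s
    induction s using Finset.induction_on with
    | empty => simpa using hz
    | insert a s ha ih =>
      rw [Finset.sum_insert ha, add_comm]
      exact h1 _ _ _ ih
  have h3 : ∀ n, starCoef ħ hK hφ n = 0 := fun n => by
    rw [← h2 n Finset.univ, Finset.univ_sum_single]
  have hflow := isStarFlow_starExp hK hħ hφ h0 hexp
  -- All coefficients vanish, hence so does the star-exponential at the point `x = 0`; but it equals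
  -- 1 at `t = 0`.
  have h4 := eq_zero_of_integral_character (g := fun t => (starExp ħ K φ t : Fn m) 0)
    (continuous_iff_continuousAt.2 fun t => (AnalyticAt.comp
      (g := fun p : (Fin m → ℝ) × (Idx m → ℂ) => (starExp ħ K φ p.1 : Fn m) p.2)
      (f := fun t => (t, 0)) (hflow.analytic (t, 0) trivial)
      (analyticAt_id.prod analyticAt_const)).continuousAt)
    (fun k t => by rw [starExp_periodic hper]) (fun n => by
      have h5 := starCoef_apply (ħ := ħ) hK hφ n 0
      rw [h3] at h5
      exact (mul_eq_zero.1 h5.symm).resolve_left (inv_ne_zero (two_pi_pow_ne_zero m))) 0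
  rw [starExp_zero h0] at h4
  exact one_ne_zero h4

theorem periodMean_starExp (hK : K ∈ frakK0 m) (hφ : Continuous φ) :
    periodMean (fun t => (starExp ħ K φ t : Fn m)) = starCoef ħ hK hφ 0 := by
  funext x
  rw [starCoef_apply, periodMean, pi_Icc_eq_box]
  simp only [neg_zero, character_zero, one_mul]

end
end PseudoVacuum

/-! ### The regular representation space and its bilinear form -/

namespace PseudoVacuum
noncomputable section
open scoped Matrix Pointwise
variable {m : ℕ} {ħ : ℝ} {K : Matrix (Idx m) (Idx m) ℂ}

theorem hasDerivAt_character_update (n : Fin m → ℤ) (k : Fin m) (t : Fin m → ℝ) :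
    HasDerivAt (fun s : ℝ => character n (Function.update t k s)) (I * n k * character n t)
      (t k) := by
  obtain ⟨L, hL, hLk⟩ := hasFDerivAt_character n t
  rw [← hLk k]
  refine HasFDerivAt.comp_hasDerivAt (l := character n)
    (f := fun r => Function.update t k r) _ ?_ (hasDerivAt_update _ _ _)
  rwa [Function.update_eq_self]

/-- The flow through a finite sum of weight vectors. -/
theorem isStarFlow_sum_character {ι : Type*} (s : Finset ι) {w : ι → Fin m → ℤ}
    {v : ι → Entire m} (hv : ∀ a, IsWeight ħ K (w a) (v a)) :
    IsStarFlow ħ K ((∑ a ∈ s, v a : Entire m) : Fn m)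
      fun t => ((∑ a ∈ s, character (w a) t • v a : Entire m) : Fn m) where
  init := by simp only [character_zero_right, one_smul]
  entire t := (∑ a ∈ s, character (w a) t • v a : Entire m).2.1
  analytic p _ := by
    have h : ∀ p : (Fin m → ℝ) × (Idx m → ℂ), ((∑ a ∈ s, character (w a) p.1 • v a : Entire m) :
        Fn m) p.2 = ∑ a ∈ s, character (w a) p.1 * (v a : Fn m) p.2 := fun p => by simp
    simp only [h]
    refine Finset.analyticAt_fun_sum _ fun a _ => AnalyticAt.mul ?_ ?_
    · exact AnalyticAt.comp (g := character (w a)) (analyticAt_character (w a) p.1) analyticAt_fst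
    · exact AnalyticAt.comp (g := (v a : Fn m)) ((v a).2.2 p.2 trivial) analyticAt_snd
  evolution k t x := by
    rw [starMul_ham]
    have h : ∀ t, ((∑ a ∈ s, character (w a) t • v a : Entire m) : Fn m) x =
        ∑ a ∈ s, character (w a) t * (v a : Fn m) x := fun t => by simp
    have h2 : (hamOp ħ K k (∑ a ∈ s, character (w a) t • v a) : Fn m) x =
        ∑ a ∈ s, character (w a) t * (w a k * (v a : Fn m) x) := by
      simp [map_sum, (hv _) k]
    simp only [h, h2, Finset.mul_sum]
    refine HasDerivAt.fun_sum fun a _ => ?_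
    refine ((hasDerivAt_character_update (w a) k t).mul_const _).congr_deriv ?_
    ring

/-- The pseudo-vacuum projects a sum of weight vectors onto its part of weight zero. -/
theorem isPseudoVacMul_sum {ι : Type*} (s : Finset ι) {w : ι → Fin m → ℤ}
    {v : ι → Entire m} (hv : ∀ a, IsWeight ħ K (w a) (v a)) :
    IsPseudoVacMul ħ K ((∑ a ∈ s, v a : Entire m) : Fn m)
      ((∑ a ∈ s with w a = 0, v a : Entire m) : Fn m) := by
  refine isPseudoVacMul_of_isStarFlow (isStarFlow_sum_character s hv) ?_
  funext x
  have h : ∀ t, ((∑ a ∈ s, character (w a) t • v a : Entire m) : Fn m) x =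
      ∑ a ∈ s, character (w a) t * (v a : Fn m) x := fun t => by simp
  rw [periodMean, pi_Icc_eq_box]
  simp only [h]
  rw [integral_finsetSum (f := fun a t => character (w a) t * (v a : Fn m) x) _ fun a _ =>
    (((continuous_character (w a)).mul
      continuous_const).continuousOn.integrableOn_compact isCompact_Icc)]
  simp only [integral_mul_const, Finset.mul_sum, ← mul_assoc, mean_box_character, ite_mul, one_mul,
    zero_mul]
  rw [← Finset.sum_filter]
  simp

/-- The weight vectors generated from a vacuum. -/
def weightVec (ħ : ℝ) (K : Matrix (Idx m) (Idx m) ℂ) (ϖ : Entire m) (n : Fin m → ℤ) : Entire m :=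
  wordOp ħ K (word n) ϖ

variable {ϖ : Entire m} (hK : K.IsSymm) (hħ : ħ ≠ 0) (hw : IsWeight ħ K 0 ϖ)

theorem weightVec_zero : weightVec ħ K ϖ 0 = ϖ := by rw [weightVec, word_zero]; rfl

include hK hħ in
theorem IsWeight.wordOp_word {n : Fin m → ℤ} {f : Entire m} (h : IsWeight ħ K n f)
    (a : Fin m → ℤ) : IsWeight ħ K (n + a) (PseudoVacuum.wordOp ħ K (word a) f) := by
  have := h.wordOp hK hħ (word a)
  rwa [wordWt_word] at this

include hK hħ hw in
theorem isWeight_weightVec (n : Fin m → ℤ) : IsWeight ħ K n (weightVec ħ K ϖ n) := by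
  simpa [weightVec] using hw.wordOp_word hK hħ n

include hK hħ hw in
-- The word of `-k` moves the `k`-th vector to weight 0 and the others elsewhere. The product with
-- the vacuum then isolates its coefficient in a linear relation.
theorem linearIndependent_weightVec (hne : ϖ ≠ 0) : LinearIndependent ℂ (weightVec ħ K ϖ) := by
  rw [linearIndependent_iff']
  intro s c hc k hk
  have h1 := isPseudoVacMul_sum s (w := fun n => n + -k)
    (v := fun n => c n • wordOp ħ K (word (-k)) (weightVec ħ K ϖ n)) fun n =>
      ((isWeight_weightVec hK hħ hw n).wordOp_word hK hħ (-k)).smul (c n)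
  have h2 : ∑ n ∈ s, c n • wordOp ħ K (word (-k)) (weightVec ħ K ϖ n) =
      ∑ _n ∈ (∅ : Finset (Fin m → ℤ)), ϖ := by
    simp only [← wordOp_smul, ← wordOp_sum, hc]
    simpa using wordOp_smul (ħ := ħ) (K := K) (word (-k)) 0 0
  -- The same relation is read as an empty sum, whose vacuum product is 0; uniqueness of the product
  -- compares the two values.
  rw [h2] at h1
  have h3 := Subtype.ext (h1.unique (isPseudoVacMul_sum ∅ (w := 0) fun _ => hw))
  have h4 : (s.filter fun n => n + -k = 0) = {k} := by
    ext n
    simp only [Finset.mem_filter, Finset.mem_singleton, add_neg_eq_zero]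
    exact ⟨fun h => h.2, fun h => ⟨h ▸ hk, h⟩⟩
  rw [h4, Finset.sum_singleton] at h3
  simp only [Finset.filter_empty, Finset.sum_empty] at h3
  exact (smul_eq_zero.1 h3).resolve_right (wordOp_word_ne_zero hK hħ
    (isWeight_weightVec hK hħ hw k) (wordOp_word_ne_zero hK hħ hw hne k) _)

theorem starMul_starMonomial (n : Fin m → ℤ) :
    starMul ħ K (starMonomial ħ K n) ϖ = weightVec ħ K ϖ n := by
  rw [starMonomial_eq, starMul_polyFn, polyStar_wordPoly]
  rfl

theorem starMul_expr_eq (f : StarPoly m) : starMul ħ K (expr ħ K f) ϖ =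
    ((Finsupp.linearCombination ℂ (weightVec ħ K ϖ) f : Entire m) : Fn m) := starMul_expr ..

theorem starMul_expr_mem (f : StarPoly m) : starMul ħ K (expr ħ K f) ϖ ∈ regRep ħ K ϖ :=
  Submodule.subset_span ⟨exprPoly ħ K f, by rw [expr_eq]⟩

include hK hħ hw in
theorem exists_starMul_polyFn (p : MvPolynomial (Idx m) ℂ) :
    ∃ f : StarPoly m, starMul ħ K (expr ħ K f) ϖ = starMul ħ K (polyFn p) ϖ := by
  obtain ⟨f, hf⟩ := (Finsupp.mem_span_range_iff_exists_finsupp).1 (polyStar_mem_span hK hħ hw p)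
  refine ⟨f, ?_⟩
  rw [starMul_expr_eq, starMul_polyFn, ← hf]
  rfl

include hK hħ hw in
-- Distinct star monomials have distinct weights, so only the constant coefficient contributes to
-- weight 0.
theorem isPseudoVacMul_expr (f : StarPoly m) :
    IsPseudoVacMul ħ K (starMul ħ K (expr ħ K f) ϖ) (f 0 • (ϖ : Fn m)) := by
  have h := isPseudoVacMul_sum f.support (v := fun n => f n • weightVec ħ K ϖ n) fun n =>
    (isWeight_weightVec hK hħ hw n).smul (f n)
  rw [starMul_expr_eq]
  convert! h using 1
  rw [Finset.sum_filter, Finset.sum_ite_eq' f.support 0, weightVec_zero]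
  split_ifs with h0
  · rfl
  · rw [Finsupp.notMem_support_iff.1 h0, zero_smul]
    rfl

theorem linearCombination_iotaMap (v : (Fin m → ℤ) → Entire m) (g : StarPoly m) :
    Finsupp.linearCombination ℂ v (iotaMap m g) =
      ∑ n ∈ g.support, g n • ((∏ k, if n k < 0 then (-1 : ℂ) else 1) • v (-n)) := by
  rw [iotaMap, Finsupp.linearCombination_apply ℂ (v := fun n => _) g, Finsupp.sum, map_sum]
  refine Finset.sum_congr rfl fun n _ => ?_
  rw [map_smul, Finsupp.linearCombination_single]

include hK hħ hw in
/-- The values of the form on the weight vectors. -/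
theorem exists_pairing : ∃ d : (Fin m → ℤ) → ℂ, (∀ n, d n ≠ 0) ∧ ∀ f g : StarPoly m,
    IsPseudoVacMul ħ K (starMul ħ K (expr ħ K f) (starMul ħ K (expr ħ K (iotaMap m g)) ϖ))
      ((f.sum fun n c => c * (d n * g n)) • (ϖ : Fn m)) := by
  have h1 : ∀ n : Fin m → ℤ, ∃ c : ℂ, c ≠ 0 ∧
      wordOp ħ K (word n) (weightVec ħ K ϖ (-n)) = c • ϖ := by
    intro n
    have h := wordOp_word_word hK hħ hw n (-n)
    rw [add_neg_cancel] at h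
    rwa [word_zero] at h
  choose c hc hcw using h1
  refine ⟨fun n => (∏ k, if n k < 0 then (-1 : ℂ) else 1) * c n, fun n => mul_ne_zero
    (Finset.prod_ne_zero_iff.2 fun k _ => by split_ifs <;> norm_num) (hc n), fun f g => ?_⟩
  have h := isPseudoVacMul_sum (f.support ×ˢ g.support) (w := fun p => -p.2 + p.1)
    (v := fun p => (f p.1 * (g p.2 * (∏ k, if p.2 k < 0 then (-1 : ℂ) else 1))) •
      wordOp ħ K (word p.1) (weightVec ħ K ϖ (-p.2))) fun p =>
        ((isWeight_weightVec hK hħ hw (-p.2)).wordOp_word hK hħ p.1).smul _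
  rw [starMul_expr_eq, starMul_expr]
  convert! h using 2
  · rw [linearCombination_iotaMap, Finset.sum_product, Finsupp.sum]
    simp only [wordOp_sum, wordOp_smul, Finset.smul_sum, smul_smul]
  · change (((_ : ℂ) • ϖ : Entire m) : Fn m) = _
    congr 1
    rw [Finset.sum_filter, Finset.sum_product, Finsupp.sum, Finset.sum_smul]
    refine Finset.sum_congr rfl fun n _ => ?_
    -- The pair of exponents `(n, n')` contributes in weight `n - n'`, so only the diagonal survives
    -- the projection.
    have h2 : ∀ n', (-n' + n = 0) ↔ n' = n := fun n' => by rw [neg_add_eq_zero]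
    simp only [h2]
    rw [Finset.sum_ite_eq' g.support n]
    split_ifs with h0
    · rw [hcw, smul_smul]
      congr 1
      ring
    · rw [Finsupp.notMem_support_iff.1 h0]
      simp

/-- The regular representation space in terms of star polynomials. -/
theorem exists_regRep_equiv (hK : K.IsSymm) (hħ : ħ ≠ 0) (hw : IsWeight ħ K 0 ϖ) (hne : ϖ ≠ 0) :
    ∃ R : StarPoly m ≃ₗ[ℂ] regRep ħ K ϖ,
      ∀ f, (R f : Fn m) = starMul ħ K (expr ħ K f) ϖ := by
  let L : StarPoly m →ₗ[ℂ] regRep ħ K ϖ := LinearMap.codRestrict _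
    ((Entire m).val.toLinearMap ∘ₗ Finsupp.linearCombination ℂ (weightVec ħ K ϖ)) fun f => by
      have h := starMul_expr_mem (ħ := ħ) (K := K) (ϖ := ϖ) f
      rwa [starMul_expr_eq] at h
  have hL : ∀ f, (L f : Fn m) = starMul ħ K (expr ħ K f) ϖ := fun f => (starMul_expr_eq f).symm
  refine ⟨LinearEquiv.ofBijective L ⟨fun f g hfg => ?_, fun x => ?_⟩, hL⟩
  -- Injectivity is the linear independence of the weight vectors; surjectivity comes from the
  -- spanning property `polyStar_mem_span`.
  · exact linearIndependent_weightVec hK hħ hw hne (Subtype.ext (congrArg (fun y : regRep ħ K (ϖ : Fn m) => (y : Fn m)) hfg))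
  · have h1 : regRep ħ K ϖ ≤ L.range.map (regRep ħ K ϖ).subtype := by
      refine Submodule.span_le.2 ?_
      rintro _ ⟨p, rfl⟩
      obtain ⟨f, hf⟩ := exists_starMul_polyFn hK hħ hw p
      exact ⟨L f, ⟨f, rfl⟩, (hL f).trans hf⟩
    obtain ⟨_, ⟨f, rfl⟩, hf⟩ := h1 x.2
    exact ⟨f, Subtype.ext hf⟩

/-- Diagonal bilinear forms with nonzero entries restrict to nondegenerate forms on the spans of
sets of basis vectors. -/
theorem nondegenerate_restrict_diagonal {ι V : Type*} [AddCommGroup V] [Module ℂ V]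
    (R : (ι →₀ ℂ) ≃ₗ[ℂ] V) {d : ι → ℂ} (hd : ∀ n, d n ≠ 0) {B : LinearMap.BilinForm ℂ V}
    (hB : ∀ f g, B (R f) (R g) = f.sum fun n c => c * (d n * g n)) (S : Set ι)
    {W : Submodule ℂ V} (hW : W = Submodule.span ℂ {x | ∃ n ∈ S, x = R (Finsupp.single n 1)}) :
    (B.restrict W).Nondegenerate := by
  have hmem : ∀ n ∈ S, R (Finsupp.single n 1) ∈ W := fun n hn => by
    rw [hW]
    exact Submodule.subset_span ⟨n, hn, rfl⟩
  have hsupp : ∀ x ∈ W, ∀ n ∉ S, R.symm x n = 0 := by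
    have h : W ≤ (Finsupp.supported ℂ ℂ S).comap R.symm.toLinearMap := by
      rw [hW]
      refine Submodule.span_le.2 ?_
      rintro _ ⟨n, hn, rfl⟩
      simp only [Submodule.comap_coe, Set.mem_preimage, LinearEquiv.coe_coe,
        LinearEquiv.symm_apply_apply, SetLike.mem_coe]
      exact Finsupp.single_mem_supported ℂ 1 hn
    intro x hx n hn
    by_contra h0
    exact hn (h hx (Finsupp.mem_support_iff.2 h0))
  have hext : ∀ x ∈ W, (∀ n ∈ S, R.symm x n = 0) → x = 0 := fun x hx h => by
    rw [← R.symm.map_eq_zero_iff]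
    ext n
    by_cases hn : n ∈ S
    · exact h n hn
    · exact hsupp x hx n hn
  refine ⟨fun x h => Subtype.ext (hext x x.2 fun n hn => ?_),
    fun x h => Subtype.ext (hext x x.2 fun n hn => ?_)⟩
  -- Pairing with a basis vector indexed by `S` reads off that coordinate up to the nonzero factor
  -- `d n`. The coordinates outside `S` vanish on `W`.
  · have h1 : B x (R (Finsupp.single n 1)) = 0 := h ⟨_, hmem n hn⟩
    rw [← R.apply_symm_apply (x : V), hB, Finsupp.sum, Finset.sum_eq_single n] at h1
    · simpa [hd n] using h1
    · intro k _ hk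
      simp [hk.symm]
    · intro h0
      simp [Finsupp.notMem_support_iff.1 h0]
  · have h1 : B (R (Finsupp.single n 1)) x = 0 := h ⟨_, hmem n hn⟩
    rw [← R.apply_symm_apply (x : V), hB, Finsupp.sum_single_index (by simp)] at h1
    simpa [hd n] using h1

theorem nondegenerate_diagonal {ι V : Type*} [AddCommGroup V] [Module ℂ V]
    (R : (ι →₀ ℂ) ≃ₗ[ℂ] V) {d : ι → ℂ} (hd : ∀ n, d n ≠ 0) {B : LinearMap.BilinForm ℂ V}
    (hB : ∀ f g, B (R f) (R g) = f.sum fun n c => c * (d n * g n)) : B.Nondegenerate := by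
  have h1 : (⊤ : Submodule ℂ V) =
      Submodule.span ℂ {x | ∃ n ∈ (Set.univ : Set ι), x = R (Finsupp.single n 1)} := by
    symm
    rw [eq_top_iff]
    intro x _
    rw [← R.apply_symm_apply x, ← Finsupp.sum_single (R.symm x), Finsupp.sum, map_sum]
    refine Submodule.sum_mem _ fun n _ => ?_
    rw [← mul_one (R.symm x n), ← smul_eq_mul, ← Finsupp.smul_single, map_smul]
    exact Submodule.smul_mem _ _ (Submodule.subset_span ⟨n, trivial, rfl⟩)
  have h := nondegenerate_restrict_diagonal R hd hB Set.univ h1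
  exact ⟨fun x hx => congrArg Subtype.val (h.1 ⟨x, trivial⟩ fun y => hx y),
    fun x hx => congrArg Subtype.val (h.2 ⟨x, trivial⟩ fun y => hx y)⟩

/-- The diagonal form on star polynomials is carried over along the basis of weight vectors. The
half space is the span of the basis vectors with exponents of one sign, so its nondegeneracy is
inherited. -/
theorem exists_form (hK : K.IsSymm) (hħ : ħ ≠ 0) (hw : IsWeight ħ K 0 ϖ) (hne : ϖ ≠ 0) :
    ∃ B : LinearMap.BilinForm ℂ (regRep ħ K ϖ),
      (∀ (f g : StarPoly m) (x y : regRep ħ K ϖ),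
        (x : Fn m) = starMul ħ K (expr ħ K f) ϖ → (y : Fn m) = starMul ħ K (expr ħ K g) ϖ →
          IsPseudoVacMul ħ K
            (starMul ħ K (expr ħ K f) (starMul ħ K (expr ħ K (iotaMap m g)) ϖ))
            (B x y • (ϖ : Fn m))) ∧
      B.Nondegenerate ∧ (B.restrict (halfRep ħ K ϖ)).Nondegenerate := by
  obtain ⟨R, hR⟩ := exists_regRep_equiv hK hħ hw hne
  obtain ⟨d, hd, hpair⟩ := exists_pairing hK hħ hw
  let B₀ : StarPoly m →ₗ[ℂ] StarPoly m →ₗ[ℂ] ℂ :=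
    Finsupp.linearCombination ℂ fun n => d n • Finsupp.lapply n
  let B : LinearMap.BilinForm ℂ (regRep ħ K ϖ) :=
    B₀.compl₁₂ R.symm.toLinearMap R.symm.toLinearMap
  have hB : ∀ f g, B (R f) (R g) = f.sum fun n c => c * (d n * g n) := by
    intro f g
    simp [B, B₀, Finsupp.linearCombination_apply, Finsupp.sum]
  refine ⟨B, fun f g x y hx hy => ?_, nondegenerate_diagonal R hd hB,
    nondegenerate_restrict_diagonal R hd hB {n | 0 ≤ n ∨ n ≤ 0} ?_⟩
  · have hx' : x = R f := Subtype.ext (hx.trans (hR f).symm)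
    have hy' : y = R g := Subtype.ext (hy.trans (hR g).symm)
    rw [hx', hy', hB]
    exact hpair f g
  · rw [halfRep]
    congr 1
    ext x
    refine exists_congr fun n => and_congr Iff.rfl ?_
    rw [← Subtype.coe_inj, hR, starMul_expr_eq, Finsupp.linearCombination_single, one_smul,
      starMul_starMonomial]

include hK hħ hw in
theorem setOf_isPseudoVacMul : {G : Fn m | ∃ p : MvPolynomial (Idx m) ℂ,
    IsPseudoVacMul ħ K (starMul ħ K (polyFn p) ϖ) G} = {G | ∃ c : ℂ, G = c • (ϖ : Fn m)} := by
  ext G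
  constructor
  · rintro ⟨p, hp⟩
    obtain ⟨f, hf⟩ := exists_starMul_polyFn hK hħ hw p
    rw [← hf] at hp
    exact ⟨f 0, hp.unique (isPseudoVacMul_expr hK hħ hw f)⟩
  · rintro ⟨c, rfl⟩
    refine ⟨exprPoly ħ K (Finsupp.single 0 c), ?_⟩
    rw [← expr_eq]
    simpa using isPseudoVacMul_expr hK hħ hw (Finsupp.single 0 c)

end
end PseudoVacuum

theorem mainTheorem8 (m : ℕ) (ħ : ℝ) (hħ : 0 < ħ) (K : Matrix (Idx m) (Idx m) ℂ)
    (hK : K ∈ frakK0 m) :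
    ∃ E : (Fin m → ℝ) → Fn m,
      -- the star-exponential function exists, is unique, and is `2π`-periodic
      (∀ f, IsStarFlow ħ K 1 f ↔ f = E) ∧
      (∀ (k : Fin m) (t : Fin m → ℝ), E (t + Pi.single k (2 * Real.pi)) = E t) ∧
      ∃ ϖ : Fn m, ϖ = periodMean E ∧
        -- the pseudo-vacuum is a nonzero idempotent
        ϖ ≠ 0 ∧
        IsPseudoVacMul ħ K ϖ ϖ ∧
        -- `ϖ * ℂ[ũ, ṽ] * ϖ = ℂ ϖ`, all products on the left being defined
        (∀ p : MvPolynomial (Idx m) ℂ, ∃ G, IsPseudoVacMul ħ K (starMul ħ K (polyFn p) ϖ) G) ∧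
        {G : Fn m | ∃ p : MvPolynomial (Idx m) ℂ,
            IsPseudoVacMul ħ K (starMul ħ K (polyFn p) ϖ) G} = {G | ∃ c : ℂ, G = c • ϖ} ∧
        -- `f ↦ f * ϖ` identifies the star polynomials with the regular representation space
        (∀ f : StarPoly m, starMul ħ K (expr ħ K f) ϖ ∈ regRep ħ K ϖ) ∧
        (∀ x ∈ regRep ħ K ϖ, ∃! f : StarPoly m, starMul ħ K (expr ħ K f) ϖ = x) ∧
        -- the form `⟨f, g⟩ ϖ = ϖ * f * ι(g) * ϖ` on this space is well defined and nondegenerate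
        ∃ B : LinearMap.BilinForm ℂ (regRep ħ K ϖ),
          (∀ (f g : StarPoly m) (x y : regRep ħ K ϖ),
            (x : Fn m) = starMul ħ K (expr ħ K f) ϖ → (y : Fn m) = starMul ħ K (expr ħ K g) ϖ →
              IsPseudoVacMul ħ K
                (starMul ħ K (expr ħ K f) (starMul ħ K (expr ħ K (iotaMap m g)) ϖ))
                (B x y • ϖ)) ∧
          B.Nondegenerate ∧ (B.restrict (halfRep ħ K ϖ)).Nondegenerate := by
  obtain ⟨φ, hφ, h0, hexp, hper⟩ := exists_log_det hK
  have hflow := isStarFlow_starExp hK hħ.ne' hφ h0 hexp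
  have hw := isWeight_starCoef hK hħ.ne' hφ h0 hexp hper 0
  have hne := starCoef_zero_ne_zero hK hħ.ne' hφ h0 hexp hper
  obtain ⟨R, hR⟩ := exists_regRep_equiv hK.1 hħ.ne' hw hne
  refine ⟨fun t => starExp ħ K φ t, fun f => ⟨fun hf => hf.unique hflow, fun hf => hf ▸ hflow⟩,
    fun k t => congrArg Subtype.val (starExp_periodic hper k t), starCoef ħ hK hφ 0, (periodMean_starExp hK hφ).symm,
    fun h => hne (Subtype.ext h), ?_, fun p => ?_, setOf_isPseudoVacMul hK.1 hħ.ne' hw,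
    starMul_expr_mem, fun x hx => ?_, exists_form hK.1 hħ.ne' hw hne⟩
  -- Idempotence: `ϖ` is a single vector of weight 0, so the flow through it is constant and equals
  -- its mean.
  · have h := isPseudoVacMul_sum {()} (w := fun _ => 0) fun _ => hw
    simpa using h
  · obtain ⟨f, hf⟩ := exists_starMul_polyFn hK.1 hħ.ne' hw p
    exact ⟨_, hf ▸ isPseudoVacMul_expr hK.1 hħ.ne' hw f⟩
  · refine ⟨R.symm ⟨x, hx⟩, ?_, fun f hf => ?_⟩
    · simp only [← hR, LinearEquiv.apply_symm_apply]
    · rw [LinearEquiv.eq_symm_apply]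
      exact Subtype.ext ((hR f).trans hf)
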